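/- **Notation.** Let $0<q<1$. Put $(a;p)_\infty=\prod_{n\ge0}(1-ap^n)$, $(a_1,\dots,a_m;p)_\infty=\prod_i(a_i;p)_\infty$, $\theta(x)=(x,q^2/x;q^2)_\infty$, $\theta(x_1,\dots,x_m)=\prod_i\theta(x_i)$. For $t\ge 0$ let $(a;p)_t=\prod_{n=0}^{t-1}(1-ap^n)$, and for $t<0$ let $(a;p)_t=1/(ap^{t};p)_{-t}$. Basic hypergeometric series ${}_4\phi_3$ are the usual ones, $\iota(s)=s/|s|$, and square roots of non-negative numbers are non-negative. Multiplicative parameters are used: $e_i=q^{2\epsilon_i}$, $s_i=q^{2\sigma_i}$, $Z=q^{2\zeta}$; the $e_i$ and $s_i$ are nonzero reals (the $s_i$, and in the second formula below also some $e_i$, may be negative). Always $e_2/e_1=e_3/e_4$, $\alpha,\alpha'\in\{1,-1\}$, $\beta=\alpha\alpha'$, $z\in\mathbb C\setminus\{0\}$, and $k,r,l\in\mathbb Z$. Let $S_l(A,B)=\sqrt{(-ABq^{2l+1},-AB^{-1}q^{2l+1};q^2)_\infty}$ and $$\kappa_r=\frac{z^r\alpha^r s_4^{-r}q^r}{(zq^{-2r+2}e_1/e_2;q^2)_r}.$$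 Let $R=R^{k,k+r*}_{l,l+r*}(z,\alpha;e_1,e_2;e_3,e_4;s_3,s_4)$ be $$\begin{aligned}R={}&\kappa_r\,z^{-k-r}q^{l-k-r}\,\frac{S_{-k}(e_4^{-1},s_4)\,S_{l+r}(e_2,\alpha s_4)}{S_{-k-r}(e_3^{-1},s_3)\,S_l(e_1,\alpha s_3)}\\ \times\Biggl\{&\frac{(\alpha q^{2(l-k-r)+2}\frac{e_1}{e_3},\,zq^2\frac{s_4}{s_3},\,z^{-1}\frac{s_4}{s_3};q^2)_\infty}{(\alpha z^{-1}q^{2(l-k)}\frac{e_1}{e_4},\,q^2\frac{e_1s_4}{e_2s_3},\,q^{2r}\frac{e_2s_4}{e_1s_3};q^2)_\infty}\,\bigl(q^{-2r+2}\tfrac{e_1}{e_2}s_3s_4;q^2\bigr)_r\\ &\times{}_4\phi_3\!\left[\begin{matrix}-q^{-2(k+r)+1}\frac{s_3}{e_3},\,-\alpha q^{2l+1}e_1s_3,\,zq^{-2r+2}\frac{e_1}{e_2},\,z^{-1}q^{-2r}\frac{e_1}{e_2}\\ \alpha q^{2(l-k-r)+2}\frac{e_1}{e_3},\,q^{-2r+2}\frac{e_1s_3}{e_2s_4},\,q^{-2r+2}\frac{e_1}{e_2}s_3s_4\end{matrix};q^2,q^2\right]\\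 +{}&\frac{(\alpha q^{2(l-k)+2}\frac{e_1s_4}{e_4s_3},\,-q^{-2(k+r)+1}\frac{s_3}{e_3},\,-\alpha q^{2l+1}e_1s_3;q^2)_\infty}{(\alpha z^{-1}q^{2(l-k)}\frac{e_1}{e_4},\,-q^{-2k+1}\frac{s_4}{e_4},\,-\alpha q^{2(l+r)+1}e_2s_4;q^2)_\infty}\cdot\frac{(zq^{-2r+2}\frac{e_1}{e_2},\,z^{-1}q^{-2r}\frac{e_1}{e_2},\,s_4^2q^2;q^2)_\infty}{(q^2\frac{e_1s_4}{e_2s_3},\,q^2\frac{e_1}{e_2}s_3s_4,\,q^{-2r}\frac{e_1s_3}{e_2s_4};q^2)_\infty}\\ &\times{}_4\phi_3\!\left[\begin{matrix}-q^{-2k+1}\frac{s_4}{e_4},\,-\alpha q^{2(l+r)+1}e_2s_4,\,zq^2\frac{s_4}{s_3},\,z^{-1}\frac{s_4}{s_3}\\ \alpha q^{2(l-k)+2}\frac{e_1s_4}{e_4s_3},\,s_4^2q^2,\,q^{2r+2}\frac{e_2s_4}{e_1s_3}\end{matrix};q^2,q^2\right]\Biggr\},\end{aligned}$$ and let $\check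 R$ be $R$ with $s_4$ replaced by $s_4^{-1}$. Let $$c(s_4)=c(z;e_3,e_4;s_3,s_4)=\frac{\sqrt{\theta(-qe_4s_4)\,\theta(-qe_4/s_4)}}{\theta(-qe_4s_4)}\cdot\frac{(q^2\frac{e_4s_4}{e_3s_3},\,q^2\frac{e_4}{e_3}s_3s_4;q^2)_\infty}{(zq^2s_3s_4,\,zq^2s_4/s_3;q^2)_\infty}.$$ Define $r^{k,k+r*}_{l,l+r*}(z,\alpha;\beta,Z;e_1,e_2;e_3,e_4;s_3,s_4)$ by $$\begin{aligned}r^{k,k+r*}_{l,l+r*}=\iota(s_3)\sqrt{\theta(-qe_3s_3,-qe_3/s_3)}\Bigl\{&c(s_4)\,\theta\bigl(-\alpha q e_2s_4,\,-\tfrac{\beta}{\alpha}q\tfrac{Z}{e_2}s_4,\,-\tfrac{\beta}{z}q\tfrac{Z}{e_3s_4}\bigr)R\\-{}&c(s_4^{-1})\,\theta\bigl(-\alpha q \tfrac{e_2}{s_4},\,-\tfrac{\beta}{\alpha}q\tfrac{Z}{e_2s_4},\,-\tfrac{\beta}{z}q\tfrac{Zs_4}{e_3}\bigr)\check R\Bigr\}\end{aligned}$$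 and $$\mathring r^{k,k+r*}_{l,l+r*}=r^{k+r,k*}_{l+r,l*}\bigl(z,\alpha;\beta,Ze_1^2/e_2^2;e_2,e_1;e_4,e_3;s_4,s_3\bigr).$$ Finally let $e_2'=Z/e_2$, $e_1'=e_1e_2'/e_2$ and $$\begin{aligned}\bar r^{k,k+r*}_{l,l+r*}&(z,\alpha;\beta,Z;e_1,e_2;e_3,e_4;s_3,s_4)=\\ &\theta\bigl(-zq^3e_3s_4,\,-\tfrac{\alpha\alpha'}{z}q\tfrac{e_1e_1'}{e_4s_3},\,-\alpha qe_1s_3,\,-\alpha'qe_1's_3\bigr)\,\theta\bigl(-qe_4s_4,-q\tfrac{e_4}{s_4},q^2s_3^2\bigr)\,\bigl(z^{-1}\tfrac{e_2}{e_1};q^2\bigr)_\infty\,\iota(s_3)\,r^{k,k+r*}_{l,l+r*}\\ -{}&\theta\bigl(-zq^3e_4s_3,\,-\tfrac{\alpha\alpha'}{z}q\tfrac{e_2e_2'}{e_3s_4},\,-\alpha qe_2s_4,\,-\alpha'qe_2's_4\bigr)\,\theta\bigl(-qe_3s_3,-q\tfrac{e_3}{s_3},q^2s_4^2\bigr)\,\bigl(z^{-1}\tfrac{e_1}{e_2};q^2\bigr)_\infty\,\iota(s_4)\,\mathring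 r^{k,k+r*}_{l,l+r*}.\end{aligned}$$ At the points considered below some terms of $\bar r$ have poles. The value of $\bar r$ at such a point is by definition the limit of $\bar r$ as $(z,e_4,s_4)\in\mathbb C\times\mathbb R\times\mathbb R$ tends to it, with $\alpha,\beta,Z,e_1,e_2,s_3$ fixed and $e_3=e_2e_4/e_1$, through the parameters at which no denominator in the formulas above vanishes; that the point is a limit point of these parameters and that the limit exists is part of the claim. **Proposition.** Let $e_1,e_2,e_1',e_2'>0$ with $e_2'/e_1'=e_2/e_1$, let $\alpha'\in\{1,-1\}$, let $s=q^{2\sigma_3}$ be a nonzero real number with $s^2\notin q^{2\mathbb Z}$, and let $k,r,l\in\mathbb Z$. Call $(e,s)$ *admissible* if $(1+q^{2n+1}es)(1+q^{2n+1}e/s)>0$ for all $n\in\mathbb Z$. (1) Suppose that $(e_1,s)$ and $(e_2,s)$ are admissible and that none of $e_2/e_1$, $e_2s^2/e_1$, $e_2/(e_1s^2)$ is in $q^{2\mathbb Z}$. Then $$\begin{aligned}\bar r^{k,k+r*}_{l,l+r*}&(1,1;\alpha',e_2e_2';e_1,e_2;e_2,e_1;s,s)=-\delta_{k,l}\,(q^2;q^2)_\infty\,\theta\bigl(\alpha'q^2e_1'e_2,\,\alpha'\tfrac{e_1'}{e_1},\,\tfrac{e_2}{e_1},\,-qe_1s,\,-qe_2s,\,q^2s^2\bigr)\\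 &\times\Bigl\{\theta\bigl(q^2\tfrac{e_2}{e_1}s^2,\,-qe_1s,\,-\alpha'qe_1's,\,-q\tfrac{e_2}{s},\,-\alpha'q\tfrac{e_2'}{s}\bigr)-s^{-2}\,\theta\bigl(q^2\tfrac{e_2}{e_1s^2},\,-q\tfrac{e_1}{s},\,-\alpha'q\tfrac{e_1'}{s},\,-qe_2s,\,-\alpha'qe_2's\bigr)\Bigr\}.\end{aligned}$$ (2) Suppose that $(e_1,-s)$ and $(e_2,s)$ are admissible. Then, both values being defined, $$\bar r^{k,k+r*}_{l,l+r*}(-1,-1;-\alpha',e_2e_2';e_1,e_2;e_2,e_1;s,-s)=(-1)^k\,\bar r^{k,k+r*}_{l,l+r*}(1,1;\alpha',-e_2e_2';-e_1,e_2;e_2,-e_1;s,s).$$ -/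

import Mathlib

open Filter Topology

namespace QInt

noncomputable section

/-! Multiplicative parameters are used throughout: `eᵢ` stands for `q ^ (2 εᵢ)` and `sᵢ` for
`q ^ (2 σᵢ)`, and the base of all shifted factorials and theta functions is `q ^ 2`. -/

/-- The infinite shifted factorial `(a; p)_∞ = ∏_{s ≥ 0} (1 - a p ^ s)`. -/
def qInf {K : Type*} [Field K] [TopologicalSpace K] (a p : K) : K :=
  ∏' s : ℕ, (1 - a * p ^ s)

/-- The product `(a₁, …, aₙ; p)_∞`. -/
def qInfs {K : Type*} [Field K] [TopologicalSpace K] (as : List K) (p : K) : K :=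
  (as.map fun a => qInf a p).prod

/-- The theta function `θ_p(x) = (x, p / x; p)_∞`. -/
def theta {K : Type*} [Field K] [TopologicalSpace K] (x p : K) : K :=
  qInf x p * qInf (p / x) p

/-- The product `θ_p(x₁, …, xₙ)`. -/
def thetas {K : Type*} [Field K] [TopologicalSpace K] (xs : List K) (p : K) : K :=
  (xs.map fun x => theta x p).prod

/-- The finite shifted factorial `(a; p)_t`, `t ≥ 0`. -/
def qFac {K : Type*} [Field K] (a p : K) (t : ℕ) : K :=
  ∏ s ∈ Finset.range t, (1 - a * p ^ s)

/-- The shifted factorial `(a; p)_t` for an integer `t`; it is `1 / (a p ^ t; p)_{-t}` for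
`t < 0`. -/
def qFacZ {K : Type*} [Field K] (a p : K) (t : ℤ) : K :=
  if 0 ≤ t then qFac a p t.toNat else 1 / qFac (a * p ^ t) p (-t).toNat

/-- The basic hypergeometric series `ₘφₙ(a₁, …, aₘ; b₁, …, bₙ; p, w)`, `m ≤ n + 1`. -/
def phi (as bs : List ℂ) (p w : ℂ) : ℂ :=
  ∑' t : ℕ, ((as.map fun a => qFac a p t).prod * w ^ t) /
      (qFac p p t * (bs.map fun b => qFac b p t).prod) *
    ((-1) ^ t * p ^ (t * (t - 1) / 2)) ^ (bs.length + 1 - as.length)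

/-- `S_l(A, B)`, the square root of `(-A B q ^ (2 l + 1), -A B⁻¹ q ^ (2 l + 1); q ^ 2)_∞`. -/
def S (q : ℝ) (l : ℤ) (A B : ℝ) : ℝ :=
  Real.sqrt (qInfs [-A * B * q ^ (2 * l + 1), -A * B⁻¹ * q ^ (2 * l + 1)] (q ^ 2))

/-- The prefactor `κ_r`. -/
def kappa (q : ℝ) (r : ℤ) (z : ℂ) (α e₁ e₂ s₄ : ℝ) : ℂ :=
  z ^ r * α ^ r * s₄ ^ (-r) * q ^ r / qFacZ (z * q ^ (-2 * r + 2) * (e₁ / e₂)) (q ^ 2) r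

/-- The matrix element `R^{k, k+r*}_{l, l+r*}(z, α; e₁, e₂; e₃, e₄; s₃, s₄)`, as a combination of
two nonterminating `₄φ₃` series. -/
def R (q : ℝ) (k r l : ℤ) (z : ℂ) (α e₁ e₂ e₃ e₄ s₃ s₄ : ℝ) : ℂ :=
  kappa q r z α e₁ e₂ s₄ * z ^ (-k - r) * q ^ (l - k - r) *
    (S q (-k) e₄⁻¹ s₄ / S q (-k - r) e₃⁻¹ s₃ : ℝ) *
    (S q (l + r) e₂ (α * s₄) / S q l e₁ (α * s₃) : ℝ) *
  (qInfs (K := ℂ) [α * q ^ (2 * (l - k - r) + 2) * (e₁ / e₃), z * q ^ 2 * (s₄ / s₃), z⁻¹ * (s₄ / s₃)]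
        (q ^ 2) /
      qInfs (K := ℂ) [α * z⁻¹ * q ^ (2 * (l - k)) * (e₁ / e₄), q ^ 2 * (e₁ / e₂) * (s₄ / s₃),
        q ^ (2 * r) * (e₂ / e₁) * (s₄ / s₃)] (q ^ 2) *
      qFacZ (K := ℂ) (q ^ (-2 * r + 2) * (e₁ / e₂) * (s₃ * s₄)) (q ^ 2) r *
      phi [-q ^ (-2 * (k + r) + 1) * (s₃ / e₃), -α * q ^ (2 * l + 1) * (e₁ * s₃),
          z * q ^ (-2 * r + 2) * (e₁ / e₂), z⁻¹ * q ^ (-2 * r) * (e₁ / e₂)]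
        [α * q ^ (2 * (l - k - r) + 2) * (e₁ / e₃),
          q ^ (-2 * r + 2) * (e₁ / e₂) * (s₃ / s₄),
          q ^ (-2 * r + 2) * (e₁ / e₂) * (s₃ * s₄)] (q ^ 2) (q ^ 2) +
    qInfs (K := ℂ) [α * q ^ (2 * (l - k) + 2) * (e₁ / e₄) * (s₄ / s₃),
          -q ^ (-2 * (k + r) + 1) * (s₃ / e₃), -α * q ^ (2 * l + 1) * (e₁ * s₃)] (q ^ 2) /
      qInfs (K := ℂ) [α * z⁻¹ * q ^ (2 * (l - k)) * (e₁ / e₄), -q ^ (-2 * k + 1) * (s₄ / e₄),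
          -α * q ^ (2 * (l + r) + 1) * (e₂ * s₄)] (q ^ 2) *
      (qInfs (K := ℂ) [z * q ^ (-2 * r + 2) * (e₁ / e₂), z⁻¹ * q ^ (-2 * r) * (e₁ / e₂),
          s₄ ^ 2 * q ^ 2] (q ^ 2) /
        qInfs (K := ℂ) [q ^ 2 * (e₁ / e₂) * (s₄ / s₃), q ^ 2 * (e₁ / e₂) * (s₃ * s₄),
          q ^ (-2 * r) * (e₁ / e₂) * (s₃ / s₄)] (q ^ 2)) *
      phi [-q ^ (-2 * k + 1) * (s₄ / e₄), -α * q ^ (2 * (l + r) + 1) * (e₂ * s₄),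
          z * q ^ 2 * (s₄ / s₃), z⁻¹ * (s₄ / s₃)]
        [α * q ^ (2 * (l - k) + 2) * (e₁ / e₄) * (s₄ / s₃), s₄ ^ 2 * q ^ 2,
          q ^ (2 * r + 2) * (e₂ / e₁) * (s₄ / s₃)] (q ^ 2) (q ^ 2))

/-- The sign `ι(s) = s / |s|`. -/
def iota (s : ℝ) : ℝ := s / |s|

/-- `√θ(-q e s, -q e / s)`. -/
def rootTheta (q e s : ℝ) : ℝ :=
  Real.sqrt (thetas [-e * s * q, -e * s⁻¹ * q] (q ^ 2))

/-- The coefficient `c(z; e₃, e₄; s₃, s₄)`, where `e₂ / e₁ = e₃ / e₄`. The root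
`√(θ(-q e₄ / s₄) / θ(-q e₄ s₄))` is taken as `√(θ(-q e₄ s₄) θ(-q e₄ / s₄)) / θ(-q e₄ s₄)`, the
branch for which it is a quotient of the roots used elsewhere; it is the non-negative root
whenever `θ(-q e₄ s₄) > 0`, for instance whenever `e₄ > 0` and `s₄ > 0`. -/
def c (q : ℝ) (z : ℂ) (e₃ e₄ s₃ s₄ : ℝ) : ℂ :=
  (rootTheta q e₄ s₄ / theta (-e₄ * s₄ * q) (q ^ 2) : ℝ) *
    (qInfs (K := ℂ) [q ^ 2 * (e₄ / e₃) * (s₄ / s₃), q ^ 2 * (e₄ / e₃) * (s₃ * s₄)] (q ^ 2) /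
      qInfs (K := ℂ) [z * q ^ 2 * (s₃ * s₄), z * q ^ 2 * (s₄ / s₃)] (q ^ 2))

/-- One of the two summands of `r`, without its common prefactor; the other one is obtained by
`s₄ ↦ s₄⁻¹`, which also turns `R` into `Ř`. -/
def rPart (q : ℝ) (k r l : ℤ) (z : ℂ) (α β Z e₁ e₂ e₃ e₄ s₃ s₄ : ℝ) : ℂ :=
  c q z e₃ e₄ s₃ s₄ *
    thetas (K := ℂ) [-α * e₂ * s₄ * q, -β * α⁻¹ * (Z / e₂) * s₄ * q,
      -β * z⁻¹ * (Z / e₃) * s₄⁻¹ * q] (q ^ 2) *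
    R q k r l z α e₁ e₂ e₃ e₄ s₃ s₄

/-- The combination `r^{k, k+r*}_{l, l+r*}(z, α; β, Z; e₁, e₂; e₃, e₄; s₃, s₄)` of `R` and `Ř`,
where `Z = q ^ (2 ζ)`. -/
def rElt (q : ℝ) (k r l : ℤ) (z : ℂ) (α β Z e₁ e₂ e₃ e₄ s₃ s₄ : ℝ) : ℂ :=
  (iota s₃ * rootTheta q e₃ s₃ : ℝ) *
    (rPart q k r l z α β Z e₁ e₂ e₃ e₄ s₃ s₄ - rPart q k r l z α β Z e₁ e₂ e₃ e₄ s₃ s₄⁻¹)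

/-- The combination `r̊^{k, k+r*}_{l, l+r*}`; here `ε₁ + ε₁' = ζ - 2 (ε₂ - ε₁)`, that is
`q ^ (2 (ε₁ + ε₁')) = Z e₁ ^ 2 / e₂ ^ 2`. -/
def rRing (q : ℝ) (k r l : ℤ) (z : ℂ) (α β Z e₁ e₂ e₃ e₄ s₃ s₄ : ℝ) : ℂ :=
  rElt q (k + r) (-r) (l + r) z α β (Z * e₁ ^ 2 / e₂ ^ 2) e₂ e₁ e₄ e₃ s₄ s₃

/-- The combination `r̄^{k, k+r*}_{l, l+r*}(z, α; β, Z; e₁, e₂; e₃, e₄; s₃, s₄)` of `r` and `r̊`,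
with `α' = β / α`, `e₂' = Z / e₂` and `e₁' = e₁ e₂' / e₂`. -/
def rBar (q : ℝ) (k r l : ℤ) (z : ℂ) (α β Z e₁ e₂ e₃ e₄ s₃ s₄ : ℝ) : ℂ :=
  let α' : ℝ := β / α
  let e₂' : ℝ := Z / e₂
  let e₁' : ℝ := e₁ * e₂' / e₂
  thetas (K := ℂ) [-z * e₃ * s₄ * q ^ 3, -α * α' * z⁻¹ * (e₁ * e₁' / e₄) * s₃⁻¹ * q,
      -α * e₁ * s₃ * q, -α' * e₁' * s₃ * q] (q ^ 2) *
    thetas (K := ℂ) [-e₄ * s₄ * q, -e₄ * s₄⁻¹ * q, s₃ ^ 2 * q ^ 2] (q ^ 2) *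
    qInf (K := ℂ) (z⁻¹ * (e₂ / e₁)) (q ^ 2) * iota s₃ *
    rElt q k r l z α β Z e₁ e₂ e₃ e₄ s₃ s₄ -
  thetas (K := ℂ) [-z * e₄ * s₃ * q ^ 3, -α * α' * z⁻¹ * (e₂ * e₂' / e₃) * s₄⁻¹ * q,
      -α * e₂ * s₄ * q, -α' * e₂' * s₄ * q] (q ^ 2) *
    thetas (K := ℂ) [-e₃ * s₃ * q, -e₃ * s₃⁻¹ * q, s₄ ^ 2 * q ^ 2] (q ^ 2) *
    qInf (K := ℂ) (z⁻¹ * (e₁ / e₂)) (q ^ 2) * iota s₄ *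
    rRing q k r l z α β Z e₁ e₂ e₃ e₄ s₃ s₄

/-- `x` is not an integer power of `q ^ 2`. -/
def NotPow (q : ℝ) (x : ℂ) : Prop := ∀ n : ℤ, x ≠ (q : ℂ) ^ (2 * n)

/-- The radicands attached to the module with parameters `(e, s)` are positive. -/
def Admissible (q e s : ℝ) : Prop :=
  ∀ l : ℤ, 0 < (1 + q ^ (2 * l + 1) * e * s) * (1 + q ^ (2 * l + 1) * e * s⁻¹)

/-- The set of those `(z, e₄, s₄)` for which, with `e₃ = e₂ e₄ / e₁`, none of the denominators
vanishes in the expressions that define `R`, `Ř`, their counterparts in `r̊`, and the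
coefficients `c` (apart from those denominators that `Admissible` controls). -/
def regularSet (q α e₁ e₂ s₃ : ℝ) : Set (ℂ × ℝ × ℝ) :=
  {p | p.1 ≠ 0 ∧ p.2.1 ≠ 0 ∧ p.2.2 ≠ 0 ∧
    NotPow q (p.1 * (e₁ / e₂)) ∧ NotPow q (p.1 * (e₂ / e₁)) ∧
    NotPow q (α * p.1⁻¹ * (e₁ / p.2.1)) ∧
    NotPow q (α * (e₁ / (e₂ * p.2.1 / e₁))) ∧ NotPow q (α * (e₂ / p.2.1)) ∧
    NotPow q (p.2.2 ^ 2) ∧ NotPow q (s₃ ^ 2) ∧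
    ∀ t ∈ ({s₃ * p.2.2, s₃ / p.2.2, p.2.2 / s₃, 1 / (s₃ * p.2.2)} : Set ℝ),
      NotPow q (e₂ / e₁ * t) ∧ NotPow q (α * (e₁ / p.2.1) * t) ∧
      ∀ n : ℕ, 1 ≤ n → p.1 * t * q ^ (2 * n) ≠ 1}

/-- `v` is the value at `(z₀, e₄, s₄)` of
`r̄^{k, k+r*}_{l, l+r*}(z, α; β, Z; e₁, e₂; e₃, e₄; s₃, s₄)` with `e₃ = e₂ e₄ / e₁`:
the point is a limit point of the set on which the defining expression is free of vanishing
denominators, and `r̄` extends continuously from that set to the point, with the value `v`. The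
two parts of `r̄` have poles there, hence the value of `r̄` is the one after their removal. -/
def IsValue (q : ℝ) (k r l : ℤ) (z₀ : ℂ) (α β Z e₁ e₂ e₄ s₃ s₄ : ℝ) (v : ℂ) : Prop :=
  (z₀, e₄, s₄) ∈ closure (regularSet q α e₁ e₂ s₃) ∧
  Tendsto (fun p : ℂ × ℝ × ℝ => rBar q k r l p.1 α β Z e₁ e₂ (e₂ * p.2.1 / e₁) p.2.1 s₃ p.2.2)
    (𝓝[regularSet q α e₁ e₂ s₃] (z₀, e₄, s₄)) (𝓝 v)

end

end QInt

namespace QInt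

/-! Put `p = q ^ 2`. Up to elementary factors, the two-term combination of ₄φ₃ series in `R` is a
Jackson integral of a quotient of infinite products (`phi_combination`, `R_eq`). Multiplied by the
denominators at its end points, such an integral (`jack`) has no poles in its numerator parameters,
so all poles of `r̄` become explicit. The square roots and one infinite product are unchanged by the
exchange of parameters that turns `r` into `r̊`. Hence `r̄` is `rootQuot` times `rBarNum` divided by
`(p ^ (l - k) e₁ / (z e₄); p)_∞` (`rBar_eq`), where `rBarNum` is continuous, and holomorphic in `z`,
near the point in question.

Existence of the value: for `k < l` that last product does not vanish at the point. For `l ≤ k` it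
has a simple zero along `z e₄ = e₁`. On this hypersurface an upper parameter of the integral equals
a lower one times `p ^ (k - l)`, so the integrand is a three-over-three one times a polynomial.
Expanding the polynomial and using the nonterminating `q`-Saalschütz formula (`jack_saalschutz`)
shows that the two summands of `r`, coming from `R` and from `Ř`, coincide there
(`gCore_inv_of_resonant`); the same holds for `r̊`. The numerator therefore vanishes on the
hypersurface, and a removable-singularity theorem with parameters (`exists_tendsto_div_sub`) gives
the limit.

Its evaluation: the limit may be taken along `z = 1`, `s₄ = s₃ = s`, `e₄ = e₁ / u`, `u → 1`. There
the integral of `R` collapses to one term and that of `Ř` is summed by Saalschütz. The three-term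
theta relation, which is additivity of Saalschütz integrals, extracts a factor `θ(u)` from the
difference of the two halves of `r̄` (`half_sub_line`). The quotient `θ(u) / (1 - u p ^ (l - k))`
tends to `(p; p)_∞ ^ 2` if `k = l` and to `0` otherwise, which is the Kronecker delta. The remaining
theta products take the stated form by `theta_four_term`.

Part (2) is a formal symmetry (`rBar_neg`): changing the signs of `z, α, β, s₄` has, up to `(-1) ^
k`, the same effect as changing those of `Z, e₁, e₄`. The existence argument does not depend on the
sign of `e₁`, and the genericity conditions on `e₂ / e₁` hold automatically when this quotient is
negative. -/

/-! ### Shifted factorials: functional equations, zeros, bounds, holomorphy. -/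

theorem summable_norm_geometric_mul {p : ℂ} (hp : ‖p‖ < 1) (a : ℂ) :
    Summable fun n : ℕ => ‖-(a * p ^ n)‖ := by
  simp only [norm_neg, norm_mul, norm_pow]
  exact (summable_geometric_of_lt_one (norm_nonneg _) hp).mul_left _

theorem multipliable_qInf {p : ℂ} (hp : ‖p‖ < 1) (a : ℂ) :
    Multipliable fun n : ℕ => 1 - a * p ^ n := by
  simpa only [sub_eq_add_neg] using
    multipliable_one_add_of_summable (summable_norm_geometric_mul hp a)

theorem qInf_step {p : ℂ} (hp : ‖p‖ < 1) (a : ℂ) :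
    qInf a p = (1 - a) * qInf (a * p) p := by
  have h := tprod_eq_zero_mul' (f := fun n : ℕ => 1 - a * p ^ n)
    (by simpa only [pow_succ', mul_assoc] using multipliable_qInf hp (a * p))
  simpa only [qInf, pow_zero, mul_one, pow_succ', mul_assoc] using h

theorem qFac_zero {K : Type*} [Field K] (a p : K) : qFac a p 0 = 1 := by simp [qFac]

theorem qFac_zero_left {K : Type*} [Field K] (p : K) (n : ℕ) : qFac 0 p n = 1 := by
  simp [qFac]

theorem qFac_succ {K : Type*} [Field K] (a p : K) (n : ℕ) :
    qFac a p (n + 1) = qFac a p n * (1 - a * p ^ n) := by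
  simp [qFac, Finset.prod_range_succ]

theorem qFac_succ' {K : Type*} [Field K] (a p : K) (n : ℕ) :
    qFac a p (n + 1) = (1 - a) * qFac (a * p) p n := by
  simp [qFac, Finset.prod_range_succ', pow_succ', mul_assoc, mul_comm]

theorem qFac_add {K : Type*} [Field K] (a p : K) (m n : ℕ) :
    qFac a p (m + n) = qFac a p m * qFac (a * p ^ m) p n := by
  simp [qFac, Finset.prod_range_add, pow_add, mul_assoc]

theorem qFac_one_left {K : Type*} [Field K] (p : K) {n : ℕ} (hn : n ≠ 0) : qFac 1 p n = 0 := by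
  obtain ⟨m, rfl⟩ := Nat.exists_eq_succ_of_ne_zero hn
  simp [qFac_succ']

theorem qInf_eq_qFac_mul {p : ℂ} (hp : ‖p‖ < 1) (a : ℂ) (n : ℕ) :
    qInf a p = qFac a p n * qInf (a * p ^ n) p := by
  induction n with
  | zero => simp [qFac_zero]
  | succ n ih => rw [ih, qFac_succ, qInf_step hp (a * p ^ n), pow_succ]; ring_nf

theorem qInf_zero (p : ℂ) : qInf 0 p = 1 := by simp [qInf]

theorem qInf_one {p : ℂ} (hp : ‖p‖ < 1) : qInf 1 p = 0 := by rw [qInf_step hp]; simp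

theorem qInf_ne_zero {p : ℂ} (hp : ‖p‖ < 1) {a : ℂ} (h : ∀ n : ℕ, a * p ^ n ≠ 1) :
    qInf a p ≠ 0 := by
  have := tprod_one_add_ne_zero_of_summable (f := fun n : ℕ => -(a * p ^ n))
    (fun n => by rw [← sub_eq_add_neg, sub_ne_zero]; exact (h n).symm)
    (summable_norm_geometric_mul hp a)
  simpa only [qInf, sub_eq_add_neg] using this

theorem qInf_self_ne_zero {p : ℂ} (hp : ‖p‖ < 1) : qInf p p ≠ 0 := by
  refine qInf_ne_zero hp fun n h => ?_
  have h1 : ‖p ^ (n + 1)‖ < 1 := by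
    rw [norm_pow]; exact pow_lt_one₀ (norm_nonneg _) hp (by simp)
  rw [pow_succ', h] at h1
  simp at h1

/-- A bound for the shifted factorials with `‖a‖ ≤ r`. -/
noncomputable def facBound (p : ℂ) (r : ℝ) : ℝ := Real.exp (r * (1 - ‖p‖)⁻¹)

theorem facBound_pos (p : ℂ) (r : ℝ) : 0 < facBound p r := Real.exp_pos _

theorem norm_qFac_le {p : ℂ} (hp : ‖p‖ < 1) {a : ℂ} {r : ℝ} (ha : ‖a‖ ≤ r) (n : ℕ) :
    ‖qFac a p n‖ ≤ facBound p r := by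
  have h1 := (Finset.range n).norm_prod_one_add_sub_one_le (fun n : ℕ => -(a * p ^ n))
  have h2 : ∑ i ∈ Finset.range n, ‖-(a * p ^ i)‖ ≤ r * (1 - ‖p‖)⁻¹ := by
    simp only [norm_neg, norm_mul, norm_pow]
    rw [← Finset.mul_sum]
    have h3 : ∑ i ∈ Finset.range n, ‖p‖ ^ i ≤ (1 - ‖p‖)⁻¹ := by
      rw [← tsum_geometric_of_lt_one (norm_nonneg _) hp]
      exact (summable_geometric_of_lt_one (norm_nonneg _) hp).sum_le_tsum _
        (fun i _ => by positivity)
    exact mul_le_mul ha h3 (by positivity) ((norm_nonneg a).trans ha)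
  have h4 : ‖qFac a p n‖ ≤ ‖qFac a p n - 1‖ + 1 := by
    simpa using norm_add_le (qFac a p n - 1) 1
  simp only [← sub_eq_add_neg] at h1
  have h5 := Real.exp_le_exp.2 h2
  unfold facBound
  unfold qFac at h4 ⊢
  linarith

theorem tendsto_qFac {p : ℂ} (hp : ‖p‖ < 1) (a : ℂ) :
    Tendsto (qFac a p) atTop (𝓝 (qInf a p)) :=
  (multipliable_qInf hp a).hasProd.tendsto_prod_nat

theorem norm_qInf_le {p : ℂ} (hp : ‖p‖ < 1) {a : ℂ} {r : ℝ} (ha : ‖a‖ ≤ r) :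
    ‖qInf a p‖ ≤ facBound p r :=
  le_of_tendsto (tendsto_qFac hp a).norm (Eventually.of_forall fun n => norm_qFac_le hp ha n)

theorem differentiable_qInf {p : ℂ} (hp : ‖p‖ < 1) : Differentiable ℂ fun a => qInf a p := by
  intro a
  have hu : Summable fun n : ℕ => (‖a‖ + 1) * ‖p‖ ^ n :=
    (summable_geometric_of_lt_one (norm_nonneg _) hp).mul_left _
  have h := Summable.hasProdLocallyUniformlyOn_nat_one_add (f := fun (n : ℕ) (x : ℂ) => -(x * p ^ n))
    (K := Metric.ball 0 (‖a‖ + 1)) Metric.isOpen_ball hu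
    (Eventually.of_forall fun n x hx => by
      rw [norm_neg, norm_mul, norm_pow]
      have : ‖x‖ ≤ ‖a‖ + 1 := by simpa using (Metric.mem_ball.1 hx).le
      gcongr) (fun n => by fun_prop)
  have h2 := h.tendstoLocallyUniformlyOn_finsetRange.differentiableOn
    (Eventually.of_forall fun n => by fun_prop) Metric.isOpen_ball
  have h3 := h2.differentiableAt (x := a) (Metric.isOpen_ball.mem_nhds (by simp))
  simpa only [qInf, sub_eq_add_neg] using h3

@[fun_prop]
theorem DifferentiableAt.qInf {E : Type*} [NormedAddCommGroup E] [NormedSpace ℂ E] {p : ℂ}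
    (hp : ‖p‖ < 1) {a : E → ℂ} {x : E} (ha : DifferentiableAt ℂ a x) :
    DifferentiableAt ℂ (fun y => QInt.qInf (a y) p) x :=
  (differentiable_qInf hp (a x)).comp x ha

@[fun_prop]
theorem Continuous.qInf {X : Type*} [TopologicalSpace X] {p : ℂ} (hp : ‖p‖ < 1)
    {a : X → ℂ} (ha : Continuous a) : Continuous fun y => QInt.qInf (a y) p :=
  (differentiable_qInf hp).continuous.comp ha

@[fun_prop]
theorem ContinuousAt.qInf {X : Type*} [TopologicalSpace X] {p : ℂ} (hp : ‖p‖ < 1)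
    {a : X → ℂ} {x : X} (ha : ContinuousAt a x) : ContinuousAt (fun y => QInt.qInf (a y) p) x :=
  (differentiable_qInf hp).continuous.continuousAt.comp ha

/-! ### Theta functions -/

theorem theta_inv (x p : ℂ) (hp : p ≠ 0) : theta (p / x) p = theta x p := by
  unfold theta
  rw [div_div_cancel₀ hp, mul_comm]

theorem theta_mul_base {p : ℂ} (hp : ‖p‖ < 1) (hp0 : p ≠ 0) {x : ℂ} (hx : x ≠ 0) :
    theta x p = -x * theta (x * p) p := by
  unfold theta
  have h : p / (x * p) = 1 / x := by field_simp
  rw [qInf_step hp x, h, qInf_step hp (1 / x), show 1 / x * p = p / x by ring]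
  field_simp
  ring

theorem theta_one {p : ℂ} (hp : ‖p‖ < 1) : theta 1 p = 0 := by simp [theta, qInf_one hp]

theorem theta_inv' {p : ℂ} (hp : ‖p‖ < 1) (hp0 : p ≠ 0) {x : ℂ} (hx : x ≠ 0) :
    theta x⁻¹ p = -x⁻¹ * theta x p := by
  rw [theta_mul_base hp hp0 (inv_ne_zero hx), ← theta_inv x p hp0, div_eq_mul_inv, mul_comm p]

/-- Iterated quasi-periodicity. The square root `q` of `p` turns the exponent `n (n - 1) / 2` of `p`
into an integral power. -/
theorem theta_mul_zpow {p : ℂ} (hp : ‖p‖ < 1) (hp0 : p ≠ 0) {q : ℂ} (hq : p = q ^ 2) {x : ℂ}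
    (hx : x ≠ 0) (n : ℤ) :
    theta (x * p ^ n) p = (-x) ^ (-n) * q ^ (-(n * (n - 1))) * theta x p := by
  have hq0 : q ≠ 0 := by rintro rfl; simp at hq; exact hp0 hq
  have step : ∀ m : ℤ, theta (x * p ^ m) p = -(x * p ^ m) * theta (x * p ^ (m + 1)) p := by
    intro m
    rw [theta_mul_base hp hp0 (mul_ne_zero hx (zpow_ne_zero m hp0)), zpow_add₀ hp0, zpow_one,
      mul_assoc x]
  have key : ∀ m : ℤ, (-x) ^ (-m) * q ^ (-(m * (m - 1))) =
      -(x * p ^ m) * ((-x) ^ (-(m + 1)) * q ^ (-((m + 1) * (m + 1 - 1)))) := by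
    intro m
    have h1 : (-x) ^ (-m) = (-x) * (-x) ^ (-(m + 1)) := by
      rw [← zpow_one_add₀ (neg_ne_zero.2 hx)]; congr 1; ring
    have h2 : q ^ (-(m * (m - 1))) = p ^ m * q ^ (-((m + 1) * (m + 1 - 1))) := by
      rw [hq, ← zpow_natCast q 2, ← zpow_mul, ← zpow_add₀ hq0]; congr 1; push_cast; ring
    rw [h1, h2]; ring
  have hne : ∀ m : ℤ, -(x * p ^ m) ≠ 0 := fun m =>
    neg_ne_zero.2 (mul_ne_zero hx (zpow_ne_zero m hp0))
  induction n with
  | zero => simp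
  | succ n ih =>
    rw [step, key, mul_assoc] at ih
    exact mul_left_cancel₀ (hne _) ih
  | pred n ih =>
    rw [step, key, mul_assoc, show (-(n : ℤ) - 1 + 1) = -n by ring, ih]

theorem theta_ne_zero {p : ℂ} (hp : ‖p‖ < 1) (hp0 : p ≠ 0) {x : ℂ} (hx : x ≠ 0)
    (h : ∀ n : ℤ, x ≠ p ^ n) : theta x p ≠ 0 := by
  refine mul_ne_zero (qInf_ne_zero hp fun n hn => ?_) (qInf_ne_zero hp fun n hn => ?_)
  · refine h (-n) ?_
    rw [zpow_neg, zpow_natCast]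
    exact eq_inv_of_mul_eq_one_left hn
  · refine h (n + 1) ?_
    rw [zpow_add_one₀ hp0, zpow_natCast]
    field_simp at hn
    rw [← hn, mul_comm]

theorem ne_zpow_of_theta_ne_zero {p : ℂ} (hp : ‖p‖ < 1) (hp0 : p ≠ 0) {x : ℂ}
    (h : theta x p ≠ 0) (n : ℤ) : x ≠ p ^ n := by
  rintro rfl
  have := theta_mul_zpow hp hp0 (q := p ^ (1 / 2 : ℂ)) (by
    rw [← Complex.cpow_nat_mul]; simp) one_ne_zero n
  rw [one_mul, theta_one hp, mul_zero] at this
  exact h this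

theorem qInf_ne_zero_of_ne_zpow {p : ℂ} (hp : ‖p‖ < 1) {x : ℂ} (h : ∀ n : ℤ, x ≠ p ^ n) :
    qInf x p ≠ 0 := by
  refine qInf_ne_zero hp fun n hn => h (-n) ?_
  rw [zpow_neg, zpow_natCast]
  exact eq_inv_of_mul_eq_one_left hn

/-! ### The regularised ₄φ₃ series and its analyticity in the parameters. -/

/-- The `n`-th term of `phiReg`. -/
noncomputable def phiTerm (p a b c d e f g : ℂ) (n : ℕ) : ℂ :=
  p ^ n * (qFac a p n * qFac b p n * qFac c p n * qFac d p n) *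
    (qInf (p * p ^ n) p * qInf (e * p ^ n) p * qInf (f * p ^ n) p * qInf (g * p ^ n) p)

/-- The series `(p, e, f, g; p)_∞ ₄φ₃(a, b, c, d; e, f, g; p, p)`, which is entire in all
parameters. -/
noncomputable def phiReg (p a b c d e f g : ℂ) : ℂ := ∑' n, phiTerm p a b c d e f g n

/-- All eight factorials are bounded independently of `n` and of parameters in a fixed ball, and `p
^ n` supplies a geometric majorant. This one bound serves the M-test for summability, joint
continuity and holomorphy. -/
theorem norm_phiTerm_le {p : ℂ} (hp : ‖p‖ < 1) {r : ℝ} (hr : 1 ≤ r) {a b c d e f g : ℂ}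
    (ha : ‖a‖ ≤ r) (hb : ‖b‖ ≤ r) (hc : ‖c‖ ≤ r) (hd : ‖d‖ ≤ r) (he : ‖e‖ ≤ r) (hf : ‖f‖ ≤ r)
    (hg : ‖g‖ ≤ r) (n : ℕ) :
    ‖phiTerm p a b c d e f g n‖ ≤ facBound p r ^ 8 * ‖p‖ ^ n := by
  have h1 : ∀ x : ℂ, ‖x‖ ≤ r → ‖qInf (x * p ^ n) p‖ ≤ facBound p r := fun x hx => by
    refine norm_qInf_le hp ?_
    rw [norm_mul, norm_pow]
    exact (mul_le_of_le_one_right (norm_nonneg _) (pow_le_one₀ (norm_nonneg _) hp.le)).trans hx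
  have hB := (facBound_pos p r).le
  simp only [phiTerm, norm_mul, norm_pow]
  calc _ ≤ ‖p‖ ^ n * (facBound p r * facBound p r * facBound p r * facBound p r) *
        (facBound p r * facBound p r * facBound p r * facBound p r) := by
        gcongr
        · exact norm_qFac_le hp ha n
        · exact norm_qFac_le hp hb n
        · exact norm_qFac_le hp hc n
        · exact norm_qFac_le hp hd n
        · exact h1 p (hp.le.trans hr)
        · exact h1 e he
        · exact h1 f hf
        · exact h1 g hg
    _ = _ := by ring

theorem summable_phiTerm {p : ℂ} (hp : ‖p‖ < 1) (a b c d e f g : ℂ) :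
    Summable (phiTerm p a b c d e f g) := by
  set r : ℝ := 1 + ‖a‖ + ‖b‖ + ‖c‖ + ‖d‖ + ‖e‖ + ‖f‖ + ‖g‖ with hr
  have h := norm_nonneg a
  have h := norm_nonneg b
  have h := norm_nonneg c
  have h := norm_nonneg d
  have h := norm_nonneg e
  have h := norm_nonneg f
  have h := norm_nonneg g
  exact Summable.of_norm_bounded
    ((summable_geometric_of_lt_one (norm_nonneg _) hp).mul_left (facBound p r ^ 8))
    (norm_phiTerm_le hp (by linarith) (by linarith) (by linarith) (by linarith) (by linarith)
      (by linarith) (by linarith) (by linarith))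

@[fun_prop]
theorem DifferentiableAt.qFac {p : ℂ} {n : ℕ} {a : ℂ → ℂ} {x : ℂ} (ha : DifferentiableAt ℂ a x) :
    DifferentiableAt ℂ (fun y => QInt.qFac (a y) p n) x := by
  unfold QInt.qFac
  exact DifferentiableAt.fun_finsetProd fun i _ => (ha.mul_const _).const_sub 1

@[fun_prop]
theorem Continuous.qFac {X : Type*} [TopologicalSpace X] {p : ℂ} {n : ℕ}
    {a : X → ℂ} (ha : Continuous a) : Continuous fun y => QInt.qFac (a y) p n := by
  unfold QInt.qFac
  fun_prop

theorem exists_bound_nhds {X : Type*} [TopologicalSpace X] {x : X} {a b c d e f g : X → ℂ}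
    (ha : ContinuousAt a x) (hb : ContinuousAt b x) (hc : ContinuousAt c x)
    (hd : ContinuousAt d x) (he : ContinuousAt e x) (hf : ContinuousAt f x)
    (hg : ContinuousAt g x) : ∃ r : ℝ, 1 ≤ r ∧ ∀ᶠ y in 𝓝 x, ‖a y‖ ≤ r ∧ ‖b y‖ ≤ r ∧ ‖c y‖ ≤ r ∧
      ‖d y‖ ≤ r ∧ ‖e y‖ ≤ r ∧ ‖f y‖ ≤ r ∧ ‖g y‖ ≤ r := by
  have key : ∀ {u : X → ℂ}, ContinuousAt u x → ∀ r : ℝ, ‖u x‖ < r → ∀ᶠ y in 𝓝 x, ‖u y‖ ≤ r :=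
    fun hu r hr => (hu.norm.eventually_lt_const hr).mono fun _ => le_of_lt
  have h := norm_nonneg (a x)
  have h := norm_nonneg (b x)
  have h := norm_nonneg (c x)
  have h := norm_nonneg (d x)
  have h := norm_nonneg (e x)
  have h := norm_nonneg (f x)
  have h := norm_nonneg (g x)
  obtain ⟨r, hr⟩ : ∃ r : ℝ, r = 1 + ‖a x‖ + ‖b x‖ + ‖c x‖ + ‖d x‖ + ‖e x‖ + ‖f x‖ + ‖g x‖ :=
    ⟨_, rfl⟩
  refine ⟨r, by linarith, ?_⟩
  filter_upwards [key ha r (by linarith), key hb r (by linarith), key hc r (by linarith),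
    key hd r (by linarith), key he r (by linarith), key hf r (by linarith),
    key hg r (by linarith)] with y h1 h2 h3 h4 h5 h6 h7
  exact ⟨h1, h2, h3, h4, h5, h6, h7⟩

theorem continuous_phiTerm {p : ℂ} (hp : ‖p‖ < 1) (n : ℕ) :
    Continuous fun v : Fin 7 → ℂ => phiTerm p (v 0) (v 1) (v 2) (v 3) (v 4) (v 5) (v 6) n := by
  unfold phiTerm
  fun_prop (disch := assumption)

theorem continuous_phiReg {p : ℂ} (hp : ‖p‖ < 1) :
    Continuous fun v : Fin 7 → ℂ => phiReg p (v 0) (v 1) (v 2) (v 3) (v 4) (v 5) (v 6) := by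
  rw [continuous_iff_continuousAt]
  intro v
  obtain ⟨r, hr, h⟩ := exists_bound_nhds (x := v) (a := fun v : Fin 7 → ℂ => v 0)
    (b := fun v => v 1) (c := fun v => v 2) (d := fun v => v 3) (e := fun v => v 4)
    (f := fun v => v 5) (g := fun v => v 6) (continuous_apply 0).continuousAt
    (continuous_apply 1).continuousAt (continuous_apply 2).continuousAt
    (continuous_apply 3).continuousAt (continuous_apply 4).continuousAt
    (continuous_apply 5).continuousAt (continuous_apply 6).continuousAt
  refine ContinuousOn.continuousAt ?_ h
  refine continuousOn_tsum (fun n => (continuous_phiTerm hp n).continuousOn)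
    ((summable_geometric_of_lt_one (norm_nonneg _) hp).mul_left (facBound p r ^ 8)) ?_
  rintro n w ⟨h1, h2, h3, h4, h5, h6, h7⟩
  exact norm_phiTerm_le hp hr h1 h2 h3 h4 h5 h6 h7 n

@[fun_prop]
theorem ContinuousAt.phiReg {X : Type*} [TopologicalSpace X] {p : ℂ} (hp : ‖p‖ < 1) {x : X}
    {a b c d e f g : X → ℂ} (ha : ContinuousAt a x) (hb : ContinuousAt b x)
    (hc : ContinuousAt c x) (hd : ContinuousAt d x) (he : ContinuousAt e x)
    (hf : ContinuousAt f x) (hg : ContinuousAt g x) :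
    ContinuousAt (fun y => QInt.phiReg p (a y) (b y) (c y) (d y) (e y) (f y) (g y)) x := by
  have h : ContinuousAt (fun y => ![a y, b y, c y, d y, e y, f y, g y]) x := by
    rw [continuousAt_pi]
    intro i
    fin_cases i <;> assumption
  exact ContinuousAt.comp (f := fun y => ![a y, b y, c y, d y, e y, f y, g y])
    (continuous_phiReg hp).continuousAt h

@[fun_prop]
theorem Continuous.phiReg {X : Type*} [TopologicalSpace X] {p : ℂ} (hp : ‖p‖ < 1)
    {a b c d e f g : X → ℂ} (ha : Continuous a) (hb : Continuous b)
    (hc : Continuous c) (hd : Continuous d) (he : Continuous e)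
    (hf : Continuous f) (hg : Continuous g) :
    Continuous (fun y => QInt.phiReg p (a y) (b y) (c y) (d y) (e y) (f y) (g y)) :=
  continuous_iff_continuousAt.2 fun _ => ContinuousAt.phiReg hp ha.continuousAt hb.continuousAt
    hc.continuousAt hd.continuousAt he.continuousAt hf.continuousAt hg.continuousAt

theorem DifferentiableOn.phiReg {p : ℂ} (hp : ‖p‖ < 1) {U : Set ℂ} (hU : IsOpen U)
    {a b c d e f g : ℂ → ℂ} (ha : DifferentiableOn ℂ a U) (hb : DifferentiableOn ℂ b U)
    (hc : DifferentiableOn ℂ c U) (hd : DifferentiableOn ℂ d U) (he : DifferentiableOn ℂ e U)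
    (hf : DifferentiableOn ℂ f U) (hg : DifferentiableOn ℂ g U) :
    DifferentiableOn ℂ (fun y => QInt.phiReg p (a y) (b y) (c y) (d y) (e y) (f y) (g y)) U := by
  intro x hx
  have hxU := hU.mem_nhds hx
  obtain ⟨r, hr, h⟩ := exists_bound_nhds (ha.differentiableAt hxU).continuousAt
    (hb.differentiableAt hxU).continuousAt (hc.differentiableAt hxU).continuousAt
    (hd.differentiableAt hxU).continuousAt (he.differentiableAt hxU).continuousAt
    (hf.differentiableAt hxU).continuousAt (hg.differentiableAt hxU).continuousAt
  obtain ⟨V, hV, hVo, hxV⟩ := eventually_nhds_iff.1 (h.and hxU)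
  refine DifferentiableAt.differentiableWithinAt ?_
  refine DifferentiableOn.differentiableAt (s := V) ?_ (hVo.mem_nhds hxV)
  have hd' : ∀ {u : ℂ → ℂ}, DifferentiableOn ℂ u U → ∀ y ∈ V, DifferentiableAt ℂ u y :=
    fun hu y hy => hu.differentiableAt (hU.mem_nhds (hV y hy).2)
  refine Complex.differentiableOn_tsum_of_summable_norm
    ((summable_geometric_of_lt_one (norm_nonneg _) hp).mul_left (facBound p r ^ 8)) ?_ hVo ?_
  · intro n y hy
    have h1 := hd' ha y hy
    have h2 := hd' hb y hy
    have h3 := hd' hc y hy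
    have h4 := hd' hd y hy
    have h5 := hd' he y hy
    have h6 := hd' hf y hy
    have h7 := hd' hg y hy
    refine DifferentiableAt.differentiableWithinAt ?_
    unfold phiTerm
    fun_prop (disch := assumption)
  · intro n y hy
    obtain ⟨h1, h2, h3, h4, h5, h6, h7⟩ := (hV y hy).1
    exact norm_phiTerm_le hp hr h1 h2 h3 h4 h5 h6 h7 n

/-! ### Jackson integrals and the nonterminating q-Saalschütz formula. -/

/-- The Jackson integral from `p / f` to `1` of
`(p x, e x, f x, g x; p)_∞ / (a x, b x, c x, d x; p)_∞`, multiplied by the denominators at both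
end points. -/
noncomputable def jack (p a b c d e f g : ℂ) : ℂ :=
  qInf (a * (p / f)) p * qInf (b * (p / f)) p * qInf (c * (p / f)) p * qInf (d * (p / f)) p *
      phiReg p a b c d e f g -
    p / f * (qInf a p * qInf b p * qInf c p * qInf d p *
      phiReg p (a * (p / f)) (b * (p / f)) (c * (p / f)) (d * (p / f)) (e * (p / f))
        (p * (p / f)) (g * (p / f)))

theorem tendsto_pow_zero {p : ℂ} (hp : ‖p‖ < 1) (a : ℂ) :
    Tendsto (fun n : ℕ => a * p ^ n) atTop (𝓝 0) := by
  simpa using (tendsto_pow_atTop_nhds_zero_of_norm_lt_one hp).const_mul a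

theorem tendsto_qInf_pow {p : ℂ} (hp : ‖p‖ < 1) (a : ℂ) :
    Tendsto (fun n : ℕ => qInf (a * p ^ n) p) atTop (𝓝 1) := by
  rw [← qInf_zero p]
  exact ((differentiable_qInf hp).continuous.tendsto 0).comp (tendsto_pow_zero hp a)

/-- A contiguous relation for the balanced series, up to boundary terms. -/
theorem phiReg_contiguous {p : ℂ} (hp : ‖p‖ < 1) (hp0 : p ≠ 0) {a b d f g : ℂ}
    (ha0 : a ≠ 0) (ha1 : a ≠ 1) (hg0 : g ≠ 0) (hag : a ≠ g) (h : f * g = p * a * b * d) :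
    (b - g) * (d - g) / g * phiReg p (a * p) b 0 d 0 f (g * p) +
      (a - f / p) / a * phiReg p a b 0 d 0 f g = qInf (a * p) p * qInf b p * qInf d p := by
  -- A discrete antiderivative: the balancing condition makes the combination of the two terms
  -- proportional to `G (n + 1) - G n`. The factor `(1 * p ^ n; p)_∞` vanishes at `n = 0`, so only
  -- the limit at infinity survives the telescoping.
  set G : ℕ → ℂ := fun n => qFac a p n * qFac b p n * qFac d p n *
    (qInf (1 * p ^ n) p * qInf (f / p * p ^ n) p * qInf (g * p ^ n) p) with hG
  have hG0 : G 0 = 0 := by simp [hG, qInf_one hp]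
  have hGlim : Tendsto G atTop (𝓝 (qInf a p * qInf b p * qInf d p * (1 * 1 * 1))) :=
    (((tendsto_qFac hp a).mul (tendsto_qFac hp b)).mul (tendsto_qFac hp d)).mul
      (((tendsto_qInf_pow hp 1).mul (tendsto_qInf_pow hp _)).mul (tendsto_qInf_pow hp _))
  set u : ℕ → ℂ := fun n => (b - g) * (d - g) / g * phiTerm p (a * p) b 0 d 0 f (g * p) n +
      (a - f / p) / a * phiTerm p a b 0 d 0 f g n with hu
  have hsum : HasSum u ((b - g) * (d - g) / g * phiReg p (a * p) b 0 d 0 f (g * p) +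
      (a - f / p) / a * phiReg p a b 0 d 0 f g) :=
    ((summable_phiTerm hp _ _ _ _ _ _ _).hasSum.mul_left _).add
      ((summable_phiTerm hp _ _ _ _ _ _ _).hasSum.mul_left _)
  have h1a : (1 : ℂ) - a ≠ 0 := sub_ne_zero.2 (Ne.symm ha1)
  have hag' : a - g ≠ 0 := sub_ne_zero.2 hag
  have hf : f = p * a * b * d / g := by rw [← h]; field_simp
  have step : ∀ n, u n = (G (n + 1) - G n) / (1 - a) := by
    intro n
    have e1 : qFac (a * p) p n = qFac a p n * (1 - a * p ^ n) / (1 - a) := by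
      rw [← qFac_succ, qFac_succ']; field_simp
    have e2 : qInf (g * p ^ n) p = (1 - g * p ^ n) * qInf (g * p * p ^ n) p := by
      rw [qInf_step hp]; ring_nf
    have e3 : qInf (1 * p ^ n) p = (1 - p ^ n) * qInf (p * p ^ n) p := by
      rw [qInf_step hp]; ring_nf
    have e4 : qInf (f / p * p ^ n) p = (1 - f / p * p ^ n) * qInf (f * p ^ n) p := by
      rw [qInf_step hp]; congr 2; field_simp
    have e5 : f / p * p ^ (n + 1) = f * p ^ n := by rw [pow_succ]; field_simp
    simp only [hu, hG, phiTerm, qFac_succ, e5, e1, qFac_zero_left, zero_mul, qInf_zero]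
    rw [show g * p ^ (n + 1) = g * p * p ^ n by ring, show 1 * p ^ (n + 1) = p * p ^ n by ring,
      e2, e3, e4]
    generalize qInf (p * p ^ n) p = x1
    generalize qInf (f * p ^ n) p = x2
    generalize qInf (g * p * p ^ n) p = x3
    generalize qFac a p n = x4
    generalize qFac b p n = x5
    generalize qFac d p n = x6
    generalize p ^ n = X
    rw [hf]
    field_simp
    ring
  have hsum2 : HasSum u ((qInf a p * qInf b p * qInf d p * (1 * 1 * 1) - G 0) / (1 - a)) := by
    have hs : Summable u := hsum.summable
    have ht := hs.hasSum.tendsto_sum_nat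
    have ht2 : Tendsto (fun n => ∑ i ∈ Finset.range n, u i) atTop
        (𝓝 ((qInf a p * qInf b p * qInf d p * (1 * 1 * 1) - G 0) / (1 - a))) := by
      have : (fun n => ∑ i ∈ Finset.range n, u i) = fun n => (G n - G 0) / (1 - a) := by
        funext n
        rw [Finset.sum_congr rfl fun i _ => step i, ← Finset.sum_div, Finset.sum_range_sub]
      rw [this]
      exact (hGlim.sub_const _).div_const _
    rw [← tendsto_nhds_unique ht ht2]
    exact hs.hasSum
  rw [hsum.unique hsum2, hG0, qInf_step hp a]
  field_simp
  ring

/-- The contiguous relation is used at both end points, the second time with all parameters scaled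
by `p / f`. After multiplication by the denominators the two boundary terms are equal, and they
cancel in the difference. -/
theorem jack_contiguous {p : ℂ} (hp : ‖p‖ < 1) (hp0 : p ≠ 0) {a b d f g : ℂ}
    (ha0 : a ≠ 0) (ha1 : a ≠ 1) (ha2 : a * (p / f) ≠ 1) (hb0 : b ≠ 0) (hd0 : d ≠ 0)
    (hf0 : f ≠ 0) (hg0 : g ≠ 0) (hag : a ≠ g) (h : f * g = p * a * b * d) :
    jack p a b 0 d 0 f g =
      (1 - g / b) * (1 - g / d) * jack p (a * p) b 0 d 0 f (g * p) := by
  obtain ⟨w, hw⟩ : ∃ w, w = p / f := ⟨_, rfl⟩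
  have hw0 : w ≠ 0 := hw ▸ div_ne_zero hp0 hf0
  have hgw : g = w * (a * b * d) := by rw [hw]; field_simp; linear_combination h
  have hfw : f = p / w := by rw [hw]; field_simp
  have r1 := phiReg_contiguous hp hp0 ha0 ha1 hg0 hag h
  have r2 := phiReg_contiguous hp hp0 (a := a * w) (b := b * w) (d := d * w) (f := p * w)
    (g := g * w) (mul_ne_zero ha0 hw0) (hw ▸ ha2) (mul_ne_zero hg0 hw0)
    (fun hh => hag (mul_right_cancel₀ hw0 hh)) (by rw [hgw]; ring)
  have hn1 : 1 - a ≠ 0 := sub_ne_zero.2 (Ne.symm ha1)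
  have hn2 : 1 - a * w ≠ 0 := sub_ne_zero.2 (Ne.symm (hw ▸ ha2))
  simp only [jack, ← hw, zero_mul, qInf_zero, mul_one]
  rw [show a * p * w = a * w * p by ring, show g * p * w = g * w * p by ring,
    qInf_step hp a, qInf_step hp (a * w)]
  generalize qInf (a * w * p) p = x1 at *
  generalize qInf (b * w) p = x2 at *
  generalize qInf (d * w) p = x3 at *
  generalize qInf (a * p) p = y1 at *
  generalize qInf b p = y2 at *
  generalize qInf d p = y3 at *
  generalize phiReg p a b 0 d 0 f g = u1 at *
  generalize phiReg p (a * p) b 0 d 0 f (g * p) = u2 at *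
  generalize phiReg p (a * w) (b * w) 0 (d * w) 0 (p * w) (g * w) = u3 at *
  generalize phiReg p (a * w * p) (b * w) 0 (d * w) 0 (p * w) (g * w * p) = u4 at *
  have k1 : (1 - g / b) * (1 - g / d) = (b - g) * (d - g) / g * (w * a) := by
    rw [hgw]; field_simp
  have k2 : (a - f / p) / a * (w * a) = a * w - 1 := by rw [hfw]; field_simp
  have k3 : (b * w - g * w) * (d * w - g * w) / (g * w) = w * ((b - g) * (d - g) / g) := by
    field_simp
  have k4 : (a * w - p * w / p) / (a * w) * (w * a) = w * (a - 1) := by field_simp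
  rw [k3] at r2
  rw [k1]
  linear_combination (w * a) * (y1 * y2 * y3) * r2 - (w * a) * (x1 * x2 * x3) * r1 +
    x1 * x2 * x3 * u1 * k2 - y1 * y2 * y3 * u3 * k4

/-- A countable set has dense complement in `ℂ`. This removes the side conditions from identities
between continuous functions of a parameter. -/
theorem eq_of_eq_off_countable {F G : ℂ → ℂ} (hF : Continuous F) (hG : Continuous G)
    {s : Set ℂ} (hs : s.Countable) (h : ∀ x ∉ s, F x = G x) (x : ℂ) : F x = G x :=
  congrFun (Continuous.ext_on (hs.dense_compl ℂ) hF hG fun y hy => h y hy) x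

/-- The points where `(x; p)_∞` vanishes, together with `0`. -/
def poles (p : ℂ) : Set ℂ := insert 0 (Set.range fun n : ℕ => (p ^ n)⁻¹)

theorem countable_poles (p : ℂ) : (poles p).Countable := (Set.countable_range _).insert 0

theorem mul_pow_ne_one {p : ℂ} (hp0 : p ≠ 0) {x : ℂ} (h : x ∉ poles p) (n : ℕ) :
    x * p ^ n ≠ 1 := fun hh => h (Set.mem_insert_of_mem _ ⟨n, by
      have := pow_ne_zero n hp0
      field_simp
      linear_combination -hh⟩)

theorem ne_zero_of_not_mem_poles {p x : ℂ} (h : x ∉ poles p) : x ≠ 0 :=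
  fun hh => h (hh ▸ Set.mem_insert _ _)

@[fun_prop]
theorem Continuous.jack {X : Type*} [TopologicalSpace X] {p : ℂ} (hp : ‖p‖ < 1) {f : ℂ}
    {a b c d e g : X → ℂ} (ha : Continuous a) (hb : Continuous b)
    (hc : Continuous c) (hd : Continuous d) (he : Continuous e) (hg : Continuous g) :
    Continuous (fun y => QInt.jack p (a y) (b y) (c y) (d y) (e y) f (g y)) := by
  unfold QInt.jack
  fun_prop (disch := assumption)

/-- Iterating the shift `a ↦ a p` and letting `a p ^ n → 0` reduces the integral to its value at `a
= 0`; with `g = κ a` the balancing condition is preserved at each step. The excluded values of `a`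
are countable. -/
theorem jack_iterate {p : ℂ} (hp : ‖p‖ < 1) (hp0 : p ≠ 0) {b d f κ : ℂ} (hb0 : b ≠ 0)
    (hd0 : d ≠ 0) (hf0 : f ≠ 0) (hκ : f * κ = p * b * d) (hκ1 : κ ≠ 1) (a : ℂ) :
    jack p a b 0 d 0 f (κ * a) =
      qInf (κ * a / b) p * qInf (κ * a / d) p * jack p 0 b 0 d 0 f 0 := by
  have hκ0 : κ ≠ 0 := by
    rintro rfl
    simp [hp0, hb0, hd0] at hκ
  have hw0 : p / f ≠ 0 := div_ne_zero hp0 hf0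
  refine eq_of_eq_off_countable (F := fun a => jack p a b 0 d 0 f (κ * a))
    (G := fun a => qInf (κ * a / b) p * qInf (κ * a / d) p * jack p 0 b 0 d 0 f 0)
    (by fun_prop (disch := assumption)) (by fun_prop (disch := assumption))
    (s := poles p ∪ (fun x => x / (p / f)) '' poles p)
    ((countable_poles p).union ((countable_poles p).image _)) ?_ a
  intro a ha
  simp only [Set.mem_union, not_or] at ha
  obtain ⟨ha1, ha2⟩ := ha
  have ha0 := ne_zero_of_not_mem_poles ha1
  have ha3 : a * (p / f) ∉ poles p := fun hh => ha2 ⟨_, hh, by field_simp⟩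
  have key : ∀ n : ℕ, jack p a b 0 d 0 f (κ * a) =
      qFac (κ * a / b) p n * qFac (κ * a / d) p n *
        jack p (a * p ^ n) b 0 d 0 f (κ * (a * p ^ n)) := by
    intro n
    induction n with
    | zero => simp [qFac_zero]
    | succ n ih =>
      have hpn := pow_ne_zero n hp0
      rw [ih, qFac_succ, qFac_succ, jack_contiguous hp hp0 (a := a * p ^ n)
        (mul_ne_zero ha0 hpn) (mul_pow_ne_one hp0 ha1 n) (by
          rw [mul_right_comm]; exact mul_pow_ne_one hp0 ha3 n) hb0 hd0 hf0
          (mul_ne_zero hκ0 (mul_ne_zero ha0 hpn)) (fun hh => hκ1 (by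
            have := mul_ne_zero ha0 hpn
            rw [eq_comm, mul_eq_right₀ this] at hh
            exact hh)) (by linear_combination a * p ^ n * hκ)]
      rw [show a * p ^ n * p = a * p ^ (n + 1) by ring,
        show κ * (a * p ^ n) * p = κ * (a * p ^ (n + 1)) by ring]
      ring
  have hc : Continuous fun x => jack p x b 0 d 0 f (κ * x) := by fun_prop (disch := assumption)
  have hlim := (hc.tendsto 0).comp (tendsto_pow_zero hp a)
  simp only [mul_zero] at hlim
  exact tendsto_nhds_unique tendsto_const_nhds
    ((((tendsto_qFac hp (κ * a / b)).mul (tendsto_qFac hp (κ * a / d))).mul hlim).congr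
      fun n => (key n).symm)

/-- The series with `a = 1` has only one term. -/
theorem phiReg_one {p : ℂ} (b c d e f g : ℂ) :
    phiReg p 1 b c d e f g = qInf p p * qInf e p * qInf f p * qInf g p := by
  rw [phiReg, tsum_eq_single 0]
  · simp [phiTerm, qFac_zero]
  · intro n hn
    simp [phiTerm, qFac_one_left p hn]

/-- For `a = f / p` the series at the end point `p / f` has first parameter `1`, hence a single
term, and the part from the end point `1` carries the factor `(1; p)_∞ = 0`. -/
theorem jack_base {p : ℂ} (hp : ‖p‖ < 1) (hp0 : p ≠ 0) {b d f κ : ℂ} (hf0 : f ≠ 0) :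
    jack p (f / p) b 0 d 0 f (κ * (f / p)) =
      qInf p p * theta f p * qInf b p * qInf d p * qInf κ p := by
  have h1 : f / p * (p / f) = 1 := by field_simp
  have h2 : κ * (f / p) * (p / f) = κ := by field_simp
  have h3 : p / f * qInf (f / p) p * qInf (p * (p / f)) p = - theta f p := by
    rw [theta, qInf_step hp (f / p), qInf_step hp (p / f), show f / p * p = f by field_simp,
      mul_comm p (p / f)]
    field_simp
    ring
  rw [jack, h1, h2, phiReg_one, qInf_one hp]
  simp only [zero_mul, qInf_zero]
  linear_combination (-qInf b p * qInf d p * qInf p p * qInf κ p) * h3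

/-- The nonterminating form of the `q`-Saalschütz summation formula. -/
theorem jack_saalschutz {p : ℂ} (hp : ‖p‖ < 1) (hp0 : p ≠ 0) (a b d : ℂ) {f : ℂ} (hf0 : f ≠ 0) :
    jack p a b 0 d 0 f (p / f * (a * b * d)) =
      qInf p p * theta f p * qInf (p / f * (b * d)) p * qInf (p / f * (a * d)) p *
        qInf (p / f * (a * b)) p := by
  refine eq_of_eq_off_countable (F := fun b => jack p a b 0 d 0 f (p / f * (a * b * d)))
    (G := fun b => qInf p p * theta f p * qInf (p / f * (b * d)) p * qInf (p / f * (a * d)) p *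
        qInf (p / f * (a * b)) p)
    (by fun_prop (disch := assumption)) (by fun_prop (disch := assumption))
    (countable_poles p) ?_ b
  intro b hb
  refine eq_of_eq_off_countable (F := fun d => jack p a b 0 d 0 f (p / f * (a * b * d)))
    (G := fun d => qInf p p * theta f p * qInf (p / f * (b * d)) p * qInf (p / f * (a * d)) p *
        qInf (p / f * (a * b)) p)
    (by fun_prop (disch := assumption)) (by fun_prop (disch := assumption))
    ((countable_poles p).insert (f / (p * b))) ?_ d
  intro d hd
  simp only [Set.mem_insert_iff, not_or] at hd
  have hb0 := ne_zero_of_not_mem_poles hb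
  have hd0 := ne_zero_of_not_mem_poles hd.2
  obtain ⟨κ, hκ⟩ : ∃ κ, κ = p / f * (b * d) := ⟨_, rfl⟩
  have hκ1 : κ ≠ 1 := fun hh => hd.1 (by
    rw [hκ] at hh
    field_simp at hh ⊢
    linear_combination hh)
  have hκ2 : f * κ = p * b * d := by rw [hκ]; field_simp
  have it := jack_iterate hp hp0 hb0 hd0 hf0 hκ2 hκ1
  -- The explicit case `a = f / p` determines the unknown constant `jack p 0 b 0 d 0 f 0` left by
  -- the iteration.
  have h1 := it (f / p)
  rw [jack_base hp hp0 hf0] at h1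
  have h2 := it a
  rw [show κ * (f / p) / b = d by rw [hκ]; field_simp,
    show κ * (f / p) / d = b by rw [hκ]; field_simp] at h1
  have hb1 : qInf b p ≠ 0 := qInf_ne_zero hp fun n => mul_pow_ne_one hp0 hb n
  have hd1 : qInf d p ≠ 0 := qInf_ne_zero hp fun n => mul_pow_ne_one hp0 hd.2 n
  have h3 : jack p 0 b 0 d 0 f 0 = qInf p p * theta f p * qInf κ p := by
    apply mul_left_cancel₀ (mul_ne_zero hd1 hb1)
    rw [← h1]; ring
  rw [show p / f * (a * b * d) = κ * a by rw [hκ]; ring, h2, h3, ← hκ,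
    show κ * a / b = p / f * (a * d) by rw [hκ]; field_simp,
    show κ * a / d = p / f * (a * b) by rw [hκ]; field_simp]
  ring

/-! ### The three-term theta relation from additivity of the Jackson integral. -/

/-- The three-term relation for theta functions. -/
theorem theta_three_term {p : ℂ} (hp : ‖p‖ < 1) (hp0 : p ≠ 0) {a b d f g : ℂ} (ha : a ≠ 0)
    (hb : b ≠ 0) (hd : d ≠ 0) (hf : f ≠ 0) (h : f * g = p * a * b * d) :
    theta f p * theta (g / a) p * theta (g / b) p * theta (g / d) p -
      theta g p * theta (f / a) p * theta (f / b) p * theta (f / d) p =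
    -(p / f) * (theta (p * g / f) p * theta a p * theta b p * theta d p) := by
  have hg : g ≠ 0 := by
    rintro rfl
    simp [hp0, ha, hb, hd] at h
  have hg1 : g = p / f * (a * b * d) := by field_simp; linear_combination h
  have hf1 : f = p / g * (a * b * d) := by field_simp; linear_combination h
  -- The integrand is symmetric in `f` and `g`. It is integrated from `p / f` to `1`, from `p / g`
  -- to `1`, and, in coordinates rescaled by `p / f`, from `p / g` to `p / f`. Each integral is a
  -- product by Saalschütz, and their additivity is the asserted relation.
  have j1 := jack_saalschutz hp hp0 a b d hf
  have j2 := jack_saalschutz hp hp0 a b d hg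
  have j3 := jack_saalschutz hp hp0 (a * (p / f)) (b * (p / f)) (d * (p / f))
    (f := p * g / f) (div_ne_zero (mul_ne_zero hp0 hg) hf)
  rw [← hg1] at j1
  rw [← hf1] at j2
  have e1 : p / (p * g / f) = f / g := by field_simp
  have e2 : f / g * (a * (p / f) * (b * (p / f)) * (d * (p / f))) = p * (p / f) := by
    field_simp; linear_combination -h
  have e3 : f / g * (b * (p / f) * (d * (p / f))) = p / a := by
    field_simp; linear_combination -h
  have e4 : f / g * (a * (p / f) * (d * (p / f))) = p / b := by
    field_simp; linear_combination -h
  have e5 : f / g * (a * (p / f) * (b * (p / f))) = p / d := by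
    field_simp; linear_combination -h
  rw [e1, e2, e3, e4, e5] at j3
  have s1 : ∀ x : ℂ, x * (p / f) * (f / g) = x * (p / g) := fun x => by field_simp
  have s0 : p / g = p / f * (f / g) := by field_simp
  have s4 : p / f * (b * d) = g / a := by field_simp; linear_combination -h
  have s5 : p / f * (a * d) = g / b := by field_simp; linear_combination -h
  have s6 : p / f * (a * b) = g / d := by field_simp; linear_combination -h
  have s7 : p / g * (b * d) = f / a := by field_simp; linear_combination -h
  have s8 : p / g * (a * d) = f / b := by field_simp; linear_combination -h
  have s9 : p / g * (a * b) = f / d := by field_simp; linear_combination -h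
  rw [s4, s5, s6] at j1
  rw [s7, s8, s9] at j2
  have t : ∀ x : ℂ, x ≠ 0 → theta (g / x) p = qInf (g / x) p * qInf (x * (p / g)) p :=
    fun x hx => by rw [theta]; congr 2; field_simp
  have t' : ∀ x : ℂ, x ≠ 0 → theta (f / x) p = qInf (f / x) p * qInf (x * (p / f)) p :=
    fun x hx => by rw [theta]; congr 2; field_simp
  have t'' : ∀ x : ℂ, theta x p = qInf x p * qInf (p / x) p := fun x => rfl
  rw [t a ha, t b hb, t d hd, t' a ha, t' b hb, t' d hd, t'' a, t'' b, t'' d]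
  apply mul_left_cancel₀ (qInf_self_ne_zero hp)
  simp only [jack, e1, zero_mul, qInf_zero, mul_one, s1] at j1 j2 j3
  have hsymm : phiReg p (a * (p / f)) (b * (p / f)) 0 (d * (p / f)) 0 (p * g / f) (p * (p / f)) =
      phiReg p (a * (p / f)) (b * (p / f)) 0 (d * (p / f)) 0 (p * (p / f)) (g * (p / f)) := by
    rw [show g * (p / f) = p * g / f by ring]
    unfold phiReg phiTerm
    congr 1; ext n; ring
  have hsymm2 : phiReg p (a * (p / g)) (b * (p / g)) 0 (d * (p / g)) 0 (p * (f / g)) (p * (p / g))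
      = phiReg p (a * (p / g)) (b * (p / g)) 0 (d * (p / g)) 0 (p * (p / g)) (f * (p / g)) := by
    rw [show f * (p / g) = p * (f / g) by ring]
    unfold phiReg phiTerm
    congr 1; ext n; ring
  have hsymm3 : phiReg p a b 0 d 0 g f = phiReg p a b 0 d 0 f g := by
    unfold phiReg phiTerm
    congr 1; ext n; ring
  rw [hsymm, hsymm2] at j3
  rw [hsymm3] at j2
  linear_combination (-(qInf (a * (p / g)) p * qInf (b * (p / g)) p * qInf (d * (p / g)) p)) * j1 +
    (qInf (a * (p / f)) p * qInf (b * (p / f)) p * qInf (d * (p / f)) p) * j2 +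
    (-(p / f) * qInf a p * qInf b p * qInf d p) * j3 +
    (qInf (a * (p / f)) p * qInf (b * (p / f)) p * qInf (d * (p / f)) p * (qInf a p * qInf b p *
      qInf d p * phiReg p (a * (p / g)) (b * (p / g)) 0 (d * (p / g)) 0 (p * (p / g))
        (f * (p / g)))) * s0

/-! ### Resonant Jackson integrals, whose integrand contains a polynomial factor. -/

/-- A shifted factorial of degree `m` in `x` is a combination of products of two shifted
factorials of total degree `m`. -/
theorem exists_qFac_expansion {p a d : ℂ} (had : ∀ i j : ℕ, a * p ^ i ≠ d * p ^ j)
    (y : ℂ) (m : ℕ) : ∃ C : ℕ × ℕ → ℂ, ∀ x : ℂ, qFac (y * x) p m =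
      ∑ ij ∈ Finset.HasAntidiagonal.antidiagonal m, C ij * (qFac (a * x) p ij.1 * qFac (d * x) p ij.2) := by
  induction m with
  | zero => exact ⟨fun _ => 1, fun x => by simp [qFac_zero]⟩
  | succ m ih =>
    obtain ⟨C, hC⟩ := ih
    -- The new linear factor is a combination of the next factor of `(d x; p)_j` and the next factor
    -- of `(a x; p)_i`; these two are linearly independent because `a p ^ i ≠ d p ^ j`.
    have hsplit : ∀ i j : ℕ, ∃ α β : ℂ, ∀ x : ℂ, 1 - y * x * p ^ m =
        α * (1 - d * x * p ^ j) + β * (1 - a * x * p ^ i) := by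
      intro i j
      have h1 : a * p ^ i - d * p ^ j ≠ 0 := sub_ne_zero.2 (had i j)
      refine ⟨(a * p ^ i - y * p ^ m) / (a * p ^ i - d * p ^ j),
        (y * p ^ m - d * p ^ j) / (a * p ^ i - d * p ^ j), fun x => ?_⟩
      field_simp
      ring
    choose α β hαβ using hsplit
    refine ⟨fun ij => (match ij with
        | (_, 0) => 0
        | (i, j + 1) => C (i, j) * α i j) + (match ij with
        | (0, _) => 0
        | (i + 1, j) => C (i, j) * β i j), fun x => ?_⟩
    simp only [add_mul, Finset.sum_add_distrib]
    rw [Finset.Nat.sum_antidiagonal_succ', Finset.Nat.sum_antidiagonal_succ, qFac_succ, hC x,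
      Finset.sum_mul]
    simp only [zero_mul, zero_add]
    rw [← Finset.sum_add_distrib]
    refine Finset.sum_congr rfl fun ij _ => ?_
    rw [hαβ ij.1 ij.2 x, qFac_succ, qFac_succ]
    ring

/-- Reversal of the factors of a shifted factorial. -/
theorem exists_qFac_reverse {p : ℂ} (hp0 : p ≠ 0) (i : ℕ) :
    ∃ K : ℂ, ∀ x : ℂ, x ≠ 0 → qFac (x / p ^ i) p i = K * x ^ i * qFac (p / x) p i := by
  induction i with
  | zero => exact ⟨1, fun x _ => by simp [qFac_zero]⟩
  | succ i ih =>
    obtain ⟨K, hK⟩ := ih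
    refine ⟨K * (-(p ^ (i + 1))⁻¹), fun x hx => ?_⟩
    have hpi := pow_ne_zero i hp0
    rw [qFac_succ', qFac_succ, show x / p ^ (i + 1) * p = x / p ^ i by rw [pow_succ]; field_simp, hK x hx]
    field_simp
    ring

/-- At `x = w p ^ n` the quotient `(y x; p)_∞ / (y p ^ m x; p)_∞` is the polynomial `(y x; p)_m`.
Multiplying a term by `(a x; p)_i (d x; p)_j` only shifts `a` to `a p ^ i` and `d` to `d p ^ j`.
Here `w` is an end point of the integral, `1` or `p / f`. -/
theorem phiReg_expand {p : ℂ} (hp : ‖p‖ < 1) {a d y : ℂ} {m : ℕ} {C : ℕ × ℕ → ℂ}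
    (hC : ∀ x : ℂ, qFac (y * x) p m =
      ∑ ij ∈ Finset.HasAntidiagonal.antidiagonal m, C ij * (qFac (a * x) p ij.1 * qFac (d * x) p ij.2))
    (b f g w : ℂ) :
    phiReg p (a * w) b (y * w * p ^ m) (d * w) (y * w) f g = qInf (y * w * p ^ m) p *
      ∑ ij ∈ Finset.HasAntidiagonal.antidiagonal m, C ij * (qFac (a * w) p ij.1 * qFac (d * w) p ij.2 *
        phiReg p (a * w * p ^ ij.1) b 0 (d * w * p ^ ij.2) 0 f g) := by
  refine HasSum.tsum_eq ?_
  have h : HasSum (fun n => qInf (y * w * p ^ m) p *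
      ∑ ij ∈ Finset.HasAntidiagonal.antidiagonal m, C ij * (qFac (a * w) p ij.1 * qFac (d * w) p ij.2 *
        phiTerm p (a * w * p ^ ij.1) b 0 (d * w * p ^ ij.2) 0 f g n)) _ :=
    (hasSum_sum fun ij _ =>
      (((summable_phiTerm hp (a * w * p ^ ij.1) b 0 (d * w * p ^ ij.2) 0 f g).hasSum.mul_left
        (qFac (a * w) p ij.1 * qFac (d * w) p ij.2)).mul_left (C ij))).mul_left _
  refine Eq.mp (congrArg (fun u => HasSum u _) (funext fun n => ?_)) h
  symm
  have e1 : qFac (y * w * p ^ m) p n * qInf (y * w * p ^ n) p =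
      qInf (y * w * p ^ m) p * qFac (y * (w * p ^ n)) p m := by
    rw [qInf_eq_qFac_mul hp (y * w * p ^ n) m, qInf_eq_qFac_mul hp (y * w * p ^ m) n]
    ring_nf
  have e2 : ∀ (u : ℂ) (i : ℕ), qFac (u * w) p n * qFac (u * (w * p ^ n)) p i =
      qFac (u * w) p i * qFac (u * w * p ^ i) p n := by
    intro u i
    rw [← mul_assoc u, ← qFac_add, ← qFac_add, add_comm]
  unfold phiTerm
  rw [hC] at e1
  calc _ = p ^ n * (qFac (a * w) p n * qFac b p n * qFac (d * w) p n) *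
        (qInf (p * p ^ n) p * qInf (f * p ^ n) p * qInf (g * p ^ n) p) *
        (qFac (y * w * p ^ m) p n * qInf (y * w * p ^ n) p) := by ring
    _ = _ := by
      rw [e1, mul_left_comm]
      congr 1
      rw [Finset.mul_sum]
      refine Finset.sum_congr rfl fun ij _ => ?_
      simp only [qFac_zero_left, zero_mul, qInf_zero]
      linear_combination C ij * p ^ n * qFac b p n * (qInf (p * p ^ n) p * qInf (f * p ^ n) p *
        qInf (g * p ^ n) p) * (qFac (d * w) p n * qFac (d * (w * p ^ n)) p ij.2) * e2 a ij.1 +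
        C ij * p ^ n * qFac b p n * (qInf (p * p ^ n) p * qInf (f * p ^ n) p *
        qInf (g * p ^ n) p) * (qFac (a * w) p ij.1 * qFac (a * w * p ^ ij.1) p n) * e2 d ij.2

/-- If an upper parameter differs from a lower one by a power of `p`, then the Jackson integrals
to the two other lower parameters are proportional, with a symmetric factor `T`. -/
theorem exists_jack_resonant {p : ℂ} (hp : ‖p‖ < 1) (hp0 : p ≠ 0) {a b d y f g : ℂ} {m : ℕ}
    (ha : a ≠ 0) (hb : b ≠ 0) (hd : d ≠ 0) (hf : f ≠ 0)
    (had : ∀ i j : ℕ, a * p ^ i ≠ d * p ^ j) (h : f * g = p ^ (m + 1) * (a * b * d)) :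
    ∃ T : ℂ, jack p a b (y * p ^ m) d y f g = qInf (y * p ^ m) p * qInf (y * p ^ m * (p / f)) p *
        theta f p * qInf (g / a) p * qInf (g / b) p * qInf (g / d) p * g ^ m * T ∧
      jack p a b (y * p ^ m) d y g f = qInf (y * p ^ m) p * qInf (y * p ^ m * (p / g)) p *
        theta g p * qInf (f / a) p * qInf (f / b) p * qInf (f / d) p * f ^ m * T := by
  have hg : g ≠ 0 := by
    rintro rfl
    simp [hp0, ha, hb, hd] at h
  obtain ⟨C, hC⟩ := exists_qFac_expansion had y m
  choose K hK using exists_qFac_reverse hp0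
  have key : ∀ f g : ℂ, f ≠ 0 → g ≠ 0 → f * g = p ^ (m + 1) * (a * b * d) →
      jack p a b (y * p ^ m) d y f g = qInf (y * p ^ m) p * qInf (y * p ^ m * (p / f)) p *
        theta f p * qInf (g / a) p * qInf (g / b) p * qInf (g / d) p * g ^ m *
        ∑ ij ∈ Finset.HasAntidiagonal.antidiagonal m, qInf p p * C ij * (K ij.1 * K ij.2 / (a ^ ij.1 * d ^ ij.2) *
          (qFac a p ij.1 * (qFac (a * (p / f)) p ij.1 * qFac (a * (p / g)) p ij.1)) *
          (qFac d p ij.2 * (qFac (d * (p / f)) p ij.2 * qFac (d * (p / g)) p ij.2))) := by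
    intro f g hf hg h
    have x1 := phiReg_expand hp hC b f g 1
    have x2 := phiReg_expand hp hC (b * (p / f)) (p * (p / f)) (g * (p / f)) (p / f)
    simp only [mul_one] at x1
    rw [jack, x1, show y * p ^ m * (p / f) = y * (p / f) * p ^ m by ring, x2, Finset.mul_sum,
      Finset.mul_sum, Finset.mul_sum, Finset.mul_sum, Finset.mul_sum, ← Finset.sum_sub_distrib,
      Finset.mul_sum]
    refine Finset.sum_congr rfl fun ij hij => ?_
    obtain ⟨i, j⟩ := ij
    have hij : i + j = m := Finset.HasAntidiagonal.mem_antidiagonal.1 hij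
    subst hij
    have hpi := pow_ne_zero i hp0
    have hpj := pow_ne_zero j hp0
    -- Since `i + j = m`, each summand satisfies the balancing condition of Saalschütz with the same
    -- `f` and `g`.
    have s := jack_saalschutz hp hp0 (a * p ^ i) b (d * p ^ j) hf
    have hgg : p / f * (a * p ^ i * b * (d * p ^ j)) = g := by
      field_simp
      rw [h]; ring
    have s1 : p / f * (b * (d * p ^ j)) = g / a / p ^ i := by
      rw [← hgg]; field_simp
    have s2 : p / f * (a * p ^ i * (d * p ^ j)) = g / b := by
      rw [← hgg]; field_simp
    have s3 : p / f * (a * p ^ i * b) = g / d / p ^ j := by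
      rw [← hgg]; field_simp
    -- Reversing the finite factorials of `g / a / p ^ i` and `g / d / p ^ j` pulls out the power `g
    -- ^ (i + j) = g ^ m`. What is left, `(a p / g; p)_i` and `(d p / g; p)_j`, mirrors the
    -- factorials with `f`.
    rw [hgg, s1, s2, s3, qInf_eq_qFac_mul hp (g / a / p ^ i) i, hK i _ (div_ne_zero hg ha),
      qInf_eq_qFac_mul hp (g / d / p ^ j) j, hK j _ (div_ne_zero hg hd),
      show g / a / p ^ i * p ^ i = g / a by field_simp,
      show g / d / p ^ j * p ^ j = g / d by field_simp,
      show p / (g / a) = a * (p / g) by field_simp, show p / (g / d) = d * (p / g) by field_simp,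
      jack] at s
    simp only [zero_mul, qInf_zero, mul_one] at s
    rw [show a * p ^ i * (p / f) = a * (p / f) * p ^ i by ring,
      show d * p ^ j * (p / f) = d * (p / f) * p ^ j by ring] at s
    rw [qInf_eq_qFac_mul hp a i, qInf_eq_qFac_mul hp d j, qInf_eq_qFac_mul hp (a * (p / f)) i,
      qInf_eq_qFac_mul hp (d * (p / f)) j]
    simp only
    have hs : ∀ c1 c2 : ℂ, (g / a) ^ i * (g / d) ^ j = g ^ (i + j) / (a ^ i * d ^ j) := by
      intro _ _
      rw [div_pow, div_pow, pow_add]; field_simp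
    linear_combination (C (i, j) * qInf (y * p ^ (i + j)) p * qInf (y * (p / f) * p ^ (i + j)) p *
      (qFac a p i * qFac (a * (p / f)) p i * qFac d p j * qFac (d * (p / f)) p j)) * s +
      (C (i, j) * qInf (y * p ^ (i + j)) p * qInf (y * (p / f) * p ^ (i + j)) p *
      (qFac a p i * qFac (a * (p / f)) p i * qFac d p j * qFac (d * (p / f)) p j)) *
      (qInf p p * theta f p * K i * K j * qFac (a * (p / g)) p i * qFac (d * (p / g)) p j *
        qInf (g / a) p * qInf (g / b) p * qInf (g / d) p) * hs 0 0
  refine ⟨_, key f g hf hg h, ?_⟩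
  rw [key g f hg hf (by rw [mul_comm]; exact h)]
  congr 1
  refine Finset.sum_congr rfl fun ij _ => ?_
  rw [mul_comm (qFac (a * (p / g)) p ij.1), mul_comm (qFac (d * (p / g)) p ij.2)]

/-! ### `R` as a Jackson integral. -/

theorem norm_ofReal_sq_lt_one {q : ℝ} (hq0 : 0 < q) (hq1 : q < 1) : ‖(q : ℂ) ^ 2‖ < 1 := by
  rw [norm_pow, Complex.norm_real, Real.norm_of_nonneg hq0.le]
  exact pow_lt_one₀ hq0.le hq1 two_ne_zero

theorem ofReal_qInf {p : ℝ} (hp : ‖p‖ < 1) (a : ℝ) : ((qInf a p : ℝ) : ℂ) = qInf (a : ℂ) p := by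
  have h : Multipliable fun n : ℕ => 1 - a * p ^ n := by
    simp only [sub_eq_add_neg]
    refine multipliable_one_add_of_summable ?_
    simp only [norm_neg, norm_mul, norm_pow]
    exact (summable_geometric_of_lt_one (norm_nonneg _) hp).mul_left _
  have := h.map_tprod Complex.ofRealHom Complex.continuous_ofReal
  simpa [qInf] using this

theorem ofReal_theta {p : ℝ} (hp : ‖p‖ < 1) (x : ℝ) :
    ((theta x p : ℝ) : ℂ) = theta (x : ℂ) p := by
  simp only [theta, Complex.ofReal_mul, ofReal_qInf hp, Complex.ofReal_div]

theorem thetas_cons {K : Type*} [Field K] [TopologicalSpace K] (x : K) (xs : List K) (p : K) :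
    thetas (x :: xs) p = theta x p * thetas xs p := by simp [thetas]

theorem thetas_nil {K : Type*} [Field K] [TopologicalSpace K] (p : K) :
    thetas [] p = 1 := by simp [thetas]

theorem qInfs_cons {K : Type*} [Field K] [TopologicalSpace K] (x : K) (xs : List K) (p : K) :
    qInfs (x :: xs) p = qInf x p * qInfs xs p := by simp [qInfs]

theorem qInfs_nil {K : Type*} [Field K] [TopologicalSpace K] (p : K) :
    qInfs [] p = 1 := by simp [qInfs]

theorem qFac_ne_zero {p : ℂ} (hp : ‖p‖ < 1) {a : ℂ} (h : qInf a p ≠ 0) (n : ℕ) :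
    qFac a p n ≠ 0 := by
  rw [qInf_eq_qFac_mul hp a n] at h
  exact left_ne_zero_of_mul h

theorem qFacZ_eq {p : ℂ} (hp : ‖p‖ < 1) (hp0 : p ≠ 0) {a : ℂ} (r : ℤ)
    (h2 : qInf (a * p ^ r) p ≠ 0) : qFacZ a p r = qInf a p / qInf (a * p ^ r) p := by
  unfold qFacZ
  split_ifs with hr
  · obtain ⟨n, rfl⟩ := Int.eq_ofNat_of_zero_le hr
    simp only [zpow_natCast, Int.toNat_natCast] at h2 ⊢
    rw [qInf_eq_qFac_mul hp a n, mul_div_cancel_right₀ _ h2]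
  · obtain ⟨n, hn⟩ := Int.eq_ofNat_of_zero_le (a := -r) (by omega)
    obtain rfl : r = -n := by omega
    simp only [neg_neg, Int.toNat_natCast] at h2 ⊢
    rw [qInf_eq_qFac_mul hp (a * p ^ (-(n : ℤ))) n] at h2 ⊢
    rw [zpow_neg, zpow_natCast] at h2 ⊢
    have hpn := pow_ne_zero n hp0
    rw [inv_mul_cancel_right₀ hpn] at h2 ⊢
    have := left_ne_zero_of_mul h2
    have := right_ne_zero_of_mul h2
    field_simp

/-- By `(x; p)_∞ / (x; p)_n = (x p ^ n; p)_∞`, multiplying by the infinite factorials of the base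
and of the lower parameters clears every denominator of the series. -/
theorem phi_eq_phiReg {p : ℂ} (hp : ‖p‖ < 1) (a b c d : ℂ) {e f g : ℂ}
    (he : qInf e p ≠ 0) (hf : qInf f p ≠ 0) (hg : qInf g p ≠ 0) :
    phi [a, b, c, d] [e, f, g] p p =
      phiReg p a b c d e f g / (qInf p p * qInf e p * qInf f p * qInf g p) := by
  unfold phi phiReg
  rw [← tsum_div_const]
  congr 1
  funext n
  have key : ∀ x : ℂ, qInf x p ≠ 0 → qInf (x * p ^ n) p = qInf x p / qFac x p n := by
    intro x hx
    rw [qInf_eq_qFac_mul hp x n]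
    field_simp [qFac_ne_zero hp hx n]
  have hpp := qInf_self_ne_zero hp
  have h1 := qFac_ne_zero hp he n
  have h2 := qFac_ne_zero hp hf n
  have h3 := qFac_ne_zero hp hg n
  have h4 := qFac_ne_zero hp hpp n
  simp only [phiTerm, key _ he, key _ hf, key _ hg, key _ hpp, List.map_cons, List.map_nil,
    List.prod_cons, List.prod_nil, List.length_cons, List.length_nil]
  norm_num
  field_simp

/-- The two-term combination of `₄φ₃` series in `R` is a Jackson integral. -/
theorem phi_combination {p : ℂ} (hp : ‖p‖ < 1) (hp0 : p ≠ 0) {a b c d e f g u h gM : ℂ}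
    (hf0 : f ≠ 0) (he : qInf e p ≠ 0) (hef : qInf (e * (p / f)) p ≠ 0) (hf : theta f p ≠ 0)
    (hg : qInf g p ≠ 0) (hgf : qInf (g * (p / f)) p ≠ 0) (haf : qInf (a * (p / f)) p ≠ 0)
    (hbf : qInf (b * (p / f)) p ≠ 0) :
    qInf e p * qInf (c * (p / f)) p * qInf (d * (p / f)) p /
        (qInf u p * qInf h p * qInf (p / f) p) * (qInf g p / qInf gM p) *
        phi [a, b, c, d] [e, f, g] p p +
      qInf (e * (p / f)) p * qInf a p * qInf b p /
        (qInf u p * qInf (a * (p / f)) p * qInf (b * (p / f)) p) *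
        (qInf c p * qInf d p * qInf (g * (p / f)) p /
          (qInf h p * qInf gM p * qInf (f / p) p)) *
        phi [a * (p / f), b * (p / f), c * (p / f), d * (p / f)]
          [e * (p / f), g * (p / f), p * (p / f)] p p =
    jack p a b c d e f g / (qInf p p * qInf (a * (p / f)) p * qInf (b * (p / f)) p * theta f p *
      qInf u p * qInf h p * qInf gM p) := by
  have hpp := qInf_self_ne_zero hp
  obtain ⟨w, hw⟩ : ∃ w, w = p / f := ⟨_, rfl⟩
  have hw0 : w ≠ 0 := hw ▸ div_ne_zero hp0 hf0
  have hfw : f / p = 1 / w := by rw [hw]; field_simp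
  have hF : qInf f p ≠ 0 := left_ne_zero_of_mul hf
  have hPF : qInf w p ≠ 0 := hw ▸ right_ne_zero_of_mul hf
  have hst := qInf_step hp w
  -- Comparing `1 - 1 / w` here with the factor `1 - w` of `(p / f; p)_∞` produces the coefficient
  -- `-w = -(p / f)` of the second end point.
  have hst2 : qInf (f / p) p = (1 - 1 / w) * qInf f p := by
    rw [qInf_step hp, hfw, show 1 / w * p = f by rw [hw]; field_simp]
  rw [mul_comm w p] at hst
  have hP2 : qInf (p * w) p ≠ 0 := right_ne_zero_of_mul (hst ▸ hPF)
  have h1w : 1 - w ≠ 0 := left_ne_zero_of_mul (hst ▸ hPF)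
  have h1w' : w - 1 ≠ 0 := by
    intro hh
    exact h1w (by linear_combination -hh)
  rw [← hw] at hef hgf haf hbf ⊢
  rw [phi_eq_phiReg hp _ _ _ _ he hF hg, phi_eq_phiReg hp _ _ _ _ hef hgf hP2, hst2]
  have hsym : phiReg p (a * w) (b * w) (c * w) (d * w) (e * w) (g * w) (p * w) =
      phiReg p (a * w) (b * w) (c * w) (d * w) (e * w) (p * w) (g * w) := by
    unfold phiReg phiTerm
    congr 1; ext n; ring
  rw [hsym, jack, theta, ← hw, hst]
  generalize phiReg p (a * w) (b * w) (c * w) (d * w) (e * w) (p * w) (g * w) = x1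
  generalize phiReg p a b c d e f g = x2
  generalize qInf (p * w) p = x3 at *
  generalize qInf (e * w) p = x4 at *
  generalize qInf (g * w) p = x5 at *
  generalize qInf (a * w) p = x6 at *
  generalize qInf (b * w) p = x7 at *
  -- `u`, `h` and `gM` occur in the denominators of all three products; if one of these factorials
  -- is zero, everything is `0` by the convention for division by zero.
  by_cases hu : qInf u p = 0
  · simp [hu]
  by_cases hh : qInf h p = 0
  · simp [hh]
  by_cases hgM : qInf gM p = 0
  · simp [hgM]
  have e1 : 1 - 1 / w = (w - 1) / w := by field_simp
  rw [e1, show 1 - w = -(w - 1) by ring]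
  field_simp
  ring

/-- The Jackson integral underlying `R`, with `K = q ^ (2 k)`, `M = q ^ (2 r)`, `L = q ^ (2 l)`
and `α = 1`. -/
noncomputable def coreJack (q K M L z e₁ e₂ e₃ s₃ s₄ : ℂ) : ℂ :=
  jack (q ^ 2) (-(q * s₃ / (K * M * e₃))) (-(q * L * e₁ * s₃)) (z * q ^ 2 * e₁ / (M * e₂))
    (e₁ / (z * M * e₂)) (q ^ 2 * L * e₁ / (K * M * e₃)) (q ^ 2 * e₁ * s₃ / (M * e₂ * s₄))
    (q ^ 2 * e₁ * s₃ * s₄ / (M * e₂))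

/-- The denominators that occur in `R` and in the coefficient in front of it do not vanish. -/
structure Regular (q K M L z e₁ e₂ e₃ e₄ s₃ s₄ : ℂ) : Prop where
  low_e : qInf (q ^ 2 * L * e₁ / (K * M * e₃)) (q ^ 2) ≠ 0
  low_e' : qInf (q ^ 2 * L * e₁ * s₄ / (K * e₄ * s₃)) (q ^ 2) ≠ 0
  low_f : theta (q ^ 2 * e₁ * s₃ / (M * e₂ * s₄)) (q ^ 2) ≠ 0
  low_g : qInf (q ^ 2 * e₁ * s₃ * s₄ / (M * e₂)) (q ^ 2) ≠ 0
  low_g' : qInf (q ^ 2 * s₄ ^ 2) (q ^ 2) ≠ 0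
  up_a' : qInf (-(q * s₄ / (K * e₄))) (q ^ 2) ≠ 0
  up_b' : qInf (-(q * L * M * e₂ * s₄)) (q ^ 2) ≠ 0
  shift_g : qInf (q ^ 2 * e₁ * s₃ * s₄ / e₂) (q ^ 2) ≠ 0
  shift_h : qInf (q ^ 2 * e₁ * s₄ / (e₂ * s₃)) (q ^ 2) ≠ 0
  shift_c : qInf (z * q ^ 2 * e₁ / e₂) (q ^ 2) ≠ 0

theorem kappa_eq {q : ℝ} (hq0 : 0 < q) (hq1 : q < 1) (r : ℤ) {z : ℂ} {e₁ e₂ s₄ : ℝ} {M : ℂ}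
    (hM : M = ((q : ℂ) ^ 2) ^ r)
    (h1 : qInf (z * (q : ℂ) ^ 2 * e₁ / e₂) ((q : ℂ) ^ 2) ≠ 0) :
    kappa q r z 1 e₁ e₂ s₄ = z ^ r * (s₄ : ℂ) ^ (-r) * (q : ℂ) ^ r *
      qInf (z * (q : ℂ) ^ 2 * e₁ / e₂) ((q : ℂ) ^ 2) /
        qInf (z * (q : ℂ) ^ 2 * e₁ / (M * e₂)) ((q : ℂ) ^ 2) := by
  have hqc : (q : ℂ) ≠ 0 := by exact_mod_cast hq0.ne'
  have hp := norm_ofReal_sq_lt_one hq0 hq1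
  have hp0 : (q : ℂ) ^ 2 ≠ 0 := pow_ne_zero 2 hqc
  have hM0 : M ≠ 0 := hM ▸ zpow_ne_zero r hp0
  have E3 : (q : ℂ) ^ (-2 * r + 2) = q ^ 2 / M := by
    rw [show -2 * r + 2 = 2 * (-r) + 2 by ring, zpow_add₀ hqc, zpow_mul, zpow_neg, hM]
    rw [show (q : ℂ) ^ (2 : ℤ) = q ^ 2 from zpow_ofNat _ _]
    field_simp
  have hc : z * (q : ℂ) ^ (-2 * r + 2) * (e₁ / e₂) = z * (q : ℂ) ^ 2 * e₁ / (M * e₂) := by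
    rw [E3]; field_simp
  have hcM : z * (q : ℂ) ^ 2 * e₁ / (M * e₂) * ((q : ℂ) ^ 2) ^ r = z * (q : ℂ) ^ 2 * e₁ / e₂ := by
    rw [← hM]; field_simp
  have h := qFacZ_eq hp hp0 (a := z * (q : ℂ) ^ 2 * e₁ / (M * e₂)) r (by rwa [hcM])
  rw [hcM] at h
  unfold kappa
  rw [hc, h, div_div_eq_mul_div]
  simp

/-- Multiplication by `p / f = M e₂ s₄ / (e₁ s₃)` carries the parameters of the first ₄φ₃ in `R` to
those of the second; for the parameters containing `e₃` this rests on `e₁ e₃ = e₂ e₄`. Thus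
`phi_combination` applies. -/
theorem R_eq {q : ℝ} (hq0 : 0 < q) (hq1 : q < 1) (k r l : ℤ) {z : ℂ} {e₁ e₂ e₃ e₄ s₃ s₄ : ℝ}
    {K M L : ℂ} (hK : K = ((q : ℂ) ^ 2) ^ k) (hM : M = ((q : ℂ) ^ 2) ^ r)
    (hL : L = ((q : ℂ) ^ 2) ^ l) (hz : z ≠ 0) (he₁ : e₁ ≠ 0) (he₂ : e₂ ≠ 0) (he₄ : e₄ ≠ 0)
    (hs₃ : s₃ ≠ 0) (hs₄ : s₄ ≠ 0) (he : e₁ * e₃ = e₂ * e₄)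
    (hr : Regular q K M L z e₁ e₂ e₃ e₄ s₃ s₄) :
    R q k r l z 1 e₁ e₂ e₃ e₄ s₃ s₄ =
      kappa q r z 1 e₁ e₂ s₄ * z ^ (-k - r) * (q : ℂ) ^ (l - k - r) *
      (S q (-k) e₄⁻¹ s₄ / S q (-k - r) e₃⁻¹ s₃ : ℝ) *
      (S q (l + r) e₂ s₄ / S q l e₁ s₃ : ℝ) *
      (coreJack q K M L z e₁ e₂ e₃ s₃ s₄ /
        (qInf ((q : ℂ) ^ 2) (q ^ 2) * qInf (-(q * s₄ / (K * e₄))) ((q : ℂ) ^ 2) *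
        qInf (-(q * L * M * e₂ * s₄)) ((q : ℂ) ^ 2) *
        theta ((q : ℂ) ^ 2 * e₁ * s₃ / (M * e₂ * s₄)) ((q : ℂ) ^ 2) *
        qInf (L * e₁ / (z * K * e₄)) ((q : ℂ) ^ 2) *
        qInf ((q : ℂ) ^ 2 * e₁ * s₄ / (e₂ * s₃)) ((q : ℂ) ^ 2) *
        qInf ((q : ℂ) ^ 2 * e₁ * s₃ * s₄ / e₂) ((q : ℂ) ^ 2))) := by
  have hqc : (q : ℂ) ≠ 0 := by exact_mod_cast hq0.ne'
  have hp := norm_ofReal_sq_lt_one hq0 hq1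
  have hp0 : (q : ℂ) ^ 2 ≠ 0 := pow_ne_zero 2 hqc
  have hK0 : K ≠ 0 := hK ▸ zpow_ne_zero k hp0
  have hM0 : M ≠ 0 := hM ▸ zpow_ne_zero r hp0
  have hL0 : L ≠ 0 := hL ▸ zpow_ne_zero l hp0
  have h2 : (q : ℂ) ^ (2 : ℤ) = q ^ 2 := zpow_ofNat _ _
  have Z : ∀ n : ℤ, (q : ℂ) ^ (2 * n) = ((q : ℂ) ^ 2) ^ n := fun n => by rw [zpow_mul, h2]
  have E1 : (q : ℂ) ^ (-2 * (k + r) + 1) = q / (K * M) := by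
    rw [show -2 * (k + r) + 1 = 2 * (-(k + r)) + 1 by ring, zpow_add₀ hqc, Z, zpow_neg,
      zpow_add₀ hp0, hK, hM, zpow_one]
    field_simp
  have E2 : (q : ℂ) ^ (2 * l + 1) = q * L := by
    rw [zpow_add₀ hqc, Z, hL, zpow_one]; ring
  have E3 : (q : ℂ) ^ (-2 * r + 2) = q ^ 2 / M := by
    rw [show -2 * r + 2 = 2 * (-r) + 2 by ring, zpow_add₀ hqc, Z, zpow_neg, hM, h2]
    field_simp
  have E4 : (q : ℂ) ^ (-2 * r) = 1 / M := by
    rw [show -2 * r = 2 * (-r) by ring, Z, zpow_neg, hM]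
    field_simp
  have E6 : (q : ℂ) ^ (2 * (l - k)) = L / K := by
    rw [Z, zpow_sub₀ hp0, hL, hK]
  have E5 : (q : ℂ) ^ (2 * (l - k - r) + 2) = q ^ 2 * L / (K * M) := by
    rw [zpow_add₀ hqc, Z, zpow_sub₀ hp0, zpow_sub₀ hp0, hL, hK, hM, h2]
    field_simp
  have E7 : (q : ℂ) ^ (2 * r) = M := by rw [Z, hM]
  have E8 : (q : ℂ) ^ (-2 * k + 1) = q / K := by
    rw [show -2 * k + 1 = 2 * (-k) + 1 by ring, zpow_add₀ hqc, Z, zpow_neg, hK, zpow_one]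
    field_simp
  have E9 : (q : ℂ) ^ (2 * (l + r) + 1) = q * L * M := by
    rw [zpow_add₀ hqc, Z, zpow_add₀ hp0, hL, hM, zpow_one]
    ring
  have E10 : (q : ℂ) ^ (2 * (l - k) + 2) = q ^ 2 * L / K := by
    rw [zpow_add₀ hqc, E6, h2]; ring
  have E11 : (q : ℂ) ^ (2 * r + 2) = q ^ 2 * M := by
    rw [zpow_add₀ hqc, E7, h2]; ring
  have hz' := hz
  have c1 : (e₁ : ℂ) ≠ 0 := by exact_mod_cast he₁
  have c2 : (e₂ : ℂ) ≠ 0 := by exact_mod_cast he₂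
  have c4 : (e₄ : ℂ) ≠ 0 := by exact_mod_cast he₄
  have t3 : (s₃ : ℂ) ≠ 0 := by exact_mod_cast hs₃
  have t4 : (s₄ : ℂ) ≠ 0 := by exact_mod_cast hs₄
  have c3 : (e₃ : ℂ) = e₂ * e₄ / e₁ := by
    rw [eq_div_iff c1]
    exact_mod_cast (mul_comm _ _).trans he
  have Af : -(q * s₃ / (K * M * e₃)) * ((q : ℂ) ^ 2 / (q ^ 2 * e₁ * s₃ / (M * e₂ * s₄))) =
      -(q * s₄ / (K * e₄)) := by rw [c3]; field_simp
  have Bf : -(q * L * e₁ * s₃) * ((q : ℂ) ^ 2 / (q ^ 2 * e₁ * s₃ / (M * e₂ * s₄))) =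
      -(q * L * M * e₂ * s₄) := by field_simp
  have Cf : (z * q ^ 2 * e₁ / (M * e₂)) * ((q : ℂ) ^ 2 / (q ^ 2 * e₁ * s₃ / (M * e₂ * s₄))) =
      z * q ^ 2 * (s₄ / s₃) := by field_simp
  have Df : (e₁ / (z * M * e₂)) * ((q : ℂ) ^ 2 / (q ^ 2 * e₁ * s₃ / (M * e₂ * s₄))) =
      z⁻¹ * (s₄ / s₃) := by field_simp
  have Ef : q ^ 2 * L * e₁ / (K * M * e₃) * ((q : ℂ) ^ 2 / (q ^ 2 * e₁ * s₃ / (M * e₂ * s₄))) =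
      q ^ 2 * L * e₁ * s₄ / (K * e₄ * s₃) := by rw [c3]; field_simp
  have Gf : q ^ 2 * e₁ * s₃ * s₄ / (M * e₂) *
      ((q : ℂ) ^ 2 / (q ^ 2 * e₁ * s₃ / (M * e₂ * s₄))) = q ^ 2 * s₄ ^ 2 := by field_simp
  have pf : (q : ℂ) ^ 2 / (q ^ 2 * e₁ * s₃ / (M * e₂ * s₄)) = M * e₂ * s₄ / (e₁ * s₃) := by
    field_simp
  have fp : q ^ 2 * e₁ * s₃ / (M * e₂ * s₄) / (q : ℂ) ^ 2 = e₁ * s₃ / (M * e₂ * s₄) := by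
    field_simp
  have gM : q ^ 2 * e₁ * s₃ * s₄ / (M * e₂) * ((q : ℂ) ^ 2) ^ r = q ^ 2 * e₁ * s₃ * s₄ / e₂ := by
    rw [← hM]; field_simp
  have hgZ := qFacZ_eq hp hp0 (a := q ^ 2 * e₁ * s₃ * s₄ / (M * e₂)) r
    (by rw [gM]; exact hr.shift_g)
  rw [gM] at hgZ
  have pc := phi_combination hp hp0 (a := -(q * s₃ / (K * M * e₃))) (b := -(q * L * e₁ * s₃))
    (c := z * q ^ 2 * e₁ / (M * e₂)) (d := e₁ / (z * M * e₂))
    (e := q ^ 2 * L * e₁ / (K * M * e₃)) (f := q ^ 2 * e₁ * s₃ / (M * e₂ * s₄))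
    (g := q ^ 2 * e₁ * s₃ * s₄ / (M * e₂)) (u := L * e₁ / (z * K * e₄))
    (h := q ^ 2 * e₁ * s₄ / (e₂ * s₃)) (gM := q ^ 2 * e₁ * s₃ * s₄ / e₂)
    (div_ne_zero (mul_ne_zero (mul_ne_zero hp0 c1) t3)
      (mul_ne_zero (mul_ne_zero hM0 c2) t4)) hr.low_e (by rw [Ef]; exact hr.low_e') hr.low_f hr.low_g
    (by rw [Gf]; exact hr.low_g') (by rw [Af]; exact hr.up_a') (by rw [Bf]; exact hr.up_b')
  rw [Af, Bf, Cf, Df, Ef, Gf, pf, fp, ← hgZ] at pc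
  unfold R coreJack
  rw [← pc]
  simp only [qInfs_cons, qInfs_nil, mul_one, one_mul, Complex.ofReal_one]
  rw [E1, E2, E3, E4, E5, E6, E7, E8, E9, E10, E11]
  have T1 : -(q / (K * M)) * (s₃ / e₃ : ℂ) = -(q * s₃ / (K * M * e₃)) := by ring
  have T2 : -1 * (q * L) * (e₁ * s₃ : ℂ) = -(q * L * e₁ * s₃) := by ring
  have T3 : z * (q ^ 2 / M) * (e₁ / e₂ : ℂ) = z * q ^ 2 * e₁ / (M * e₂) := by ring
  have T4 : z⁻¹ * (1 / M) * (e₁ / e₂ : ℂ) = e₁ / (z * M * e₂) := by field_simp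
  have T5 : q ^ 2 * L / (K * M) * (e₁ / e₃ : ℂ) = q ^ 2 * L * e₁ / (K * M * e₃) := by ring
  have T6 : q ^ 2 / M * (e₁ / e₂) * (s₃ / s₄ : ℂ) = q ^ 2 * e₁ * s₃ / (M * e₂ * s₄) := by ring
  have T7 : q ^ 2 / M * (e₁ / e₂) * (s₃ * s₄ : ℂ) = q ^ 2 * e₁ * s₃ * s₄ / (M * e₂) := by ring
  have T8 : -(q / K) * (s₄ / e₄ : ℂ) = -(q * s₄ / (K * e₄)) := by ring
  have T9 : -1 * (q * L * M) * (e₂ * s₄ : ℂ) = -(q * L * M * e₂ * s₄) := by ring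
  have T10 : q ^ 2 * L / K * (e₁ / e₄) * (s₄ / s₃ : ℂ) = q ^ 2 * L * e₁ * s₄ / (K * e₄ * s₃) := by
    ring
  have T11 : (s₄ : ℂ) ^ 2 * q ^ 2 = q ^ 2 * s₄ ^ 2 := by ring
  have T12 : q ^ 2 * M * (e₂ / e₁) * (s₄ / s₃ : ℂ) = q ^ 2 * (M * e₂ * s₄ / (e₁ * s₃)) := by ring
  have T13 : M * (e₂ / e₁) * (s₄ / s₃ : ℂ) = M * e₂ * s₄ / (e₁ * s₃) := by ring
  have T14 : z⁻¹ * (L / K) * (e₁ / e₄ : ℂ) = L * e₁ / (z * K * e₄) := by field_simp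
  have T15 : q ^ 2 * (e₁ / e₂) * (s₄ / s₃ : ℂ) = q ^ 2 * e₁ * s₄ / (e₂ * s₃) := by ring
  have T16 : q ^ 2 * (e₁ / e₂) * (s₃ * s₄ : ℂ) = q ^ 2 * e₁ * s₃ * s₄ / e₂ := by ring
  have T17 : 1 / M * (e₁ / e₂) * (s₃ / s₄ : ℂ) = e₁ * s₃ / (M * e₂ * s₄) := by field_simp
  rw [T1, T2, T3, T4, T5, T6, T7, T8, T9, T10, T11, T12, T13, T14, T15, T16, T17]
  simp only [mul_assoc]

/-! ### Separating the part of `r` that is symmetric under inversion of `s₄`. -/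

theorem S_inv (q : ℝ) (n : ℤ) (A B : ℝ) : S q n A B⁻¹ = S q n A B := by
  simp only [S, qInfs_cons, qInfs_nil, mul_one, inv_inv]
  rw [mul_comm]

theorem rootTheta_inv (q e s : ℝ) : rootTheta q e s⁻¹ = rootTheta q e s := by
  simp only [rootTheta, thetas_cons, thetas_nil, mul_one, inv_inv]
  rw [mul_comm]

theorem norm_sq_lt_one {q : ℝ} (hq0 : 0 < q) (hq1 : q < 1) : ‖q ^ 2‖ < 1 := by
  rw [norm_pow, Real.norm_of_nonneg hq0.le]
  exact pow_lt_one₀ hq0.le hq1 two_ne_zero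

/-- Positivity of the root guarantees a positive radicand; the real square root of a negative number
is `0`. -/
theorem ofReal_S_sq {q : ℝ} (hq0 : 0 < q) (hq1 : q < 1) {n : ℤ} {A B : ℝ}
    (h : 0 < S q n A B) : ((S q n A B : ℝ) : ℂ) ^ 2 =
      qInf (-(q * ((q : ℂ) ^ 2) ^ n * A * B)) ((q : ℂ) ^ 2) *
        qInf (-(q * ((q : ℂ) ^ 2) ^ n * A * (B : ℂ)⁻¹)) ((q : ℂ) ^ 2) := by
  have hqc : (q : ℂ) ≠ 0 := by exact_mod_cast hq0.ne'
  have h' : q ^ (2 * n + 1) = q * (q ^ 2) ^ n := by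
    rw [zpow_add₀ hq0.ne', zpow_mul, zpow_one, mul_comm]; norm_cast
  rw [← Complex.ofReal_pow, S, Real.sq_sqrt (Real.sqrt_pos.1 h).le]
  simp only [qInfs_cons, qInfs_nil, mul_one, Complex.ofReal_mul,
    ofReal_qInf (norm_sq_lt_one hq0 hq1), h']
  push_cast
  ring_nf

/-- The part of `rPart` that is not symmetric under `s₄ ↦ s₄⁻¹`, for `α = 1`. -/
noncomputable def gCore (r : ℤ) (q K M L z β Z e₁ e₂ e₃ e₄ s₃ s₄ : ℂ) : ℂ :=
  theta (-(e₂ * s₄ * q)) (q ^ 2) * theta (-(β * (Z / e₂) * s₄ * q)) (q ^ 2) *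
    theta (-(β * z⁻¹ * (Z / e₃) * s₄⁻¹ * q)) (q ^ 2) *
    (qInf (-(q / (K * e₄ * s₄))) (q ^ 2) * qInf (-(q * L * M * e₂ / s₄)) (q ^ 2)) * s₄ ^ (-r) *
    coreJack q K M L z e₁ e₂ e₃ s₃ s₄ /
    (theta (-(e₄ * s₄ * q)) (q ^ 2) * theta (q ^ 2 * e₁ * s₃ / (M * e₂ * s₄)) (q ^ 2) *
      qInf (z * q ^ 2 * (s₃ * s₄)) (q ^ 2) * qInf (z * q ^ 2 * (s₄ / s₃)) (q ^ 2))

/-- The elementary factor in front of `gCore`. -/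
noncomputable def gFactor (k r l : ℤ) (q M z e₁ e₂ : ℂ) : ℂ :=
  z ^ r * q ^ r * z ^ (-k - r) * q ^ (l - k - r) * qInf (z * q ^ 2 * e₁ / e₂) (q ^ 2) /
    (qInf (z * q ^ 2 * e₁ / (M * e₂)) (q ^ 2) * qInf (q ^ 2) (q ^ 2))

/-- Each root satisfies `S ^ 2 = A A'` with `A'` obtained from `A` by `s₄ ↦ s₄⁻¹`, so `S / A = A' /
S`. As `S` is itself invariant, all dependence on the choice between `s₄` and `s₄⁻¹` moves into
`gCore`. -/
theorem rPart_eq {q : ℝ} (hq0 : 0 < q) (hq1 : q < 1) (k r l : ℤ) {z : ℂ}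
    {β Z e₁ e₂ e₃ e₄ s₃ s₄ : ℝ}
    {K M L : ℂ} (hK : K = ((q : ℂ) ^ 2) ^ k) (hM : M = ((q : ℂ) ^ 2) ^ r)
    (hL : L = ((q : ℂ) ^ 2) ^ l) (hz : z ≠ 0) (he₁ : e₁ ≠ 0) (he₂ : e₂ ≠ 0) (he₄ : e₄ ≠ 0)
    (hs₃ : s₃ ≠ 0) (hs₄ : s₄ ≠ 0) (he : e₁ * e₃ = e₂ * e₄)
    (hr : Regular q K M L z e₁ e₂ e₃ e₄ s₃ s₄) (hS1 : 0 < S q (-k) e₄⁻¹ s₄)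
    (hS2 : 0 < S q (l + r) e₂ s₄) :
    rPart q k r l z 1 β Z e₁ e₂ e₃ e₄ s₃ s₄ =
      (rootTheta q e₄ s₄ / (S q (-k) e₄⁻¹ s₄ * S q (l + r) e₂ s₄ * S q (-k - r) e₃⁻¹ s₃ *
        S q l e₁ s₃) : ℝ) * (gFactor k r l q M z e₁ e₂ / qInf (L * e₁ / (z * K * e₄)) (q ^ 2)) *
      gCore r q K M L z β Z e₁ e₂ e₃ e₄ s₃ s₄ := by
  have hqc : (q : ℂ) ≠ 0 := by exact_mod_cast hq0.ne'
  have hp := norm_ofReal_sq_lt_one hq0 hq1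
  have hp0 : (q : ℂ) ^ 2 ≠ 0 := pow_ne_zero 2 hqc
  have hK0 : K ≠ 0 := hK ▸ zpow_ne_zero k hp0
  have c1 : (e₁ : ℂ) ≠ 0 := by exact_mod_cast he₁
  have c2 : (e₂ : ℂ) ≠ 0 := by exact_mod_cast he₂
  have c4 : (e₄ : ℂ) ≠ 0 := by exact_mod_cast he₄
  have t3 : (s₃ : ℂ) ≠ 0 := by exact_mod_cast hs₃
  have t4 : (s₄ : ℂ) ≠ 0 := by exact_mod_cast hs₄
  have c3 : (e₃ : ℂ) = e₂ * e₄ / e₁ := by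
    rw [eq_div_iff c1]
    exact_mod_cast (mul_comm _ _).trans he
  have q1 := ofReal_S_sq hq0 hq1 hS1
  have q2 := ofReal_S_sq hq0 hq1 hS2
  have n1 : ((S q (-k) e₄⁻¹ s₄ : ℝ) : ℂ) ≠ 0 := by exact_mod_cast hS1.ne'
  have n2 : ((S q (l + r) e₂ s₄ : ℝ) : ℂ) ≠ 0 := by exact_mod_cast hS2.ne'
  rw [zpow_neg, ← hK, Complex.ofReal_inv] at q1
  rw [zpow_add₀ hp0, ← hL, ← hM] at q2
  have a1 : -((q : ℂ) * K⁻¹ * (e₄ : ℂ)⁻¹ * s₄) = -(q * s₄ / (K * e₄)) := by field_simp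
  have a2 : -((q : ℂ) * K⁻¹ * (e₄ : ℂ)⁻¹ * (s₄ : ℂ)⁻¹) = -(q / (K * e₄ * s₄)) := by field_simp
  have a3 : -((q : ℂ) * (L * M) * e₂ * s₄) = -(q * L * M * e₂ * s₄) := by ring
  have a4 : -((q : ℂ) * (L * M) * e₂ * (s₄ : ℂ)⁻¹) = -(q * L * M * e₂ / s₄) := by ring
  rw [a1, a2] at q1
  rw [a3, a4] at q2
  have b1 : (q : ℂ) ^ 2 * (e₄ / e₃) * (s₄ / s₃) = q ^ 2 * e₁ * s₄ / (e₂ * s₃) := by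
    rw [c3]; field_simp
  have b2 : (q : ℂ) ^ 2 * (e₄ / e₃) * (s₃ * s₄) = q ^ 2 * e₁ * s₃ * s₄ / e₂ := by
    rw [c3]; field_simp
  have d1 : (-1 : ℂ) * e₂ * s₄ * q = -(e₂ * s₄ * q) := by ring
  have d2 : -(β : ℂ) * (Z / e₂) * s₄ * q = -(β * (Z / e₂) * s₄ * q) := by ring
  have d3 : -(β : ℂ) * z⁻¹ * (Z / e₃) * (s₄ : ℂ)⁻¹ * q = -(β * z⁻¹ * (Z / e₃) * (s₄ : ℂ)⁻¹ * q) := by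
    ring
  have d4 : -(e₄ : ℂ) * s₄ * q = -(e₄ * s₄ * q) := by ring
  rw [rPart, R_eq hq0 hq1 k r l hK hM hL hz he₁ he₂ he₄ hs₃ hs₄ he hr,
    kappa_eq hq0 hq1 r hM hr.shift_c, c, gCore, gFactor]
  simp only [qInfs_cons, qInfs_nil, thetas_cons, thetas_nil, mul_one, Complex.ofReal_mul,
    Complex.ofReal_div, ofReal_theta (norm_sq_lt_one hq0 hq1), Complex.ofReal_one,
    Complex.ofReal_neg, Complex.ofReal_pow, Complex.ofReal_inv, inv_one]
  rw [b1, b2, d1, d2, d3, d4]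
  have h1 := hr.up_a'
  have h2 := hr.up_b'
  have h3 := hr.shift_g
  have h4 := hr.shift_h
  have e1 : ((S q (-k) e₄⁻¹ s₄ : ℝ) : ℂ) / qInf (-(q * s₄ / (K * e₄))) ((q : ℂ) ^ 2) =
      qInf (-(q / (K * e₄ * s₄))) ((q : ℂ) ^ 2) / (S q (-k) e₄⁻¹ s₄ : ℝ) := by
    rw [div_eq_div_iff h1 n1]
    linear_combination q1
  have e2 : ((S q (l + r) e₂ s₄ : ℝ) : ℂ) / qInf (-(q * L * M * e₂ * s₄)) ((q : ℂ) ^ 2) =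
      qInf (-(q * L * M * e₂ / s₄)) ((q : ℂ) ^ 2) / (S q (l + r) e₂ s₄ : ℝ) := by
    rw [div_eq_div_iff h2 n2]
    linear_combination q2
  have e3 := div_self h3
  have e4 := div_self h4
  simp only [div_eq_mul_inv, mul_inv] at e1 e2 e3 e4 ⊢
  generalize qInf (q ^ 2 * e₁ * s₄ * ((e₂ : ℂ)⁻¹ * (s₃ : ℂ)⁻¹)) ((q : ℂ) ^ 2) = H at *
  generalize qInf (q ^ 2 * e₁ * s₃ * s₄ * (e₂ : ℂ)⁻¹) ((q : ℂ) ^ 2) = G at *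
  generalize theta (-(e₂ * s₄ * q) : ℂ) ((q : ℂ) ^ 2) = y1
  generalize theta (-(β * (Z * (e₂ : ℂ)⁻¹) * s₄ * q) : ℂ) ((q : ℂ) ^ 2) = y2
  generalize theta (-(β * z⁻¹ * (Z * (e₃ : ℂ)⁻¹) * (s₄ : ℂ)⁻¹ * q) : ℂ) ((q : ℂ) ^ 2) = y3
  generalize theta (-(e₄ * s₄ * q) : ℂ) ((q : ℂ) ^ 2) = y4
  generalize coreJack q K M L z e₁ e₂ e₃ s₃ s₄ = J
  generalize qInf (-(q * s₄ * (K⁻¹ * (e₄ : ℂ)⁻¹))) ((q : ℂ) ^ 2) = A at *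
  generalize qInf (-(q * L * M * e₂ * s₄)) ((q : ℂ) ^ 2) = B at *
  generalize qInf (-(q * (K⁻¹ * (e₄ : ℂ)⁻¹ * (s₄ : ℂ)⁻¹))) ((q : ℂ) ^ 2) = A' at *
  generalize qInf (-(q * L * M * e₂ * (s₄ : ℂ)⁻¹)) ((q : ℂ) ^ 2) = B' at *
  generalize ((S q (-k) e₄⁻¹ s₄ : ℝ) : ℂ) = S1 at *
  generalize ((S q (l + r) e₂ s₄ : ℝ) : ℂ) = S2 at *
  have A1 : A⁻¹ = A' * S1⁻¹ * S1⁻¹ := by rw [← e1]; field_simp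
  have B1 : B⁻¹ = B' * S2⁻¹ * S2⁻¹ := by rw [← e2]; field_simp
  have m1 := mul_inv_cancel₀ n1
  have m2 := mul_inv_cancel₀ n2
  rw [A1, B1]
  have key : S1 * S1⁻¹ * (S2 * S2⁻¹) * (H * H⁻¹) * (G * G⁻¹) = 1 := by
    rw [m1, m2, e3, e4]; norm_num
  generalize S1⁻¹ = S1' at *
  generalize S2⁻¹ = S2' at *
  generalize H⁻¹ = H' at *
  generalize G⁻¹ = G' at *
  refine Eq.trans ?_ (mul_one _)
  rw [← key]
  ring

/-! ### Coincidence of the two summands of `r` on the polar hypersurface. -/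

/-- The right-hand side is visibly invariant under `s₄ ↦ s₄⁻¹` when `c` and `T` are. The factorials
left by `hJ` pair with those of `gCore` into shifted theta functions, and quasi-periodicity removes
the shifts. -/
theorem gCore_resonant {q K M L z β Z e₁ e₂ e₃ e₄ s₃ s₄ T c : ℂ} {k r l : ℤ} {m : ℕ}
    (hq : q ≠ 0) (hp : ‖q ^ 2‖ < 1) (hK : K = (q ^ 2) ^ k) (hM : M = (q ^ 2) ^ r)
    (hL : L = (q ^ 2) ^ l) (hm : k = l + m) (hz : z ≠ 0) (he₂ : e₂ ≠ 0) (he₃ : e₃ ≠ 0)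
    (he₄ : e₄ ≠ 0) (hs₄ : s₄ ≠ 0) (hze₃ : z * e₃ = e₂)
    (h1 : theta (-(e₄ * s₄ * q)) (q ^ 2) ≠ 0)
    (h2 : theta (q ^ 2 * e₁ * s₃ / (M * e₂ * s₄)) (q ^ 2) ≠ 0)
    (h3 : qInf (z * q ^ 2 * (s₃ * s₄)) (q ^ 2) ≠ 0)
    (h4 : qInf (z * q ^ 2 * (s₄ / s₃)) (q ^ 2) ≠ 0)
    (hJ : coreJack q K M L z e₁ e₂ e₃ s₃ s₄ = qInf c (q ^ 2) *
      qInf (z * q ^ 2 * (s₄ / s₃)) (q ^ 2) * theta (q ^ 2 * e₁ * s₃ / (M * e₂ * s₄)) (q ^ 2) *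
      qInf (-(q * K * e₄ * s₄)) (q ^ 2) * qInf (-(q * s₄ / (L * M * e₂))) (q ^ 2) *
      qInf (z * q ^ 2 * (s₃ * s₄)) (q ^ 2) * (q ^ 2 * e₁ * s₃ * s₄ / (M * e₂)) ^ m * T) :
    gCore r q K M L z β Z e₁ e₂ e₃ e₄ s₃ s₄ =
      theta (-(e₂ * s₄ * q)) (q ^ 2) * theta (-(e₂ * s₄⁻¹ * q)) (q ^ 2) *
      (theta (-(β * (Z / e₂) * s₄ * q)) (q ^ 2) * theta (-(β * (Z / e₂) * s₄⁻¹ * q)) (q ^ 2)) *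
      (qInf c (q ^ 2) * T * ((e₄ * q) ^ (-k) * q ^ (-(k * (k - 1))) * ((e₂ * q) ^ (-(l + r)) *
        q ^ (-((l + r) * (l + r - 1)))) * (q ^ 2 * e₁ * s₃ / (M * e₂)) ^ m)) := by
  have hp0 : q ^ 2 ≠ 0 := pow_ne_zero 2 hq
  have hK0 : K ≠ 0 := hK ▸ zpow_ne_zero k hp0
  have hM0 : M ≠ 0 := hM ▸ zpow_ne_zero r hp0
  have hL0 : L ≠ 0 := hL ▸ zpow_ne_zero l hp0
  have t1 : qInf (-(q * K * e₄ * s₄)) (q ^ 2) * qInf (-(q / (K * e₄ * s₄))) (q ^ 2) =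
      (e₄ * s₄ * q) ^ (-k) * q ^ (-(k * (k - 1))) * theta (-(e₄ * s₄ * q)) (q ^ 2) := by
    have := theta_mul_zpow hp hp0 rfl (x := -(e₄ * s₄ * q))
      (neg_ne_zero.2 (mul_ne_zero (mul_ne_zero he₄ hs₄) hq)) k
    rw [neg_neg] at this
    rw [← this, theta, ← hK]
    congr 2
    · ring
    · field_simp
  have t2 : qInf (-(q * s₄ / (L * M * e₂))) (q ^ 2) * qInf (-(q * L * M * e₂ / s₄)) (q ^ 2) =
      (e₂ * s₄⁻¹ * q) ^ (-(l + r)) * q ^ (-((l + r) * (l + r - 1))) *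
        theta (-(e₂ * s₄⁻¹ * q)) (q ^ 2) := by
    have := theta_mul_zpow hp hp0 rfl (x := -(e₂ * s₄⁻¹ * q))
      (neg_ne_zero.2 (mul_ne_zero (mul_ne_zero he₂ (inv_ne_zero hs₄)) hq)) (l + r)
    rw [neg_neg] at this
    rw [← this, theta, mul_comm, zpow_add₀ hp0, ← hL, ← hM]
    congr 2
    · field_simp
    · field_simp
  have t3 : -(β * z⁻¹ * (Z / e₃) * s₄⁻¹ * q) = -(β * (Z / e₂) * s₄⁻¹ * q) := by
    rw [← hze₃]; field_simp
  -- The total exponent of `s₄` is `-k + (l + r) - r + m`, which is `0` because `k = l + m`.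
  have t4 : (e₄ * s₄ * q) ^ (-k) * (e₂ * s₄⁻¹ * q) ^ (-(l + r)) * s₄ ^ (-r) *
      (q ^ 2 * e₁ * s₃ * s₄ / (M * e₂)) ^ m = (e₄ * q) ^ (-k) * (e₂ * q) ^ (-(l + r)) *
        (q ^ 2 * e₁ * s₃ / (M * e₂)) ^ m := by
    rw [show e₄ * s₄ * q = e₄ * q * s₄ by ring, show e₂ * s₄⁻¹ * q = e₂ * q * s₄⁻¹ by ring,
      mul_div_right_comm, mul_zpow (e₄ * q), mul_zpow (e₂ * q), mul_pow, inv_zpow, ← zpow_neg]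
    have : s₄ ^ (-k) * s₄ ^ (- -(l + r)) * s₄ ^ (-r) * s₄ ^ m = 1 := by
      rw [← zpow_natCast s₄ m, ← zpow_add₀ hs₄, ← zpow_add₀ hs₄, ← zpow_add₀ hs₄, hm]
      rw [show -(l + (m : ℤ)) + - -(l + r) + -r + m = 0 by ring, zpow_zero]
    linear_combination ((e₄ * q) ^ (-k) * (e₂ * q) ^ (-(l + r)) *
        (q ^ 2 * e₁ * s₃ / (M * e₂)) ^ m) * this
  unfold gCore
  rw [hJ, t3, div_eq_iff (mul_ne_zero (mul_ne_zero (mul_ne_zero h1 h2) h3) h4)]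
  generalize theta (q ^ 2 * e₁ * s₃ / (M * e₂ * s₄)) (q ^ 2) = F
  generalize qInf (z * q ^ 2 * (s₄ / s₃)) (q ^ 2) = y1
  generalize qInf (z * q ^ 2 * (s₃ * s₄)) (q ^ 2) = y2
  generalize theta (-(e₂ * s₄ * q)) (q ^ 2) = y3
  generalize theta (-(β * (Z / e₂) * s₄ * q)) (q ^ 2) = y4
  generalize theta (-(β * (Z / e₂) * s₄⁻¹ * q)) (q ^ 2) = y5
  generalize theta (-(e₂ * s₄⁻¹ * q)) (q ^ 2) = y6 at *
  generalize theta (-(e₄ * s₄ * q)) (q ^ 2) = y7 at *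
  generalize qInf (-(q * K * e₄ * s₄)) (q ^ 2) = y8 at *
  generalize qInf (-(q / (K * e₄ * s₄))) (q ^ 2) = y9 at *
  generalize qInf (-(q * s₄ / (L * M * e₂))) (q ^ 2) = y10 at *
  generalize qInf (-(q * L * M * e₂ / s₄)) (q ^ 2) = y11 at *
  generalize (q ^ 2 * e₁ * s₃ * s₄ / (M * e₂)) ^ m = g1 at *
  generalize (q ^ 2 * e₁ * s₃ / (M * e₂)) ^ m = g2 at *
  linear_combination (y3 * y4 * y5 * y10 * y11 * s₄ ^ (-r) * qInf c (q ^ 2) * y1 * F * y2 * g1 *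
      T) * t1 + (y3 * y4 * y5 * ((e₄ * s₄ * q) ^ (-k) * q ^ (-(k * (k - 1))) * y7) * s₄ ^ (-r) *
      qInf c (q ^ 2) * y1 * F * y2 * g1 * T) * t2 +
    (y3 * y4 * y5 * q ^ (-(k * (k - 1))) * y7 * q ^ (-((l + r) * (l + r - 1))) * y6 *
      qInf c (q ^ 2) * y1 * F * y2 * T) * t4

/-- On the hypersurface `z e₄ = e₁` the two parts of `r` coincide. -/
theorem gCore_inv_of_resonant {q K M L z β Z e₁ e₂ e₃ e₄ s₃ s₄ : ℂ} {k r l : ℤ}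
    (hq : q ≠ 0) (hp : ‖q ^ 2‖ < 1) (hK : K = (q ^ 2) ^ k) (hM : M = (q ^ 2) ^ r)
    (hL : L = (q ^ 2) ^ l) (hkl : l ≤ k) (hz : z ≠ 0) (he₁ : e₁ ≠ 0) (he₂ : e₂ ≠ 0)
    (he₃ : e₃ ≠ 0) (he₄ : e₄ ≠ 0) (hs₃ : s₃ ≠ 0) (hs₄ : s₄ ≠ 0) (he : e₁ * e₃ = e₂ * e₄)
    (hze₄ : z * e₄ = e₁)
    (had : ∀ n : ℤ, -(q * s₃ * z ^ 2 / (K * e₁)) ≠ (q ^ 2) ^ n)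
    (h1 : theta (-(e₄ * s₄ * q)) (q ^ 2) ≠ 0)
    (h2 : theta (q ^ 2 * e₁ * s₃ / (M * e₂ * s₄)) (q ^ 2) ≠ 0)
    (h3 : qInf (z * q ^ 2 * (s₃ * s₄)) (q ^ 2) ≠ 0)
    (h4 : qInf (z * q ^ 2 * (s₄ / s₃)) (q ^ 2) ≠ 0)
    (h1' : theta (-(e₄ * s₄⁻¹ * q)) (q ^ 2) ≠ 0)
    (h2' : theta (q ^ 2 * e₁ * s₃ / (M * e₂ * s₄⁻¹)) (q ^ 2) ≠ 0)
    (h3' : qInf (z * q ^ 2 * (s₃ * s₄⁻¹)) (q ^ 2) ≠ 0)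
    (h4' : qInf (z * q ^ 2 * (s₄⁻¹ / s₃)) (q ^ 2) ≠ 0) :
    gCore r q K M L z β Z e₁ e₂ e₃ e₄ s₃ s₄ = gCore r q K M L z β Z e₁ e₂ e₃ e₄ s₃ s₄⁻¹ := by
  obtain ⟨m, hm⟩ := Int.le.dest hkl
  have hp0 : q ^ 2 ≠ 0 := pow_ne_zero 2 hq
  have hK0 : K ≠ 0 := hK ▸ zpow_ne_zero k hp0
  have hM0 : M ≠ 0 := hM ▸ zpow_ne_zero r hp0
  have hL0 : L ≠ 0 := hL ▸ zpow_ne_zero l hp0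
  have hKL : K = L * (q ^ 2) ^ m := by rw [hK, hL, ← hm, zpow_add₀ hp0, zpow_natCast]
  have hze₃ : z * e₃ = e₂ := by
    apply mul_left_cancel₀ he₄
    linear_combination he + e₃ * hze₄
  have had' : ∀ i j : ℕ, -(q * s₃ / (K * M * e₃)) * (q ^ 2) ^ i ≠
      e₁ / (z * M * e₂) * (q ^ 2) ^ j := by
    intro i j hij
    refine had (j - i) ?_
    rw [zpow_sub₀ hp0, zpow_natCast, zpow_natCast, eq_div_iff (pow_ne_zero i hp0)]
    have e1 : -(q * s₃ * z ^ 2 / (K * e₁)) = -(q * s₃ / (K * M * e₃)) * (z * M * e₂ / e₁) := by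
      rw [← hze₃]; field_simp
    rw [e1, mul_right_comm, hij]
    field_simp
  have hmp := pow_ne_zero m hp0
  -- On `z e₄ = e₁` the upper parameter `c` is the lower parameter `y` times `p ^ m`, with `m = k -
  -- l ≥ 0`. The inversion `s₄ ↦ s₄⁻¹` exchanges `f` and `g`, so both integrals involve the same
  -- `T`.
  obtain ⟨T, hT1, hT2⟩ := exists_jack_resonant hp hp0 (a := -(q * s₃ / (K * M * e₃)))
    (b := -(q * L * e₁ * s₃)) (d := e₁ / (z * M * e₂)) (y := q ^ 2 * L * e₁ / (K * M * e₃))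
    (f := q ^ 2 * e₁ * s₃ / (M * e₂ * s₄)) (g := q ^ 2 * e₁ * s₃ * s₄ / (M * e₂)) (m := m)
    (by simp [hq, hs₃, hK0, hM0, he₃]) (by simp [hq, hs₃, hL0, he₁])
    (by simp [hz, he₁, hM0, he₂]) (by simp [hq, he₁, hs₃, hM0, he₂, hs₄]) had'
    (by rw [hKL, ← hze₃]; field_simp; ring)
  have hc : q ^ 2 * L * e₁ / (K * M * e₃) * (q ^ 2) ^ m = z * q ^ 2 * e₁ / (M * e₂) := by
    rw [hKL, ← hze₃]; field_simp
  have he₄' : e₄ = z⁻¹ * e₁ := by rw [← hze₄]; field_simp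
  rw [gCore_resonant hq hp hK hM hL hm.symm hz he₂ he₃ he₄ hs₄ hze₃ h1 h2 h3 h4
      (T := T) (c := z * q ^ 2 * e₁ / (M * e₂)) ?_,
    gCore_resonant hq hp hK hM hL hm.symm hz he₂ he₃ he₄ (inv_ne_zero hs₄) hze₃ h1' h2' h3'
      h4' (T := T) (c := z * q ^ 2 * e₁ / (M * e₂)) ?_, inv_inv]
  · ring
  · rw [hc] at hT2
    have f' : q ^ 2 * e₁ * s₃ / (M * e₂ * s₄⁻¹) = q ^ 2 * e₁ * s₃ * s₄ / (M * e₂) := by field_simp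
    have g' : q ^ 2 * e₁ * s₃ * s₄⁻¹ / (M * e₂) = q ^ 2 * e₁ * s₃ / (M * e₂ * s₄) := by field_simp
    rw [coreJack, f', g', hT2]
    congr 7
    · field_simp
    · rw [← hze₃, he₄']; field_simp
    · field_simp
    · field_simp
  · rw [hc] at hT1
    rw [coreJack, hT1]
    congr 7
    · field_simp
    · rw [← hze₃, he₄']; field_simp
    · field_simp
    · field_simp

/-! ### Removal of a simple pole, uniformly in parameters. -/

/-- If `N` is continuous, holomorphic in its first variable and vanishes on the graph of `ζ`, then
the quotient of `N` by `z - ζ x` extends continuously to the graph. -/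
theorem exists_tendsto_div_sub {X : Type*} [TopologicalSpace X] {N : ℂ × X → ℂ} {ζ : X → ℂ}
    {x₀ : X} (hζ : ContinuousAt ζ x₀) (hc : ∀ᶠ y in 𝓝 (ζ x₀, x₀), ContinuousAt N y)
    (hd : ∀ᶠ y in 𝓝 (ζ x₀, x₀), DifferentiableAt ℂ (fun z => N (z, y.2)) y.1)
    (h0 : ∀ᶠ x in 𝓝 x₀, N (ζ x, x) = 0) :
    ∃ v, Tendsto (fun y : ℂ × X => N y / (y.1 - ζ y.2))
      (𝓝[{y | y.1 ≠ ζ y.2}] (ζ x₀, x₀)) (𝓝 v) := by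
  have hcd := hc.and hd
  rw [nhds_prod_eq, eventually_prod_iff] at hcd
  obtain ⟨pa, hpa, pb, hpb, hab⟩ := hcd
  obtain ⟨R, hR, hpa⟩ := Metric.nhds_basis_closedBall.eventually_iff.1 hpa
  set z₀ := ζ x₀ with hz₀
  -- For each `x` this is the quotient with its removable singularity at `ζ x` filled in. It remains
  -- to show that it depends continuously on `x`, uniformly in `z`.
  set h : X → ℂ → ℂ := fun x => dslope (fun z => N (z, x)) (ζ x) with hh
  have hev : ∀ᶠ x in 𝓝 x₀, pb x ∧ ζ x ∈ Metric.ball z₀ R ∧ N (ζ x, x) = 0 :=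
    hpb.and ((hζ.eventually (Metric.ball_mem_nhds z₀ hR)).and h0)
  have hdiff : ∀ x, pb x → ζ x ∈ Metric.ball z₀ R →
      DifferentiableOn ℂ (h x) (Metric.closedBall z₀ R) := by
    intro x hx hxR
    refine (Complex.differentiableOn_dslope (mem_of_superset
      (Metric.isOpen_ball.mem_nhds hxR) Metric.ball_subset_closedBall)).2 fun z hz => ?_
    exact (hab (hpa hz) hx).2.differentiableWithinAt
  have hval : ∀ x z, N (ζ x, x) = 0 → z ≠ ζ x → h x z = N (z, x) / (z - ζ x) := by
    intro x z hx hz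
    rw [hh]
    simp only
    rw [dslope_of_ne _ hz, slope_def_field, hx, sub_zero]
  have hx₀ := hev.self_of_nhds
  -- On the sphere the denominators stay away from `0`, so the quotients converge there, uniformly
  -- by compactness. The maximum principle then carries the estimate into the ball.
  have hsph : ∀ ε > 0, ∀ᶠ x in 𝓝 x₀, ∀ w ∈ Metric.sphere z₀ R,
      ‖N (w, x) / (w - ζ x) - N (w, x₀) / (w - z₀)‖ < ε := by
    intro ε hε
    refine (isCompact_sphere z₀ R).eventually_forall_of_forall_eventually fun w hw => ?_
    have hwz : w - z₀ ≠ 0 := by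
      rw [sub_ne_zero]; rintro rfl
      simp at hw; exact hR.ne hw
    have hN : ContinuousAt N (w, x₀) := (hab (hpa (Metric.sphere_subset_closedBall hw)) hx₀.1).1
    have c1 : ContinuousAt (fun y : X × ℂ => N (y.2, y.1)) (x₀, w) :=
      ContinuousAt.comp (f := fun y : X × ℂ => (y.2, y.1)) (g := N) hN (by fun_prop)
    have c2 : ContinuousAt (fun y : X × ℂ => N (y.2, x₀)) (x₀, w) :=
      ContinuousAt.comp (f := fun y : X × ℂ => (y.2, x₀)) (g := N) hN (by fun_prop)
    have c3 : ContinuousAt (fun y : X × ℂ => ζ y.1) (x₀, w) :=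
      ContinuousAt.comp (f := fun y : X × ℂ => y.1) (g := ζ) hζ (by fun_prop)
    have c4 : ContinuousAt (fun y : X × ℂ => ‖N (y.2, y.1) / (y.2 - ζ y.1) -
        N (y.2, x₀) / (y.2 - z₀)‖) (x₀, w) :=
      ((c1.div (continuousAt_snd.sub c3) hwz).sub
        (c2.div (continuousAt_snd.sub continuousAt_const) hwz)).norm
    refine c4.eventually_lt_const ?_
    simpa [← hz₀] using hε
  have hmax : ∀ ε > 0, ∀ᶠ x in 𝓝 x₀, ∀ z ∈ Metric.closedBall z₀ R, ‖h x z - h x₀ z‖ ≤ ε := by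
    intro ε hε
    filter_upwards [hsph ε hε, hev] with x h1 h2 z hz
    refine Complex.norm_le_of_forall_mem_frontier_norm_le (f := fun z => h x z - h x₀ z)
      (U := Metric.ball z₀ R) Metric.isBounded_ball ?_ ?_ ?_
    · refine DifferentiableOn.diffContOnCl ?_
      rw [closure_ball z₀ hR.ne']
      exact (hdiff x h2.1 h2.2.1).sub (hdiff x₀ hx₀.1 hx₀.2.1)
    · intro w hw
      rw [frontier_ball z₀ hR.ne'] at hw
      have hne : ∀ u ∈ Metric.ball z₀ R, w ≠ u := by
        rintro u hu rfl
        rw [Metric.mem_ball, Metric.mem_sphere.1 hw] at hu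
        exact lt_irrefl _ hu
      rw [hval x w h2.2.2 (hne _ h2.2.1), hval x₀ w hx₀.2.2 (hne _ hx₀.2.1)]
      exact (h1 w hw).le
    · rwa [closure_ball z₀ hR.ne']
  refine ⟨h x₀ z₀, ?_⟩
  have hcont : ContinuousAt (h x₀) z₀ := ((hdiff x₀ hx₀.1 hx₀.2.1).differentiableAt
    (Metric.closedBall_mem_nhds z₀ hR)).continuousAt
  have hlim : Tendsto (fun y : ℂ × X => h y.2 y.1) (𝓝 (z₀, x₀)) (𝓝 (h x₀ z₀)) := by
    rw [Metric.tendsto_nhds]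
    intro ε hε
    have e1 : ∀ᶠ y : ℂ × X in 𝓝 (z₀, x₀), dist (h x₀ y.1) (h x₀ z₀) < ε / 2 :=
      Metric.tendsto_nhds.1 (hcont.tendsto.comp (continuousAt_fst (p := (z₀, x₀)))) (ε / 2)
        (half_pos hε)
    have e2 : ∀ᶠ y : ℂ × X in 𝓝 (z₀, x₀), y.1 ∈ Metric.closedBall z₀ R :=
      continuousAt_fst.eventually (Metric.closedBall_mem_nhds z₀ hR)
    have e3 : ∀ᶠ y : ℂ × X in 𝓝 (z₀, x₀), ∀ z ∈ Metric.closedBall z₀ R,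
        ‖h y.2 z - h x₀ z‖ ≤ ε / 2 :=
      (continuousAt_snd (p := (z₀, x₀))).tendsto.eventually
        (p := fun x => ∀ z ∈ Metric.closedBall z₀ R, ‖h x z - h x₀ z‖ ≤ ε / 2)
        (hmax (ε / 2) (half_pos hε))
    filter_upwards [e1, e2, e3] with y h1 h2 h3
    have := h3 _ h2
    rw [← dist_eq_norm] at this
    linarith [dist_triangle (h y.2 y.1) (h x₀ y.1) (h x₀ z₀)]
  refine (hlim.mono_left nhdsWithin_le_nhds).congr' ?_
  have e4 : ∀ᶠ y : ℂ × X in 𝓝[{y | y.1 ≠ ζ y.2}] (z₀, x₀), N (ζ y.2, y.2) = 0 :=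
    (continuousAt_snd.eventually (p := fun x => N (ζ x, x) = 0) h0).filter_mono nhdsWithin_le_nhds
  filter_upwards [e4, self_mem_nhdsWithin] with y h1 h2
  exact hval _ _ h1 h2

/-! ### Continuity and holomorphy of the building blocks of `r̄`. -/

@[fun_prop]
theorem ContinuousAt.theta {X : Type*} [TopologicalSpace X] {p : ℂ} (hp : ‖p‖ < 1)
    {a : X → ℂ} {x : X} (ha : ContinuousAt a x) (h : a x ≠ 0) :
    ContinuousAt (fun y => QInt.theta (a y) p) x := by
  unfold QInt.theta
  fun_prop (disch := assumption)

@[fun_prop]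
theorem DifferentiableAt.theta {p : ℂ} (hp : ‖p‖ < 1)
    {a : ℂ → ℂ} {x : ℂ} (ha : DifferentiableAt ℂ a x) (h : a x ≠ 0) :
    DifferentiableAt ℂ (fun y => QInt.theta (a y) p) x := by
  unfold QInt.theta
  fun_prop (disch := assumption)

theorem ContinuousAt.jack {X : Type*} [TopologicalSpace X] {p : ℂ} (hp : ‖p‖ < 1) {x : X}
    {a b c d e f g : X → ℂ} (ha : ContinuousAt a x) (hb : ContinuousAt b x)
    (hc : ContinuousAt c x) (hd : ContinuousAt d x) (he : ContinuousAt e x)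
    (hf : ContinuousAt f x) (hg : ContinuousAt g x) (h0 : f x ≠ 0) :
    ContinuousAt (fun y => QInt.jack p (a y) (b y) (c y) (d y) (e y) (f y) (g y)) x := by
  unfold QInt.jack
  fun_prop (disch := assumption)

theorem DifferentiableAt.coreJack {q K M L z e₁ e₂ e₃ s₃ s₄ : ℂ} (hp : ‖q ^ 2‖ < 1)
    (hz : z ≠ 0) (hM : M ≠ 0) (he₂ : e₂ ≠ 0) :
    DifferentiableAt ℂ (fun z => QInt.coreJack q K M L z e₁ e₂ e₃ s₃ s₄) z := by
  have hU : IsOpen {z : ℂ | z ≠ 0} := isOpen_ne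
  have hd : DifferentiableOn ℂ (fun z => e₁ / (z * M * e₂)) {z : ℂ | z ≠ 0} := by
    intro w hw
    have : w * M * e₂ ≠ 0 := mul_ne_zero (mul_ne_zero hw hM) he₂
    fun_prop (disch := assumption)
  have hc : DifferentiableOn ℂ (fun z => z * q ^ 2 * e₁ / (M * e₂)) {z : ℂ | z ≠ 0} := by
    fun_prop
  have hmem : {z : ℂ | z ≠ 0} ∈ 𝓝 z := hU.mem_nhds hz
  have d1 := hd.differentiableAt hmem
  have c1 := hc.differentiableAt hmem
  have K1 : ∀ w : ℂ, DifferentiableAt ℂ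
      (fun z => QInt.qInf (z * q ^ 2 * e₁ / (M * e₂) * w) (q ^ 2)) z :=
    fun w => DifferentiableAt.qInf hp (c1.mul_const w)
  have K2 : ∀ w : ℂ, DifferentiableAt ℂ
      (fun z => QInt.qInf (e₁ / (z * M * e₂) * w) (q ^ 2)) z :=
    fun w => DifferentiableAt.qInf hp (d1.mul_const w)
  have K3 := DifferentiableAt.qInf hp c1
  have K4 := DifferentiableAt.qInf hp d1
  unfold QInt.coreJack QInt.jack
  refine DifferentiableAt.sub (DifferentiableAt.mul (by fun_prop) ?_)
    (DifferentiableAt.const_mul (DifferentiableAt.mul (by fun_prop) ?_) _)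
  · exact (DifferentiableOn.phiReg hp hU (by fun_prop) (by fun_prop) hc hd (by fun_prop)
      (by fun_prop) (by fun_prop)).differentiableAt hmem
  · exact (DifferentiableOn.phiReg hp hU (by fun_prop) (by fun_prop) (hc.mul_const _)
      (hd.mul_const _) (by fun_prop) (by fun_prop) (by fun_prop)).differentiableAt hmem

/-- The denominator of `gCore`. -/
noncomputable def gDen (q M z e₁ e₂ e₄ s₃ s₄ : ℂ) : ℂ :=
  theta (-(e₄ * s₄ * q)) (q ^ 2) * theta (q ^ 2 * e₁ * s₃ / (M * e₂ * s₄)) (q ^ 2) *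
      qInf (z * q ^ 2 * (s₃ * s₄)) (q ^ 2) * qInf (z * q ^ 2 * (s₄ / s₃)) (q ^ 2)

theorem ContinuousAt.gDen {X : Type*} [TopologicalSpace X] {x : X} {q M e₁ e₂ : ℂ}
    {z e₄ s₃ s₄ : X → ℂ} (hp : ‖q ^ 2‖ < 1) (hq : q ≠ 0) (hM : M ≠ 0) (he₁ : e₁ ≠ 0)
    (he₂ : e₂ ≠ 0) (hz : ContinuousAt z x) (h₄ : ContinuousAt e₄ x)
    (k₃ : ContinuousAt s₃ x) (k₄ : ContinuousAt s₄ x) (n₄ : e₄ x ≠ 0) (m₃ : s₃ x ≠ 0)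
    (m₄ : s₄ x ≠ 0) :
    ContinuousAt (fun y => QInt.gDen q M (z y) e₁ e₂ (e₄ y) (s₃ y) (s₄ y)) x := by
  unfold QInt.gDen
  have a1 : -(e₄ x * s₄ x * q) ≠ 0 := by simp [*]
  have a2 : M * e₂ * s₄ x ≠ 0 := by simp [*]
  have a3 : q ^ 2 * e₁ * s₃ x / (M * e₂ * s₄ x) ≠ 0 := by simp [*]
  fun_prop (disch := assumption)

theorem ContinuousAt.gCore {X : Type*} [TopologicalSpace X] {x : X} {r : ℤ} {q K M L β Z e₁ e₂ : ℂ}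
    {z e₃ e₄ s₃ s₄ : X → ℂ} (hp : ‖q ^ 2‖ < 1) (hq : q ≠ 0) (hK : K ≠ 0) (hM : M ≠ 0)
    (hβ : β ≠ 0) (hZ : Z ≠ 0) (he₁ : e₁ ≠ 0)
    (he₂ : e₂ ≠ 0) (hz : ContinuousAt z x) (h₃ : ContinuousAt e₃ x) (h₄ : ContinuousAt e₄ x)
    (k₃ : ContinuousAt s₃ x) (k₄ : ContinuousAt s₄ x) (nz : z x ≠ 0) (n₃ : e₃ x ≠ 0)
    (n₄ : e₄ x ≠ 0) (m₃ : s₃ x ≠ 0) (m₄ : s₄ x ≠ 0)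
    (hD : QInt.gDen q M (z x) e₁ e₂ (e₄ x) (s₃ x) (s₄ x) ≠ 0) :
    ContinuousAt (fun y => QInt.gCore r q K M L (z y) β Z e₁ e₂ (e₃ y) (e₄ y) (s₃ y) (s₄ y)) x := by
  unfold QInt.gCore
  refine ContinuousAt.div ?_ (ContinuousAt.gDen hp hq hM he₁ he₂ hz h₄ k₃ k₄ n₄ m₃ m₄) hD
  have b1 : -(e₂ * s₄ x * q) ≠ 0 := by simp [*]
  have b2 : -(β * (Z / e₂) * s₄ x * q) ≠ 0 := by simp [*]
  have b3 : -(β * (z x)⁻¹ * (Z / e₃ x) * (s₄ x)⁻¹ * q) ≠ 0 := by simp [*]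
  have b4 : K * e₄ x * s₄ x ≠ 0 := by simp [*]
  have b5 : z x * M * e₂ ≠ 0 := by simp [*]
  have b6 : K * M * e₃ x ≠ 0 := by simp [*]
  have a2 : M * e₂ * s₄ x ≠ 0 := by simp [*]
  have a3 : q ^ 2 * e₁ * s₃ x / (M * e₂ * s₄ x) ≠ 0 := by simp [*]
  have J : ContinuousAt (fun y => QInt.coreJack q K M L (z y) e₁ e₂ (e₃ y) (s₃ y) (s₄ y)) x := by
    unfold QInt.coreJack
    exact ContinuousAt.jack hp (by fun_prop (disch := assumption)) (by fun_prop)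
      (by fun_prop) (by fun_prop (disch := assumption)) (by fun_prop (disch := assumption))
      (by fun_prop (disch := assumption)) (by fun_prop) a3
  have hs : ContinuousAt (fun y => s₄ y ^ (-r)) x := k₄.zpow₀ _ (Or.inl m₄)
  fun_prop (disch := assumption)

theorem DifferentiableAt.gCore {r : ℤ} {q K M L β Z e₁ e₂ z e₃ e₄ s₃ s₄ : ℂ}
    (hp : ‖q ^ 2‖ < 1) (hq : q ≠ 0) (hM : M ≠ 0) (hβ : β ≠ 0) (hZ : Z ≠ 0)
    (he₂ : e₂ ≠ 0) (nz : z ≠ 0) (n₃ : e₃ ≠ 0) (m₄ : s₄ ≠ 0)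
    (hD : QInt.gDen q M z e₁ e₂ e₄ s₃ s₄ ≠ 0) :
    DifferentiableAt ℂ (fun z => QInt.gCore r q K M L z β Z e₁ e₂ e₃ e₄ s₃ s₄) z := by
  unfold QInt.gCore
  refine DifferentiableAt.div ?_ (by fun_prop (disch := assumption)) hD
  have b3 : -(β * z⁻¹ * (Z / e₃) * s₄⁻¹ * q) ≠ 0 := by simp [*]
  have J := DifferentiableAt.coreJack (K := K) (L := L) (e₁ := e₁) (e₃ := e₃) (s₃ := s₃) (s₄ := s₄)
    hp nz hM he₂
  fun_prop (disch := assumption)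

/-- The denominators of `half` that may vanish. -/
noncomputable def halfDen (r : ℤ) (q z e₁ e₂ e₄ s₃ s₄ : ℂ) : ℂ :=
  qInf (z * q ^ 2 * e₁ / ((q ^ 2) ^ r * e₂)) (q ^ 2) *
    (gDen q ((q ^ 2) ^ r) z e₁ e₂ e₄ s₃ s₄ * gDen q ((q ^ 2) ^ r) z e₁ e₂ e₄ s₃ s₄⁻¹)

/-- The theta functions in front of `r` in `r̄`, for `α = 1`. -/
noncomputable def halfPre (q z β Z e₁ e₂ e₃ e₄ s₃ s₄ : ℂ) : ℂ :=
  theta (-(z * e₃ * s₄ * q ^ 3)) (q ^ 2) *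
    theta (-(β * z⁻¹ * (e₁ * (e₁ * Z / e₂ ^ 2) / e₄) * s₃⁻¹ * q)) (q ^ 2) *
    theta (-(e₁ * s₃ * q)) (q ^ 2) * theta (-(β * (e₁ * Z / e₂ ^ 2) * s₃ * q)) (q ^ 2) *
    (theta (-(e₄ * s₄ * q)) (q ^ 2) * theta (-(e₄ * s₄⁻¹ * q)) (q ^ 2) *
      theta (s₃ ^ 2 * q ^ 2) (q ^ 2)) * qInf (z⁻¹ * (e₂ / e₁)) (q ^ 2)

/-- The part of `r̄` that comes from `r`, up to elementary factors, for `α = 1`; the part that comes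
from `r̊` is obtained by exchanging parameters. -/
noncomputable def half (k r l : ℤ) (q z β Z e₁ e₂ e₃ e₄ s₃ s₄ : ℂ) : ℂ :=
  halfPre q z β Z e₁ e₂ e₃ e₄ s₃ s₄ * gFactor k r l q ((q ^ 2) ^ r) z e₁ e₂ *
    (gCore r q ((q ^ 2) ^ k) ((q ^ 2) ^ r) ((q ^ 2) ^ l) z β Z e₁ e₂ e₃ e₄ s₃ s₄ -
      gCore r q ((q ^ 2) ^ k) ((q ^ 2) ^ r) ((q ^ 2) ^ l) z β Z e₁ e₂ e₃ e₄ s₃ s₄⁻¹)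

theorem ContinuousAt.halfDen {X : Type*} [TopologicalSpace X] {x : X} {r : ℤ} {q e₁ e₂ : ℂ}
    {z e₄ s₃ s₄ : X → ℂ} (hp : ‖q ^ 2‖ < 1) (hq : q ≠ 0) (he₁ : e₁ ≠ 0)
    (he₂ : e₂ ≠ 0) (hz : ContinuousAt z x) (h₄ : ContinuousAt e₄ x)
    (k₃ : ContinuousAt s₃ x) (k₄ : ContinuousAt s₄ x) (n₄ : e₄ x ≠ 0) (m₃ : s₃ x ≠ 0)
    (m₄ : s₄ x ≠ 0) :
    ContinuousAt (fun y => QInt.halfDen r q (z y) e₁ e₂ (e₄ y) (s₃ y) (s₄ y)) x := by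
  have hM : (q ^ 2) ^ r ≠ 0 := zpow_ne_zero _ (pow_ne_zero 2 hq)
  have i1 := ContinuousAt.gDen hp hq hM he₁ he₂ hz h₄ k₃ k₄ n₄ m₃ m₄
  have i2 := ContinuousAt.gDen hp hq hM he₁ he₂ hz h₄ k₃ (k₄.inv₀ m₄) n₄ m₃ (inv_ne_zero m₄)
  unfold QInt.halfDen
  fun_prop (disch := assumption)

theorem ContinuousAt.half {X : Type*} [TopologicalSpace X] {x : X} {k r l : ℤ} {q β Z e₁ e₂ : ℂ}
    {z e₃ e₄ s₃ s₄ : X → ℂ} (hp : ‖q ^ 2‖ < 1) (hq : q ≠ 0)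
    (hβ : β ≠ 0) (hZ : Z ≠ 0) (he₁ : e₁ ≠ 0)
    (he₂ : e₂ ≠ 0) (hz : ContinuousAt z x) (h₃ : ContinuousAt e₃ x) (h₄ : ContinuousAt e₄ x)
    (k₃ : ContinuousAt s₃ x) (k₄ : ContinuousAt s₄ x) (nz : z x ≠ 0) (n₃ : e₃ x ≠ 0)
    (n₄ : e₄ x ≠ 0) (m₃ : s₃ x ≠ 0) (m₄ : s₄ x ≠ 0)
    (hD : QInt.halfDen r q (z x) e₁ e₂ (e₄ x) (s₃ x) (s₄ x) ≠ 0) :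
    ContinuousAt (fun y => QInt.half k r l q (z y) β Z e₁ e₂ (e₃ y) (e₄ y) (s₃ y) (s₄ y)) x := by
  have hp0 : q ^ 2 ≠ 0 := pow_ne_zero 2 hq
  have hM : (q ^ 2) ^ r ≠ 0 := zpow_ne_zero _ hp0
  have hK : (q ^ 2) ^ k ≠ 0 := zpow_ne_zero _ hp0
  have hD1 := left_ne_zero_of_mul hD
  have hD2 := left_ne_zero_of_mul (right_ne_zero_of_mul hD)
  have hD3 := right_ne_zero_of_mul (right_ne_zero_of_mul hD)
  have i1 := ContinuousAt.gCore (r := r) (K := (q ^ 2) ^ k) (L := (q ^ 2) ^ l) hp hq hK hM hβ hZ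
    he₁ he₂ hz h₃ h₄ k₃ k₄ nz n₃ n₄ m₃ m₄ hD2
  have i2 := ContinuousAt.gCore (r := r) (K := (q ^ 2) ^ k) (L := (q ^ 2) ^ l) hp hq hK hM hβ hZ
    he₁ he₂ hz h₃ h₄ k₃ (k₄.inv₀ m₄) nz n₃ n₄ m₃ (inv_ne_zero m₄) hD3
  unfold QInt.half halfPre gFactor
  have hq2 := qInf_self_ne_zero hp
  have b1 : -(z x * e₃ x * s₄ x * q ^ 3) ≠ 0 := by simp [*]
  have b2 : -(β * (z x)⁻¹ * (e₁ * (e₁ * Z / e₂ ^ 2) / e₄ x) * (s₃ x)⁻¹ * q) ≠ 0 := by simp [*]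
  have b3 : -(e₁ * s₃ x * q) ≠ 0 := by simp [*]
  have b4 : -(β * (e₁ * Z / e₂ ^ 2) * s₃ x * q) ≠ 0 := by simp [*]
  have b5 : -(e₄ x * s₄ x * q) ≠ 0 := by simp [*]
  have b6 : -(e₄ x * (s₄ x)⁻¹ * q) ≠ 0 := by simp [*]
  have b7 : s₃ x ^ 2 * q ^ 2 ≠ 0 := by simp [*]
  have b8 : QInt.qInf (z x * q ^ 2 * e₁ / ((q ^ 2) ^ r * e₂)) (q ^ 2) * QInt.qInf (q ^ 2) (q ^ 2) ≠ 0 :=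
    mul_ne_zero hD1 hq2
  have j1 : ContinuousAt (fun y => z y ^ r) x := hz.zpow₀ _ (Or.inl nz)
  have j2 : ContinuousAt (fun y => z y ^ (-k - r)) x := hz.zpow₀ _ (Or.inl nz)
  fun_prop (disch := assumption)

theorem DifferentiableAt.half {k r l : ℤ} {q β Z e₁ e₂ z e₃ e₄ s₃ s₄ : ℂ} (hp : ‖q ^ 2‖ < 1)
    (hq : q ≠ 0) (hβ : β ≠ 0) (hZ : Z ≠ 0) (he₁ : e₁ ≠ 0) (he₂ : e₂ ≠ 0) (nz : z ≠ 0)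
    (n₃ : e₃ ≠ 0) (n₄ : e₄ ≠ 0) (m₃ : s₃ ≠ 0) (m₄ : s₄ ≠ 0)
    (hD : QInt.halfDen r q z e₁ e₂ e₄ s₃ s₄ ≠ 0) :
    DifferentiableAt ℂ (fun z => QInt.half k r l q z β Z e₁ e₂ e₃ e₄ s₃ s₄) z := by
  have hp0 : q ^ 2 ≠ 0 := pow_ne_zero 2 hq
  have hM : (q ^ 2) ^ r ≠ 0 := zpow_ne_zero _ hp0
  have hD1 := left_ne_zero_of_mul hD
  have hD2 := left_ne_zero_of_mul (right_ne_zero_of_mul hD)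
  have hD3 := right_ne_zero_of_mul (right_ne_zero_of_mul hD)
  have i1 := DifferentiableAt.gCore (r := r) (K := (q ^ 2) ^ k) (L := (q ^ 2) ^ l) hp hq hM hβ hZ
    he₂ nz n₃ m₄ hD2
  have i2 := DifferentiableAt.gCore (r := r) (K := (q ^ 2) ^ k) (L := (q ^ 2) ^ l) hp hq hM hβ hZ
    he₂ nz n₃ (inv_ne_zero m₄) hD3
  unfold QInt.half halfPre gFactor
  have hq2 := qInf_self_ne_zero hp
  have b1 : -(z * e₃ * s₄ * q ^ 3) ≠ 0 := by simp [*]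
  have b2 : -(β * z⁻¹ * (e₁ * (e₁ * Z / e₂ ^ 2) / e₄) * s₃⁻¹ * q) ≠ 0 := by simp [*]
  have b8 : QInt.qInf (z * q ^ 2 * e₁ / ((q ^ 2) ^ r * e₂)) (q ^ 2) * QInt.qInf (q ^ 2) (q ^ 2) ≠ 0 :=
    mul_ne_zero hD1 hq2
  have j1 : DifferentiableAt ℂ (fun z : ℂ => z ^ r) z := differentiableAt_zpow.2 (Or.inl nz)
  have j2 : DifferentiableAt ℂ (fun z : ℂ => z ^ (-k - r)) z := differentiableAt_zpow.2 (Or.inl nz)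
  fun_prop (disch := assumption)

/-! ### Factorisation of `r̄` off the polar set. -/

theorem NotPow.ne_zpow {q : ℝ} {x y : ℂ} (hx : NotPow q x) (hq : (q : ℂ) ≠ 0) {m : ℤ}
    (h : y = x * ((q : ℂ) ^ 2) ^ m) (n : ℤ) : y ≠ ((q : ℂ) ^ 2) ^ n := by
  intro hy
  refine hx (n - m) ?_
  rw [zpow_mul, show (q : ℂ) ^ (2 : ℤ) = q ^ 2 from zpow_ofNat _ _,
    zpow_sub₀ (pow_ne_zero 2 hq), ← hy, h]
  have := zpow_ne_zero m (pow_ne_zero 2 hq)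
  field_simp

theorem NotPow.inv {q : ℝ} {x : ℂ} (hx : NotPow q x) : NotPow q x⁻¹ := by
  intro n hn
  refine hx (-n) ?_
  rw [mul_neg, zpow_neg, ← hn, inv_inv]

theorem NotPow.qInf_ne_zero {q : ℝ} {x y : ℂ} (hx : NotPow q x) (hq0 : 0 < q) (hq1 : q < 1) (m : ℤ)
    (h : y = x * ((q : ℂ) ^ 2) ^ m) : qInf y ((q : ℂ) ^ 2) ≠ 0 :=
  qInf_ne_zero_of_ne_zpow (norm_ofReal_sq_lt_one hq0 hq1)
    (hx.ne_zpow (by exact_mod_cast hq0.ne') h)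

theorem NotPow.theta_ne_zero {q : ℝ} {x y : ℂ} (hx : NotPow q x) (hq0 : 0 < q) (hq1 : q < 1)
    (m : ℤ) (h0 : y ≠ 0) (h : y = x * ((q : ℂ) ^ 2) ^ m) : theta y ((q : ℂ) ^ 2) ≠ 0 :=
  QInt.theta_ne_zero (norm_ofReal_sq_lt_one hq0 hq1)
    (pow_ne_zero 2 (by exact_mod_cast hq0.ne')) h0 (hx.ne_zpow (by exact_mod_cast hq0.ne') h)

theorem regular_of_notPow {q : ℝ} (hq0 : 0 < q) (hq1 : q < 1) {k r l : ℤ}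
    {z e₁ e₂ e₃ e₄ s₃ s₄ : ℂ} (he₁ : e₁ ≠ 0) (he₂ : e₂ ≠ 0)
    (hs₃ : s₃ ≠ 0) (hs₄ : s₄ ≠ 0) (h1 : NotPow q (e₁ / e₃))
    (h2 : NotPow q (e₁ / e₄ * (s₄ / s₃))) (h3 : NotPow q (e₂ / e₁ * (s₄ / s₃)))
    (h4 : NotPow q (e₂ / e₁ * (1 / (s₃ * s₄)))) (h5 : NotPow q (e₂ / e₁ * (s₃ / s₄)))
    (h6 : NotPow q (s₄ ^ 2)) (h7 : NotPow q (z * (e₁ / e₂)))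
    (h8 : qInf (-(q * s₄ / (((q : ℂ) ^ 2) ^ k * e₄))) ((q : ℂ) ^ 2) ≠ 0)
    (h9 : qInf (-(q * ((q : ℂ) ^ 2) ^ l * ((q : ℂ) ^ 2) ^ r * e₂ * s₄)) ((q : ℂ) ^ 2) ≠ 0) :
    Regular q (((q : ℂ) ^ 2) ^ k) (((q : ℂ) ^ 2) ^ r) (((q : ℂ) ^ 2) ^ l) z e₁ e₂ e₃ e₄ s₃ s₄ := by
  have hqc : (q : ℂ) ≠ 0 := by exact_mod_cast hq0.ne'
  have hp0 : (q : ℂ) ^ 2 ≠ 0 := pow_ne_zero 2 hqc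
  have hM := zpow_ne_zero r hp0
  constructor
  · refine h1.qInf_ne_zero hq0 hq1 (1 + l - k - r) ?_
    rw [zpow_sub₀ hp0, zpow_sub₀ hp0, zpow_add₀ hp0, zpow_one]; ring
  · refine h2.qInf_ne_zero hq0 hq1 (1 + l - k) ?_
    rw [zpow_sub₀ hp0, zpow_add₀ hp0, zpow_one]; ring
  · refine h3.inv.theta_ne_zero hq0 hq1 (1 - r) (by simp [*]) ?_
    rw [zpow_sub₀ hp0, zpow_one]; field_simp
  · refine h4.inv.qInf_ne_zero hq0 hq1 (1 - r) ?_
    rw [zpow_sub₀ hp0, zpow_one]; field_simp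
  · exact h6.qInf_ne_zero hq0 hq1 1 (by rw [zpow_one]; ring)
  · exact h8
  · exact h9
  · exact h4.inv.qInf_ne_zero hq0 hq1 1 (by rw [zpow_one]; field_simp)
  · exact h5.inv.qInf_ne_zero hq0 hq1 1 (by rw [zpow_one]; field_simp)
  · exact h7.qInf_ne_zero hq0 hq1 1 (by rw [zpow_one]; ring)

/-- The quotient of square roots in `r̄`. -/
noncomputable def rootQuot (q : ℝ) (k r l : ℤ) (e₁ e₂ e₃ e₄ s₃ s₄ : ℝ) : ℝ :=
  rootTheta q e₃ s₃ * rootTheta q e₄ s₄ / (S q (-k) e₄⁻¹ s₄ * S q (l + r) e₂ s₄ *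
    S q (-k - r) e₃⁻¹ s₃ * S q l e₁ s₃)

/-- The exchange of parameters defining `r̊` only permutes the roots, so `r` and `r̊` share this
factor. -/
theorem rootQuot_swap (q : ℝ) (k r l : ℤ) (e₁ e₂ e₃ e₄ s₃ s₄ : ℝ) :
    rootQuot q (k + r) (-r) (l + r) e₂ e₁ e₄ e₃ s₄ s₃ = rootQuot q k r l e₁ e₂ e₃ e₄ s₃ s₄ := by
  unfold rootQuot
  rw [show l + r + -r = l by ring, show -(k + r) - -r = -k by ring,
    show -(k + r) = -k - r by ring]
  ring

theorem iota_sq {s : ℝ} (hs : s ≠ 0) : iota s * iota s = 1 := by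
  have := abs_pos.2 hs
  rw [iota, div_mul_div_comm, abs_mul_abs_self, div_self (mul_ne_zero hs hs)]

/-- The summand of `r̄` that comes from `r`. -/
theorem left_part_eq {q : ℝ} (hq0 : 0 < q) (hq1 : q < 1) (k r l : ℤ) {z : ℂ}
    {β Z e₁ e₂ e₃ e₄ s₃ s₄ : ℝ} (hz : z ≠ 0) (he₁ : e₁ ≠ 0) (he₂ : e₂ ≠ 0) (he₄ : e₄ ≠ 0)
    (hs₃ : s₃ ≠ 0) (hs₄ : s₄ ≠ 0) (he : e₁ * e₃ = e₂ * e₄)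
    (h1 : NotPow q (e₁ / e₃)) (h2 : NotPow q (e₁ / e₄ * (s₄ / s₃)))
    (h2' : NotPow q (e₁ / e₄ * (1 / (s₃ * s₄)))) (h3 : NotPow q (e₂ / e₁ * (s₄ / s₃)))
    (h4 : NotPow q (e₂ / e₁ * (1 / (s₃ * s₄)))) (h5 : NotPow q (e₂ / e₁ * (s₃ / s₄)))
    (h5' : NotPow q (e₂ / e₁ * (s₃ * s₄)))
    (h6 : NotPow q (s₄ ^ 2)) (h7 : NotPow q (z * (e₁ / e₂)))
    (hS1 : 0 < S q (-k) e₄⁻¹ s₄) (hS2 : 0 < S q (l + r) e₂ s₄) :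
    halfPre q z β Z e₁ e₂ e₃ e₄ s₃ s₄ * iota s₃ *
      rElt q k r l z 1 β Z e₁ e₂ e₃ e₄ s₃ s₄ =
    rootQuot q k r l e₁ e₂ e₃ e₄ s₃ s₄ /
      qInf (((q : ℂ) ^ 2) ^ l * e₁ / (z * ((q : ℂ) ^ 2) ^ k * e₄)) ((q : ℂ) ^ 2) *
      half k r l q z β Z e₁ e₂ e₃ e₄ s₃ s₄ := by
  have hqc : (q : ℂ) ≠ 0 := by exact_mod_cast hq0.ne'
  have hp0 : (q : ℂ) ^ 2 ≠ 0 := pow_ne_zero 2 hqc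
  have c1 : (e₁ : ℂ) ≠ 0 := by exact_mod_cast he₁
  have c2 : (e₂ : ℂ) ≠ 0 := by exact_mod_cast he₂
  have c4 : (e₄ : ℂ) ≠ 0 := by exact_mod_cast he₄
  have t3 : (s₃ : ℂ) ≠ 0 := by exact_mod_cast hs₃
  have t4 : (s₄ : ℂ) ≠ 0 := by exact_mod_cast hs₄
  have hKn := zpow_ne_zero k hp0
  have q1 := ofReal_S_sq hq0 hq1 hS1
  have q2 := ofReal_S_sq hq0 hq1 hS2
  have n1 : ((S q (-k) e₄⁻¹ s₄ : ℝ) : ℂ) ^ 2 ≠ 0 := pow_ne_zero 2 (by exact_mod_cast hS1.ne')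
  have n2 : ((S q (l + r) e₂ s₄ : ℝ) : ℂ) ^ 2 ≠ 0 := pow_ne_zero 2 (by exact_mod_cast hS2.ne')
  rw [q1, zpow_neg, Complex.ofReal_inv, show -((q : ℂ) * (((q : ℂ) ^ 2) ^ k)⁻¹ * (e₄ : ℂ)⁻¹ * s₄) =
    -(q * s₄ / (((q : ℂ) ^ 2) ^ k * e₄)) by field_simp,
    show -((q : ℂ) * (((q : ℂ) ^ 2) ^ k)⁻¹ * (e₄ : ℂ)⁻¹ * (s₄ : ℂ)⁻¹) =
    -(q * (s₄ : ℂ)⁻¹ / (((q : ℂ) ^ 2) ^ k * e₄)) by field_simp] at n1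
  rw [q2, zpow_add₀ hp0, ← mul_assoc (q : ℂ)] at n2
  have R1 := regular_of_notPow hq0 hq1 (k := k) (r := r) (l := l) c1 c2 t3 t4 h1 h2 h3 h4 h5 h6 h7
    (left_ne_zero_of_mul n1) (left_ne_zero_of_mul n2)
  have R2 := regular_of_notPow hq0 hq1 (k := k) (r := r) (l := l) (e₃ := e₃) (e₄ := e₄)
    c1 c2 t3 (inv_ne_zero t4) h1
    (by rwa [show (s₄ : ℂ)⁻¹ / s₃ = 1 / (s₃ * s₄) by field_simp])
    (by rwa [show (s₄ : ℂ)⁻¹ / s₃ = 1 / (s₃ * s₄) by field_simp])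
    (by rwa [show 1 / (s₃ * (s₄ : ℂ)⁻¹) = s₄ / s₃ by field_simp])
    (by rwa [show (s₃ : ℂ) / (s₄ : ℂ)⁻¹ = s₃ * s₄ by field_simp])
    (by rw [inv_pow]; exact h6.inv) h7
    (right_ne_zero_of_mul n1) (right_ne_zero_of_mul n2)
  have E1 := rPart_eq hq0 hq1 k r l (β := β) (Z := Z) rfl rfl rfl hz he₁ he₂ he₄ hs₃ hs₄ he R1
    hS1 hS2
  have E2 := rPart_eq hq0 hq1 k r l (β := β) (Z := Z) rfl rfl rfl hz he₁ he₂ he₄ hs₃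
    (inv_ne_zero hs₄) he (by rw [Complex.ofReal_inv]; exact R2)
    (by rwa [S_inv]) (by rwa [S_inv])
  rw [S_inv, S_inv, rootTheta_inv, Complex.ofReal_inv] at E2
  have hi : (iota s₃ : ℂ) * iota s₃ = 1 := by exact_mod_cast iota_sq hs₃
  rw [rElt, E1, E2, half, rootQuot]
  push_cast
  linear_combination (
    halfPre q z β Z e₁ e₂ e₃ e₄ s₃ s₄ *
      (rootTheta q e₃ s₃ * rootTheta q e₄ s₄ / (S q (-k) e₄⁻¹ s₄ * S q (l + r) e₂ s₄ *
        S q (-k - r) e₃⁻¹ s₃ * S q l e₁ s₃) : ℂ) *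
      (gFactor k r l q (((q : ℂ) ^ 2) ^ r) z e₁ e₂ /
        qInf (((q : ℂ) ^ 2) ^ l * e₁ / (z * ((q : ℂ) ^ 2) ^ k * e₄)) ((q : ℂ) ^ 2)) *
      (gCore r q (((q : ℂ) ^ 2) ^ k) (((q : ℂ) ^ 2) ^ r) (((q : ℂ) ^ 2) ^ l) z β Z e₁ e₂ e₃ e₄ s₃
          s₄ - gCore r q (((q : ℂ) ^ 2) ^ k) (((q : ℂ) ^ 2) ^ r) (((q : ℂ) ^ 2) ^ l) z β Z e₁ e₂ e₃
          e₄ s₃ (s₄ : ℂ)⁻¹)) * hi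

/-- The root quotient and the one infinite product in the denominator are invariant under the
exchange defining `r̊` (the product because `e₁ / e₄ = e₂ / e₃`). Both can be taken out of the
difference. -/
theorem rBar_eq {q : ℝ} (hq0 : 0 < q) (hq1 : q < 1) (k r l : ℤ) {z : ℂ}
    {β Z e₁ e₂ e₃ e₄ s₃ s₄ : ℝ} (he₁ : e₁ ≠ 0) (he₂ : e₂ ≠ 0) (hs₃ : s₃ ≠ 0)
    (he : e₃ = e₂ * e₄ / e₁) (hreg : (z, e₄, s₄) ∈ regularSet q 1 e₁ e₂ s₃)
    (hS1 : 0 < S q (-k) e₄⁻¹ s₄) (hS2 : 0 < S q (l + r) e₂ s₄) (hS3 : 0 < S q (-k - r) e₃⁻¹ s₃)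
    (hS4 : 0 < S q l e₁ s₃) :
    rBar q k r l z 1 β Z e₁ e₂ e₃ e₄ s₃ s₄ =
    rootQuot q k r l e₁ e₂ e₃ e₄ s₃ s₄ /
      qInf (((q : ℂ) ^ 2) ^ l * e₁ / (z * ((q : ℂ) ^ 2) ^ k * e₄)) ((q : ℂ) ^ 2) *
      (half k r l q z β Z e₁ e₂ e₃ e₄ s₃ s₄ -
        half (k + r) (-r) (l + r) q z β (Z * e₁ ^ 2 / e₂ ^ 2) e₂ e₁ e₄ e₃ s₄ s₃) := by
  obtain ⟨hz, he₄, hs₄, g1, g2, g3, g4, g5, g6, g7, g8⟩ := hreg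
  simp only at hz he₄ hs₄ g1 g2 g3 g4 g5 g6 g7 g8
  have hqc : (q : ℂ) ≠ 0 := by exact_mod_cast hq0.ne'
  have hp0 : (q : ℂ) ^ 2 ≠ 0 := pow_ne_zero 2 hqc
  have c1 : (e₁ : ℂ) ≠ 0 := by exact_mod_cast he₁
  have c2 : (e₂ : ℂ) ≠ 0 := by exact_mod_cast he₂
  have c4 : (e₄ : ℂ) ≠ 0 := by exact_mod_cast he₄
  have t3 : (s₃ : ℂ) ≠ 0 := by exact_mod_cast hs₃
  have t4 : (s₄ : ℂ) ≠ 0 := by exact_mod_cast hs₄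
  have hc3 : (e₃ : ℂ) = e₂ * e₄ / e₁ := by rw [he]; push_cast; ring
  have he₃ : e₃ ≠ 0 := by rw [he]; exact div_ne_zero (mul_ne_zero he₂ he₄) he₁
  have c3 : (e₃ : ℂ) ≠ 0 := by exact_mod_cast he₃
  obtain ⟨u1, v1, -⟩ := g8 (s₃ * s₄) (by simp)
  obtain ⟨u2, v2, -⟩ := g8 (s₃ / s₄) (by simp)
  obtain ⟨u3, v3, -⟩ := g8 (s₄ / s₃) (by simp)
  obtain ⟨u4, v4, -⟩ := g8 (1 / (s₃ * s₄)) (by simp)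
  push_cast at g3 g4 g5 g6 g7 u1 u2 u3 u4 v1 v2 v3 v4
  rw [one_mul] at g4 g5 v1 v2 v3 v4
  have A := left_part_eq hq0 hq1 k r l (β := β) (Z := Z) (e₃ := e₃) hz he₁ he₂ he₄ hs₃ hs₄
    (by rw [he]; field_simp) (by rwa [hc3]) v3 v4 u3 u4 u2 u1 g6 g1 hS1 hS2
  have i12 : ∀ t t' : ℂ, t * t' = 1 → NotPow q (e₂ / e₁ * t) → NotPow q (e₁ / e₂ * t') := by
    intro t t' htt h
    have := h.inv
    rwa [mul_inv, inv_div, show t⁻¹ = t' from inv_eq_of_mul_eq_one_right htt] at this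
  have e23 : (e₂ : ℂ) / e₃ = e₁ / e₄ := by rw [hc3]; field_simp
  have B := left_part_eq hq0 hq1 (k + r) (-r) (l + r) (β := β) (Z := Z * e₁ ^ 2 / e₂ ^ 2)
    (e₁ := e₂) (e₂ := e₁) (e₃ := e₄) (e₄ := e₃) (s₃ := s₄) (s₄ := s₃) hz he₂ he₁ he₃ hs₄ hs₃
    (by rw [he]; field_simp) g5 (by rwa [e23]) (by rwa [e23, mul_comm (s₄ : ℂ)])
    (i12 _ _ (by field_simp) u3) (i12 _ _ (by field_simp) u1) (i12 _ _ (by field_simp) u2)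
    (i12 _ _ (by field_simp) u4) g7 g2 (by rwa [show -(k + r) = -k - r by ring])
    (by rwa [show l + r + -r = l by ring])
  rw [rootQuot_swap] at B
  have hden : ((q : ℂ) ^ 2) ^ (l + r) * e₂ / (z * ((q : ℂ) ^ 2) ^ (k + r) * e₃) =
      ((q : ℂ) ^ 2) ^ l * e₁ / (z * ((q : ℂ) ^ 2) ^ k * e₄) := by
    have := zpow_ne_zero r hp0
    have := zpow_ne_zero k hp0
    rw [zpow_add₀ hp0, zpow_add₀ hp0, hc3]
    field_simp
  rw [hden] at B
  rw [mul_sub]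
  simp only [rBar, rRing, thetas_cons, thetas_nil, mul_one]
  push_cast at B ⊢
  rw [← A, ← B]
  simp only [halfPre]
  have w1 : (e₂ : ℂ) * (Z * e₁ ^ 2 / e₂ ^ 2) / e₁ ^ 2 = Z / e₂ := by field_simp
  have w2 : (e₁ : ℂ) * (Z / e₂) / e₂ = e₁ * Z / e₂ ^ 2 := by field_simp
  rw [w1, w2]
  congr 1
  · ring_nf
  · ring_nf

/-! ### Evaluation on the line `z = 1`, `s₄ = s₃`, `e₄ = e₁ / u`. -/

/-- The upper parameter `f / p` becomes `1` at the end point `p / f`, leaving one term there, and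
its factorial kills the contribution of the end point `1`. This is the shape of the integral of `R`
for `z = 1`, `s₄ = s₃`. -/
theorem jack_unit {p : ℂ} (hp : ‖p‖ < 1) (hp0 : p ≠ 0) {a b e f g : ℂ} (hf : f ≠ 0) :
    jack p a b f (f / p) e f g = qInf p p * theta f p * qInf f p * qInf a p * qInf b p *
      qInf (e * (p / f)) p * qInf (g * (p / f)) p := by
  have h1 : f / p * (p / f) = 1 := by field_simp
  have h2 : phiReg p (a * (p / f)) (b * (p / f)) (f * (p / f)) 1 (e * (p / f)) (p * (p / f))
      (g * (p / f)) = phiReg p 1 (a * (p / f)) (b * (p / f)) (f * (p / f)) (e * (p / f))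
      (p * (p / f)) (g * (p / f)) := by
    unfold phiReg phiTerm
    congr 1; ext n; ring
  have h3 : p / f * qInf (f / p) p * qInf (p * (p / f)) p = - theta f p := by
    rw [theta, qInf_step hp (f / p), qInf_step hp (p / f), show f / p * p = f by field_simp,
      mul_comm (p / f) p]
    field_simp
    ring
  rw [jack, h1, h2, phiReg_one, qInf_one hp]
  linear_combination (-(qInf a p * qInf b p * qInf f p * qInf p p * qInf (e * (p / f)) p *
    qInf (g * (p / f)) p)) * h3

theorem phiReg_cancel {p : ℂ} (hp : ‖p‖ < 1) (a b c d e f : ℂ) :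
    phiReg p a b c d e f c = qInf c p * phiReg p a b 0 d 0 f e := by
  rw [phiReg, phiReg, ← tsum_mul_left]
  congr 1
  ext n
  simp only [phiTerm, qFac_zero_left, zero_mul, qInf_zero]
  rw [qInf_eq_qFac_mul hp c n]
  ring

theorem jack_cancel {p : ℂ} (hp : ‖p‖ < 1) (a b c d e f : ℂ) :
    jack p a b c d e f c = qInf c p * qInf (c * (p / f)) p * jack p a b 0 d 0 f e := by
  simp only [jack, phiReg_cancel hp, zero_mul, qInf_zero]
  ring

/-- The product of shifted factorials that remains of `R` for `z = 1`, `s₄ = s₃ = s`. -/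
noncomputable def lineFac (q K M L e₁ e₂ e₃ e₄ s : ℂ) : ℂ :=
  qInf (-(q * s / (K * M * e₃))) (q ^ 2) * qInf (-(q * L * e₁ * s)) (q ^ 2) *
    (qInf (-(q / (K * e₄ * s))) (q ^ 2) * qInf (-(q * L * M * e₂ / s)) (q ^ 2))

theorem gCore_line {r : ℤ} {q K M L β Z e₁ e₂ e₃ e₄ s : ℂ} (hq : q ≠ 0) (hp : ‖q ^ 2‖ < 1)
    (hK : K ≠ 0) (hM : M ≠ 0) (he₁ : e₁ ≠ 0) (he₂ : e₂ ≠ 0) (he₄ : e₄ ≠ 0)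
    (hs : s ≠ 0) (he : e₁ * e₃ = e₂ * e₄) (hD : gDen q M 1 e₁ e₂ e₄ s s ≠ 0) :
    gCore r q K M L 1 β Z e₁ e₂ e₃ e₄ s s = lineFac q K M L e₁ e₂ e₃ e₄ s * s ^ (-r) *
      (theta (-(e₂ * s * q)) (q ^ 2) * theta (-(β * (Z / e₂) * s * q)) (q ^ 2) *
      theta (-(β * (Z / e₃) * s⁻¹ * q)) (q ^ 2)) / theta (-(e₄ * s * q)) (q ^ 2) *
      (qInf (q ^ 2 * e₁ / (M * e₂)) (q ^ 2) * qInf (q ^ 2 * (L * e₁ / (K * e₄))) (q ^ 2)) := by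
  have hp0 : q ^ 2 ≠ 0 := pow_ne_zero 2 hq
  have hf : q ^ 2 * e₁ / (M * e₂) ≠ 0 := by simp [*]
  have a1 : q ^ 2 * e₁ * s / (M * e₂ * s) = q ^ 2 * e₁ / (M * e₂) := by field_simp
  have a2 : (1 : ℂ) * q ^ 2 * e₁ / (M * e₂) = q ^ 2 * e₁ / (M * e₂) := by ring
  have a3 : e₁ / (1 * M * e₂) = q ^ 2 * e₁ / (M * e₂) / q ^ 2 := by field_simp
  have hc : e₃ = e₂ * e₄ / e₁ := by field_simp; linear_combination he
  have a4 : q ^ 2 * L * e₁ / (K * M * e₃) * (q ^ 2 / (q ^ 2 * e₁ / (M * e₂))) =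
      q ^ 2 * (L * e₁ / (K * e₄)) := by rw [hc]; field_simp
  have a5 : q ^ 2 * e₁ * s * s / (M * e₂) * (q ^ 2 / (q ^ 2 * e₁ / (M * e₂))) =
      1 * q ^ 2 * (s * s) := by field_simp
  have hJ := jack_unit hp hp0 (a := -(q * s / (K * M * e₃))) (b := -(q * L * e₁ * s))
    (e := q ^ 2 * L * e₁ / (K * M * e₃)) (g := q ^ 2 * e₁ * s * s / (M * e₂)) hf
  rw [a4, a5] at hJ
  unfold gDen at hD
  rw [gCore, coreJack, a1, a2, a3, hJ, lineFac]
  rw [a1] at hD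
  have a6 : (1 : ℂ) * q ^ 2 * (s / s) = q ^ 2 := by field_simp
  rw [a6] at hD ⊢
  have n1 := right_ne_zero_of_mul hD
  have n2 := right_ne_zero_of_mul (left_ne_zero_of_mul hD)
  have n3 := right_ne_zero_of_mul (left_ne_zero_of_mul (left_ne_zero_of_mul hD))
  have n4 := left_ne_zero_of_mul (left_ne_zero_of_mul (left_ne_zero_of_mul hD))
  rw [inv_one, mul_one β]
  generalize qInf (q ^ 2) (q ^ 2) = x1 at *
  generalize theta (q ^ 2 * e₁ / (M * e₂)) (q ^ 2) = x2 at *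
  generalize qInf (1 * q ^ 2 * (s * s)) (q ^ 2) = x3 at *
  generalize theta (-(e₄ * s * q)) (q ^ 2) = x4 at *
  rw [div_mul_eq_mul_div, div_eq_div_iff (mul_ne_zero (mul_ne_zero (mul_ne_zero n4 n3) n2) n1) n4]
  ring

theorem gCore_line_inv {r : ℤ} {q K M L β Z e₁ e₂ e₃ e₄ s : ℂ} (hq : q ≠ 0) (hp : ‖q ^ 2‖ < 1)
    (hK : K ≠ 0) (hM : M ≠ 0) (hL : L ≠ 0) (he₁ : e₁ ≠ 0) (he₂ : e₂ ≠ 0) (he₃ : e₃ ≠ 0)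
    (he₄ : e₄ ≠ 0) (hs : s ≠ 0) (he : e₁ * e₃ = e₂ * e₄)
    (hD : gDen q M 1 e₁ e₂ e₄ s s⁻¹ ≠ 0) :
    gCore r q K M L 1 β Z e₁ e₂ e₃ e₄ s s⁻¹ = lineFac q K M L e₁ e₂ e₃ e₄ s⁻¹ * s ^ r *
      (theta (-(e₂ * s⁻¹ * q)) (q ^ 2) * theta (-(β * (Z / e₂) * s⁻¹ * q)) (q ^ 2) *
      theta (-(β * (Z / e₃) * s * q)) (q ^ 2)) / theta (-(e₄ * s⁻¹ * q)) (q ^ 2) *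
      (qInf (q ^ 2 * e₁ / (M * e₂)) (q ^ 2) * qInf (q ^ 2 * (L * e₁ / (K * e₄))) (q ^ 2)) := by
  have hp0 : q ^ 2 ≠ 0 := pow_ne_zero 2 hq
  have hf : q ^ 2 * e₁ * s / (M * e₂ * s⁻¹) ≠ 0 := by simp [*]
  have a1 : q ^ 2 * e₁ * s * s⁻¹ / (M * e₂) = 1 * q ^ 2 * e₁ / (M * e₂) := by field_simp
  have a2 : (1 : ℂ) * q ^ 2 * e₁ / (M * e₂) * (q ^ 2 / (q ^ 2 * e₁ * s / (M * e₂ * s⁻¹))) =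
      1 * q ^ 2 * (s⁻¹ / s) := by field_simp
  have hc : e₃ = e₂ * e₄ / e₁ := by field_simp; linear_combination he
  have a3 : q ^ 2 * L * e₁ / (K * M * e₃) = q ^ 2 / (q ^ 2 * e₁ * s / (M * e₂ * s⁻¹)) *
      (-(q * s / (K * M * e₃)) * -(q * L * e₁ * s) * (e₁ / (1 * M * e₂))) := by field_simp
  have a4 : q ^ 2 / (q ^ 2 * e₁ * s / (M * e₂ * s⁻¹)) *
      (-(q * L * e₁ * s) * (e₁ / (1 * M * e₂))) = -(q * L * e₁ * s⁻¹) := by field_simp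
  have a5 : q ^ 2 / (q ^ 2 * e₁ * s / (M * e₂ * s⁻¹)) *
      (-(q * s / (K * M * e₃)) * (e₁ / (1 * M * e₂))) = -(q * s⁻¹ / (K * M * e₃)) := by field_simp
  have a6 : q ^ 2 / (q ^ 2 * e₁ * s / (M * e₂ * s⁻¹)) *
      (-(q * s / (K * M * e₃)) * -(q * L * e₁ * s)) = q ^ 2 * (L * e₁ / (K * e₄)) := by
    rw [hc]; field_simp
  have hJ := jack_saalschutz hp hp0 (-(q * s / (K * M * e₃))) (-(q * L * e₁ * s))
    (e₁ / (1 * M * e₂)) hf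
  rw [← a3, a4, a5, a6] at hJ
  unfold gDen at hD
  rw [gCore, coreJack, a1, jack_cancel hp, a2, hJ, lineFac]
  have a7 : (1 : ℂ) * q ^ 2 * (s * s⁻¹) = q ^ 2 := by field_simp
  rw [a7] at hD ⊢
  have n1 := right_ne_zero_of_mul hD
  have n2 := right_ne_zero_of_mul (left_ne_zero_of_mul hD)
  have n3 := right_ne_zero_of_mul (left_ne_zero_of_mul (left_ne_zero_of_mul hD))
  have n4 := left_ne_zero_of_mul (left_ne_zero_of_mul (left_ne_zero_of_mul hD))
  rw [inv_one, mul_one β, inv_inv, one_mul (q ^ 2), show s⁻¹ ^ (-r) = s ^ r by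
    rw [inv_zpow, zpow_neg, inv_inv]]
  simp only [div_inv_eq_mul, one_mul] at n1 n2 n3 n4 ⊢
  generalize qInf (q ^ 2) (q ^ 2) = x1 at *
  generalize theta (q ^ 2 * e₁ * s / (M * e₂ * s⁻¹)) (q ^ 2) = x2 at *
  generalize qInf (q ^ 2 * (s⁻¹ / s)) (q ^ 2) = x3 at *
  generalize theta (-(e₄ * s⁻¹ * q)) (q ^ 2) = x4 at *
  rw [div_mul_eq_mul_div, div_eq_div_iff (mul_ne_zero (mul_ne_zero (mul_ne_zero n4 n3) n2) n1) n4]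
  ring_nf

/-- The theta functions in `halfPre` cancel the denominators of `gCore`. The products `(e₂ / e₁;
p)_∞` and `(p e₁ / e₂; p)_∞` join to `θ(e₂ / e₁)`. Here `xᵢ = -q eᵢ` and `yᵢ = -q β eᵢ'`, with `e₂'
= Z / e₂` and `e₁' = e₁ e₂' / e₂`. -/
theorem half_line {k r l : ℤ} {q β Z e₁ e₂ s u x₁ x₂ y₁ y₂ : ℂ} (hq : q ≠ 0)
    (hp : ‖q ^ 2‖ < 1) (he₁ : e₁ ≠ 0) (he₂ : e₂ ≠ 0) (hs : s ≠ 0) (hu : u ≠ 0)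
    (hx₁ : x₁ = -(e₁ * q)) (hx₂ : x₂ = -(e₂ * q)) (hy₁ : y₁ = -(β * (e₁ * Z / e₂ ^ 2) * q))
    (hy₂ : y₂ = -(β * (Z / e₂) * q)) (hD : halfDen r q 1 e₁ e₂ (e₁ / u) s s ≠ 0) :
    half k r l q 1 β Z e₁ e₂ (e₂ / u) (e₁ / u) s s =
      q ^ (l - k) / qInf (q ^ 2) (q ^ 2) * qInf (q ^ 2 * (u * ((q ^ 2) ^ l / (q ^ 2) ^ k))) (q ^ 2) *
      theta (s ^ 2 * q ^ 2) (q ^ 2) * theta (e₂ / e₁) (q ^ 2) *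
      (theta (x₂ * s / u * q ^ 2) (q ^ 2) * theta (u * y₁ / s) (q ^ 2) * theta (x₁ * s) (q ^ 2) *
        theta (y₁ * s) (q ^ 2)) *
      (lineFac q ((q ^ 2) ^ k) ((q ^ 2) ^ r) ((q ^ 2) ^ l) e₁ e₂ (e₂ / u) (e₁ / u) s * s ^ (-r) *
        (theta (x₁ / (u * s)) (q ^ 2) * theta (x₂ * s) (q ^ 2) * theta (y₂ * s) (q ^ 2) *
          theta (u * y₂ / s) (q ^ 2)) -
      lineFac q ((q ^ 2) ^ k) ((q ^ 2) ^ r) ((q ^ 2) ^ l) e₁ e₂ (e₂ / u) (e₁ / u) s⁻¹ * s ^ r *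
        (theta (x₁ * s / u) (q ^ 2) * theta (x₂ / s) (q ^ 2) * theta (y₂ / s) (q ^ 2) *
          theta (u * y₂ * s) (q ^ 2))) := by
  have hp0 : q ^ 2 ≠ 0 := pow_ne_zero 2 hq
  have hM : (q ^ 2) ^ r ≠ 0 := zpow_ne_zero _ hp0
  have hK : (q ^ 2) ^ k ≠ 0 := zpow_ne_zero _ hp0
  have hL : (q ^ 2) ^ l ≠ 0 := zpow_ne_zero _ hp0
  unfold halfDen at hD
  have hD1 := left_ne_zero_of_mul hD
  have hD2 := left_ne_zero_of_mul (right_ne_zero_of_mul hD)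
  have hD3 := right_ne_zero_of_mul (right_ne_zero_of_mul hD)
  have g1 := gCore_line (r := r) (L := (q ^ 2) ^ l) (β := β) (Z := Z) (e₃ := e₂ / u) hq hp hK hM
    he₁ he₂ (div_ne_zero he₁ hu) hs (by ring) hD2
  have g2 := gCore_line_inv (r := r) (β := β) (Z := Z) (e₃ := e₂ / u) hq hp hK hM hL
    he₁ he₂ (div_ne_zero he₂ hu) (div_ne_zero he₁ hu) hs (by ring) hD3
  have n1 : theta (-(e₁ / u * s * q)) (q ^ 2) ≠ 0 :=
    left_ne_zero_of_mul (left_ne_zero_of_mul (left_ne_zero_of_mul hD2))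
  have n2 : theta (-(e₁ / u * s⁻¹ * q)) (q ^ 2) ≠ 0 :=
    left_ne_zero_of_mul (left_ne_zero_of_mul (left_ne_zero_of_mul hD3))
  have hp' := qInf_self_ne_zero hp
  rw [half, halfPre, gFactor, g1, g2]
  have b1 : (1 : ℂ) * q ^ 2 * e₁ / ((q ^ 2) ^ r * e₂) = q ^ 2 * e₁ / ((q ^ 2) ^ r * e₂) := by ring
  have b2 : (1 : ℂ)⁻¹ * (e₂ / e₁) = e₂ / e₁ := by ring
  have b3 : (1 : ℂ) * q ^ 2 * e₁ / e₂ = q ^ 2 / (e₂ / e₁) := by field_simp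
  have b4 : -(1 * (e₂ / u) * s * q ^ 3) = x₂ * s / u * q ^ 2 := by rw [hx₂]; ring
  have b5 : -(β * 1⁻¹ * (e₁ * (e₁ * Z / e₂ ^ 2) / (e₁ / u)) * s⁻¹ * q) = u * y₁ / s := by
    rw [hy₁]; field_simp
  have b6 : -(e₁ * s * q) = x₁ * s := by rw [hx₁]; ring
  have b7 : -(β * (e₁ * Z / e₂ ^ 2) * s * q) = y₁ * s := by rw [hy₁]; ring
  have b8 : -(e₁ / u * s * q) = x₁ * s / u := by rw [hx₁]; ring
  have b9 : -(e₁ / u * s⁻¹ * q) = x₁ / (u * s) := by rw [hx₁]; field_simp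
  have b10 : -(e₂ * s * q) = x₂ * s := by rw [hx₂]; ring
  have b11 : -(e₂ * s⁻¹ * q) = x₂ / s := by rw [hx₂]; ring
  have b12 : -(β * (Z / e₂) * s * q) = y₂ * s := by rw [hy₂]; ring
  have b13 : -(β * (Z / e₂) * s⁻¹ * q) = y₂ / s := by rw [hy₂]; ring
  have b14 : -(β * (Z / (e₂ / u)) * s * q) = u * y₂ * s := by rw [hy₂]; field_simp
  have b15 : -(β * (Z / (e₂ / u)) * s⁻¹ * q) = u * y₂ / s := by rw [hy₂]; field_simp
  have b16 : q ^ 2 * ((q ^ 2) ^ l * e₁ / ((q ^ 2) ^ k * (e₁ / u))) =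
    q ^ 2 * (u * ((q ^ 2) ^ l / (q ^ 2) ^ k)) := by field_simp
  have b17 : (1 : ℂ) ^ r * q ^ r * 1 ^ (-k - r) * q ^ (l - k - r) = q ^ (l - k) := by
    rw [one_zpow, one_zpow, one_mul, mul_one, ← zpow_add₀ hq]
    congr 1; ring
  rw [b8] at n1
  rw [b9] at n2
  rw [b1] at hD1
  rw [b1, b2, b3, b4, b5, b6, b7, b8, b9, b10, b11, b12, b13, b14, b15, b16, b17]
  have b18 : theta (e₂ / e₁) (q ^ 2) = qInf (e₂ / e₁) (q ^ 2) * qInf (q ^ 2 / (e₂ / e₁)) (q ^ 2) :=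
    rfl
  rw [b18]
  generalize theta (x₁ * s / u) (q ^ 2) = v1 at *
  generalize theta (x₁ / (u * s)) (q ^ 2) = v2 at *
  generalize qInf (q ^ 2 * e₁ / ((q ^ 2) ^ r * e₂)) (q ^ 2) = v3 at *
  generalize qInf (q ^ 2) (q ^ 2) = v4 at *
  have h1 := mul_inv_cancel₀ n1
  have h2 := mul_inv_cancel₀ n2
  have h3 := mul_inv_cancel₀ hD1
  have h4 := mul_inv_cancel₀ hp'
  simp only [div_eq_mul_inv _ v1, div_eq_mul_inv _ v2, div_eq_mul_inv _ v4, mul_inv,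
    div_eq_mul_inv _ (v3 * v4)]
  generalize v1⁻¹ = w1 at *
  generalize v2⁻¹ = w2 at *
  generalize v3⁻¹ = w3 at *
  generalize v4⁻¹ = w4 at *
  generalize theta (x₂ * s / u * q ^ 2) (q ^ 2) = a1
  generalize theta (u * y₁ / s) (q ^ 2) = a2
  generalize theta (x₁ * s) (q ^ 2) = a3
  generalize theta (y₁ * s) (q ^ 2) = a4
  generalize theta (s ^ 2 * q ^ 2) (q ^ 2) = a5
  generalize qInf (e₂ / e₁) (q ^ 2) = a6
  generalize qInf (q ^ 2 / (e₂ / e₁)) (q ^ 2) = a7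
  generalize q ^ (l - k) = a8
  generalize qInf (q ^ 2 * (u * ((q ^ 2) ^ l / (q ^ 2) ^ k))) (q ^ 2) = a9
  generalize lineFac q ((q ^ 2) ^ k) ((q ^ 2) ^ r) ((q ^ 2) ^ l) e₁ e₂ (e₂ / u) (e₁ / u) s *
    s ^ (-r) = c1
  generalize lineFac q ((q ^ 2) ^ k) ((q ^ 2) ^ r) ((q ^ 2) ^ l) e₁ e₂ (e₂ / u) (e₁ / u) s⁻¹ *
    s ^ r = c2
  generalize theta (x₂ * s) (q ^ 2) = d1
  generalize theta (y₂ * s) (q ^ 2) = d2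
  generalize theta (u * y₂ / s) (q ^ 2) = d3
  generalize theta (x₂ / s) (q ^ 2) = d4
  generalize theta (y₂ / s) (q ^ 2) = d5
  generalize theta (u * y₂ * s) (q ^ 2) = d6
  linear_combination (a8 * w4 * a9 * a5 * a6 * a7 * a1 * a2 * a3 * a4) *
    ((c1 * v2 * d1 * d2 * d3) * ((w3 * v3) * h1 + h3) -
      (c2 * v1 * d4 * d5 * d6) * ((w3 * v3) * h2 + h3))

/-- Under the exchange defining `r̊` the product behaves as under `s ↦ s⁻¹`. Both halves of `r̄` are
therefore combinations of the same two products, whose coefficients can be subtracted. -/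
theorem lineFac_swap {q K M L e₁ e₂ e₃ e₄ s : ℂ} (hM : M ≠ 0) :
    lineFac q (K * M) M⁻¹ (L * M) e₂ e₁ e₄ e₃ s = lineFac q K M L e₁ e₂ e₃ e₄ s⁻¹ := by
  unfold lineFac
  have h1 : -(q * s / (K * M * M⁻¹ * e₄)) = -(q / (K * e₄ * s⁻¹)) := by field_simp
  have h2 : -(q * (L * M) * M⁻¹ * e₁ / s) = -(q * L * e₁ * s⁻¹) := by field_simp
  have h3 : -(q / (K * M * e₃ * s)) = -(q * s⁻¹ / (K * M * e₃)) := by field_simp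
  have h4 : -(q * (L * M) * e₂ * s) = -(q * L * M * e₂ / s⁻¹) := by field_simp
  rw [h1, h2, h3, h4]
  ring

/-- A case of the three-term relation, arranged so that the difference acquires the factor `θ(u)`,
which vanishes at `u = 1`. -/
theorem theta_difference {p : ℂ} (hp : ‖p‖ < 1) (hp0 : p ≠ 0) {x y s u : ℂ} (hx : x ≠ 0)
    (hy : y ≠ 0) (hs : s ≠ 0) (hu : u ≠ 0) :
    theta (x / (u * s)) p * theta (x * s) p * theta (y * s) p * theta (u * y / s) p -
      theta (x * s / u) p * theta (x / s) p * theta (y / s) p * theta (u * y * s) p =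
    -(p / (x * s)) * (theta (s ^ 2) p * theta u p * theta (x / (u * y)) p *
      theta (x * y / p) p) := by
  have h := theta_three_term hp hp0 (a := u) (b := x / (u * y)) (d := x * y / p) (f := x * s)
    (g := x / s) hu (by simp [*]) (by simp [*]) (by simp [*]) (by field_simp)
  have e1 : x / s / u = x / (u * s) := by field_simp
  have e2 : x / s / (x / (u * y)) = u * y / s := by field_simp
  have e3 : x / s / (x * y / p) = p / (y * s) := by field_simp
  have e4 : x * s / (x / (u * y)) = u * y * s := by field_simp
  have e5 : x * s / (x * y / p) = p / (y / s) := by field_simp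
  have e6 : p * (x / s) / (x * s) = p / s ^ 2 := by field_simp
  rw [e1, e2, e3, e4, e5, e6, theta_inv _ _ hp0, theta_inv _ _ hp0, theta_inv _ _ hp0] at h
  linear_combination h

/-- The coefficient of `lineFac` at `s` is a `theta_difference` in `(x₁, y₁)` and that at `s⁻¹` one
in `(x₂, y₂)`; hence the common factor `θ(u)`. -/
theorem half_sub_line {k r l : ℤ} {q β Z e₁ e₂ s u x₁ x₂ y₁ y₂ : ℂ} (hq : q ≠ 0)
    (hp : ‖q ^ 2‖ < 1) (hβ : β ≠ 0) (hZ : Z ≠ 0)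
    (he₁ : e₁ ≠ 0) (he₂ : e₂ ≠ 0) (hs : s ≠ 0) (hu : u ≠ 0)
    (hx₁ : x₁ = -(e₁ * q)) (hx₂ : x₂ = -(e₂ * q)) (hy₁ : y₁ = -(β * (e₁ * Z / e₂ ^ 2) * q))
    (hy₂ : y₂ = -(β * (Z / e₂) * q)) (hD : halfDen r q 1 e₁ e₂ (e₁ / u) s s ≠ 0)
    (hD' : halfDen (-r) q 1 e₂ e₁ (e₂ / u) s s ≠ 0) :
    half k r l q 1 β Z e₁ e₂ (e₂ / u) (e₁ / u) s s -
      half (k + r) (-r) (l + r) q 1 β (Z * e₁ ^ 2 / e₂ ^ 2) e₂ e₁ (e₁ / u) (e₂ / u) s s =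
      q ^ (l - k) / qInf (q ^ 2) (q ^ 2) * qInf (q ^ 2 * (u * ((q ^ 2) ^ l / (q ^ 2) ^ k))) (q ^ 2) *
      theta (s ^ 2 * q ^ 2) (q ^ 2) * theta (e₂ / e₁) (q ^ 2) * theta u (q ^ 2) *
      (q ^ 2 * u / (x₂ * s ^ 2) * theta (s ^ 2) (q ^ 2)) *
      (lineFac q ((q ^ 2) ^ k) ((q ^ 2) ^ r) ((q ^ 2) ^ l) e₁ e₂ (e₂ / u) (e₁ / u) s * s ^ (-r) *
        (theta (x₂ * s / u) (q ^ 2) * theta (x₂ * s) (q ^ 2) * theta (y₂ * s) (q ^ 2) *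
          theta (u * y₂ / s) (q ^ 2)) *
        (theta (x₁ / (u * y₁)) (q ^ 2) * theta (x₁ * y₁ / q ^ 2) (q ^ 2) / x₁) +
      lineFac q ((q ^ 2) ^ k) ((q ^ 2) ^ r) ((q ^ 2) ^ l) e₁ e₂ (e₂ / u) (e₁ / u) s⁻¹ * s ^ r *
        (theta (x₁ * s / u) (q ^ 2) * theta (x₁ * s) (q ^ 2) * theta (y₁ * s) (q ^ 2) *
          theta (u * y₁ / s) (q ^ 2)) *
        (theta (x₂ / (u * y₂)) (q ^ 2) * theta (x₂ * y₂ / q ^ 2) (q ^ 2) / x₂)) := by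
  have hp0 : q ^ 2 ≠ 0 := pow_ne_zero 2 hq
  have hM : (q ^ 2) ^ r ≠ 0 := zpow_ne_zero _ hp0
  have hK : (q ^ 2) ^ k ≠ 0 := zpow_ne_zero _ hp0
  have hx₁0 : x₁ ≠ 0 := by simp [*]
  have hx₂0 : x₂ ≠ 0 := by simp [*]
  have hy₁0 : y₁ ≠ 0 := by simp [*]
  have hy₂0 : y₂ ≠ 0 := by simp [*]
  have h1 := half_line (k := k) (l := l) hq hp he₁ he₂ hs hu hx₁ hx₂ hy₁ hy₂ hD
  have h2 := half_line (k := k + r) (l := l + r) (β := β) (Z := Z * e₁ ^ 2 / e₂ ^ 2)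
    (y₁ := y₂) (y₂ := y₁) hq hp he₂ he₁ hs hu hx₂ hx₁ (by rw [hy₂]; field_simp)
    (by rw [hy₁]; field_simp) hD'
  rw [zpow_add₀ hp0, zpow_add₀ hp0, zpow_neg, lineFac_swap hM, ← zpow_neg, neg_neg] at h2
  have hsw := lineFac_swap (q := q) (K := (q ^ 2) ^ k) (M := (q ^ 2) ^ r) (L := (q ^ 2) ^ l)
    (e₁ := e₁) (e₂ := e₂) (e₃ := e₂ / u) (e₄ := e₁ / u) (s := s⁻¹) hM
  rw [inv_inv, ← zpow_neg] at hsw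
  rw [hsw, show l + r - (k + r) = l - k by ring,
    show (q ^ 2) ^ l * (q ^ 2) ^ r / ((q ^ 2) ^ k * (q ^ 2) ^ r) = (q ^ 2) ^ l / (q ^ 2) ^ k by
      field_simp] at h2
  have t1 := theta_mul_base hp hp0 (x := x₂ * s / u) (by simp [*])
  have t2 := theta_mul_base hp hp0 (x := x₁ * s / u) (by simp [*])
  have t3 := theta_inv' hp hp0 (x := e₂ / e₁) (by simp [*])
  rw [inv_div] at t3
  have W1 := theta_difference hp hp0 hx₁0 hy₁0 hs hu
  have W2 := theta_difference hp hp0 hx₂0 hy₂0 hs hu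
  have t1' : theta (x₂ * s / u * q ^ 2) (q ^ 2) = -(u / (x₂ * s)) * theta (x₂ * s / u) (q ^ 2) := by
    rw [t1]; field_simp
  have t2' : theta (x₁ * s / u * q ^ 2) (q ^ 2) = -(u / (x₁ * s)) * theta (x₁ * s / u) (q ^ 2) := by
    rw [t2]; field_simp
  have t4 : e₁ / e₂ = x₁ / x₂ := by rw [hx₁, hx₂]; field_simp
  have hx : x₁ / x₂ * (u / (x₁ * s)) = u / (x₂ * s) := by field_simp
  rw [h1, h2, t1', t2', t3, t4]
  generalize lineFac q ((q ^ 2) ^ k) ((q ^ 2) ^ r) ((q ^ 2) ^ l) e₁ e₂ (e₂ / u) (e₁ / u) s *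
    s ^ (-r) = c1
  generalize lineFac q ((q ^ 2) ^ k) ((q ^ 2) ^ r) ((q ^ 2) ^ l) e₁ e₂ (e₂ / u) (e₁ / u) s⁻¹ *
    s ^ r = c2
  generalize q ^ (l - k) / qInf (q ^ 2) (q ^ 2) *
    qInf (q ^ 2 * (u * ((q ^ 2) ^ l / (q ^ 2) ^ k))) (q ^ 2) * theta (s ^ 2 * q ^ 2) (q ^ 2) = C
  generalize theta (e₂ / e₁) (q ^ 2) = C'
  generalize theta (x₂ * s / u) (q ^ 2) = f1 at *
  generalize theta (x₁ * s / u) (q ^ 2) = f2 at *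
  generalize theta (x₁ / (u * s)) (q ^ 2) = f3 at *
  generalize theta (x₂ / (u * s)) (q ^ 2) = f4 at *
  generalize theta (x₂ * s) (q ^ 2) = d1 at *
  generalize theta (y₂ * s) (q ^ 2) = d2 at *
  generalize theta (u * y₂ / s) (q ^ 2) = d3 at *
  generalize theta (x₂ / s) (q ^ 2) = d4 at *
  generalize theta (y₂ / s) (q ^ 2) = d5 at *
  generalize theta (u * y₂ * s) (q ^ 2) = d6 at *
  generalize theta (x₁ * s) (q ^ 2) = g1 at *
  generalize theta (y₁ * s) (q ^ 2) = g2 at *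
  generalize theta (u * y₁ / s) (q ^ 2) = g3 at *
  generalize theta (x₁ / s) (q ^ 2) = g4 at *
  generalize theta (y₁ / s) (q ^ 2) = g5 at *
  generalize theta (u * y₁ * s) (q ^ 2) = g6 at *
  linear_combination (-(u / (x₂ * s)) * C * C' * f1 * (d1 * d2 * d3) * c1) * W1 -
    (u / (x₂ * s)) * C * C' * f2 * (g1 * g2 * g3) * c2 * W2 -
    (C * C' * f2 * (d3 * d1 * d2) * (c2 * (f4 * g1 * g2 * g3) - c1 * (f1 * g4 * g5 * g6))) * hx

/-! ### Positivity of the radicands and relations between the square roots. -/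

/-- Only the products of corresponding factors are positive, not the factors separately. The limit
of the partial products is non-negative, and it is nonzero since no factor vanishes. -/
theorem qInf_mul_pos {q : ℝ} (hq0 : 0 < q) (hq1 : q < 1) {a b : ℝ}
    (h : ∀ n : ℕ, 0 < (1 - a * (q ^ 2) ^ n) * (1 - b * (q ^ 2) ^ n)) :
    0 < qInf a (q ^ 2) * qInf b (q ^ 2) := by
  have hp := norm_ofReal_sq_lt_one hq0 hq1
  have hne : ∀ x : ℝ, (∀ n : ℕ, 1 - x * (q ^ 2) ^ n ≠ 0) → qInf x (q ^ 2) ≠ 0 := by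
    intro x hx h0
    have h1 := ofReal_qInf (norm_sq_lt_one hq0 hq1) x
    rw [h0, Complex.ofReal_zero, Complex.ofReal_pow] at h1
    refine qInf_ne_zero hp (fun n hn => hx n ?_) h1.symm
    rw [sub_eq_zero]
    exact_mod_cast hn.symm
  have hlim : ∀ x : ℝ, Tendsto (fun n => qFac x (q ^ 2) n) atTop (𝓝 (qInf x (q ^ 2))) := by
    intro x
    have h1 := tendsto_qFac hp (x : ℂ)
    rw [← Complex.ofReal_pow, ← ofReal_qInf (norm_sq_lt_one hq0 hq1)] at h1
    have h2 := (Complex.continuous_re.tendsto _).comp h1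
    rw [Complex.ofReal_re] at h2
    refine h2.congr fun n => ?_
    have : qFac (x : ℂ) ((q ^ 2 : ℝ) : ℂ) n = ((qFac x (q ^ 2) n : ℝ) : ℂ) := by
      simp [qFac]
    rw [Function.comp, this, Complex.ofReal_re]
  refine lt_of_le_of_ne ?_ (mul_ne_zero (hne a fun n => left_ne_zero_of_mul (h n).ne')
    (hne b fun n => right_ne_zero_of_mul (h n).ne')).symm
  refine ge_of_tendsto' ((hlim a).mul (hlim b)) fun n => ?_
  rw [qFac, qFac, ← Finset.prod_mul_distrib]
  exact Finset.prod_nonneg fun i _ => (h i).le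

/-- The reflection `l ↦ -l - 1` turns `2 l + 1` into its negative; the two expressions then differ
by a positive square. -/
theorem Admissible.inv {q e s : ℝ} (hq0 : 0 < q) (he : e ≠ 0) (hs : s ≠ 0)
    (h : Admissible q e s) : Admissible q e⁻¹ s := by
  intro l
  have h1 := h (-l - 1)
  rw [show 2 * (-l - 1) + 1 = -(2 * l + 1) by ring, zpow_neg] at h1
  have hx : q ^ (2 * l + 1) ≠ 0 := (zpow_pos hq0 _).ne'
  generalize q ^ (2 * l + 1) = x at *
  have h2 : (1 + x * e⁻¹ * s) * (1 + x * e⁻¹ * s⁻¹) =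
      (x * e⁻¹) ^ 2 * ((1 + x⁻¹ * e * s) * (1 + x⁻¹ * e * s⁻¹)) := by
    field_simp; ring
  rw [h2]
  exact mul_pos (by positivity) h1

theorem Admissible.qInf_pos {q e s : ℝ} (hq0 : 0 < q) (hq1 : q < 1) (h : Admissible q e s)
    (n : ℤ) : 0 < qInf (-e * s * q ^ (2 * n + 1)) (q ^ 2) *
      qInf (-e * s⁻¹ * q ^ (2 * n + 1)) (q ^ 2) := by
  refine qInf_mul_pos hq0 hq1 fun m => ?_
  have := h (n + m)
  rw [show 2 * (n + (m : ℤ)) + 1 = (2 * n + 1) + 2 * m by ring, zpow_add₀ hq0.ne', zpow_mul,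
    zpow_natCast, show q ^ (2 : ℤ) = q ^ 2 from zpow_ofNat _ _] at this
  convert this using 2 <;> ring

theorem Admissible.S_pos {q e s : ℝ} (hq0 : 0 < q) (hq1 : q < 1) (h : Admissible q e s) (n : ℤ) :
    0 < S q n e s := by
  simp only [S, qInfs_cons, qInfs_nil, mul_one]
  exact Real.sqrt_pos.2 (h.qInf_pos hq0 hq1 n)

theorem Admissible.rootTheta_pos {q e s : ℝ} (hq0 : 0 < q) (hq1 : q < 1) (he : e ≠ 0) (hs : s ≠ 0)
    (h : Admissible q e s) : 0 < rootTheta q e s := by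
  simp only [rootTheta, thetas_cons, thetas_nil, mul_one, theta]
  refine Real.sqrt_pos.2 ?_
  have h1 := h.qInf_pos hq0 hq1 0
  have h2 := (h.inv hq0 he hs).qInf_pos hq0 hq1 0
  simp only [mul_zero, zero_add, zpow_one] at h1 h2
  have e1 : q ^ 2 / (-e * s * q) = -e⁻¹ * s⁻¹ * q := by field_simp
  have e2 : q ^ 2 / (-e * s⁻¹ * q) = -e⁻¹ * s * q := by field_simp
  rw [e1, e2]
  have := mul_pos h1 h2
  linarith

theorem Admissible.ne_zpow {q e s : ℝ} (hq0 : 0 < q) (h : Admissible q e s) (n : ℤ) :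
    -((e : ℂ) * s * q) ≠ ((q : ℂ) ^ 2) ^ n := by
  intro hn
  have h1 := (h (-n)).ne'
  refine h1 (mul_eq_zero_of_left ?_ _)
  have hn' : -(e * s * q) = (q ^ 2) ^ n := by exact_mod_cast hn
  rw [show 2 * -n + 1 = -(2 * n) + 1 by ring, zpow_add₀ hq0.ne', zpow_neg, zpow_mul,
    show q ^ (2 : ℤ) = q ^ 2 from zpow_ofNat _ _, ← hn', zpow_one]
  have h0 : e * s * q ≠ 0 := by
    have := zpow_pos (pow_pos hq0 2) n
    intro h0
    rw [h0] at hn'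
    linarith
  have : e ≠ 0 := fun h => h0 (by rw [h]; ring)
  have : s ≠ 0 := fun h => h0 (by rw [h]; ring)
  field_simp
  ring

theorem Admissible.neg_inv {q e s : ℝ} (h : Admissible q e s) : Admissible q e s⁻¹ := by
  intro l
  rw [inv_inv, mul_comm]
  exact h l

theorem ofReal_rootTheta_sq {q : ℝ} (hq0 : 0 < q) (hq1 : q < 1) {e s : ℝ}
    (h : 0 < rootTheta q e s) : ((rootTheta q e s : ℝ) : ℂ) ^ 2 =
      theta (-(e * s * q) : ℂ) ((q : ℂ) ^ 2) * theta (-(e * (s : ℂ)⁻¹ * q)) ((q : ℂ) ^ 2) := by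
  rw [← Complex.ofReal_pow, rootTheta, Real.sq_sqrt (Real.sqrt_pos.1 h).le]
  simp only [thetas_cons, thetas_nil, mul_one, Complex.ofReal_mul,
    ofReal_theta (norm_sq_lt_one hq0 hq1)]
  push_cast
  ring_nf

/-- Both sides are positive, so their squares may be compared. The four infinite products on the
left form two theta functions at arguments shifted by `p ^ k`, and the powers of `s` cancel. Here `e
> 0` fixes the sign of `(e q) ^ (-k)`. -/
theorem S_mul_S {q : ℝ} (hq0 : 0 < q) (hq1 : q < 1) {e s : ℝ} (he : 0 < e) (hs : s ≠ 0)
    (h : Admissible q e s) (k : ℤ) :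
    S q (-k) e⁻¹ s * S q k e s = (e * q) ^ (-k) * q ^ (-(k * (k - 1))) * rootTheta q e s := by
  have hqc : (q : ℂ) ≠ 0 := by exact_mod_cast hq0.ne'
  have hp0 : (q : ℂ) ^ 2 ≠ 0 := pow_ne_zero 2 hqc
  have hp := norm_ofReal_sq_lt_one hq0 hq1
  have h1 := (h.inv hq0 he.ne' hs).S_pos hq0 hq1 (-k)
  have h2 := h.S_pos hq0 hq1 k
  have h3 := h.rootTheta_pos hq0 hq1 he.ne' hs
  have h4 : 0 < (e * q) ^ (-k) * q ^ (-(k * (k - 1))) * rootTheta q e s := by positivity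
  rw [← pow_left_inj₀ (mul_pos h1 h2).le h4.le two_ne_zero]
  have c1 : (e : ℂ) ≠ 0 := by exact_mod_cast he.ne'
  have c2 : (s : ℂ) ≠ 0 := by exact_mod_cast hs
  have hK := zpow_ne_zero k hp0
  have r1 := ofReal_S_sq hq0 hq1 h1
  have r2 := ofReal_S_sq hq0 hq1 h2
  have r3 := ofReal_rootTheta_sq hq0 hq1 h3
  have t1 := theta_mul_zpow hp hp0 rfl (x := -((e : ℂ) * s * q)) (by simp [*]) k
  have t2 := theta_mul_zpow hp hp0 rfl (x := -((e : ℂ) * (s : ℂ)⁻¹ * q)) (by simp [*]) k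
  rw [theta, neg_neg] at t1 t2
  have a1 : -((q : ℂ) * ((q : ℂ) ^ 2) ^ (-k) * (e⁻¹ : ℝ) * s) =
      q ^ 2 / (-((e : ℂ) * (s : ℂ)⁻¹ * q) * ((q : ℂ) ^ 2) ^ k) := by
    rw [zpow_neg, Complex.ofReal_inv]; field_simp
  have a2 : -((q : ℂ) * ((q : ℂ) ^ 2) ^ (-k) * (e⁻¹ : ℝ) * (s : ℂ)⁻¹) =
      q ^ 2 / (-((e : ℂ) * s * q) * ((q : ℂ) ^ 2) ^ k) := by
    rw [zpow_neg, Complex.ofReal_inv]; field_simp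
  have a3 : -((q : ℂ) * ((q : ℂ) ^ 2) ^ k * e * s) = -((e : ℂ) * s * q) * ((q : ℂ) ^ 2) ^ k := by
    ring
  have a4 : -((q : ℂ) * ((q : ℂ) ^ 2) ^ k * e * (s : ℂ)⁻¹) =
      -((e : ℂ) * (s : ℂ)⁻¹ * q) * ((q : ℂ) ^ 2) ^ k := by ring
  rw [a1, a2] at r1
  rw [a3, a4] at r2
  have m1 : ((e : ℂ) * s * q) ^ (-k) * ((e : ℂ) * (s : ℂ)⁻¹ * q) ^ (-k) =
      ((e : ℂ) * q) ^ (-k) * ((e : ℂ) * q) ^ (-k) := by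
    rw [← mul_zpow, ← mul_zpow]; congr 1; field_simp
  apply Complex.ofReal_injective
  push_cast
  rw [mul_pow, r1, r2, mul_pow _ ((rootTheta q e s : ℝ) : ℂ), r3]
  have := congrArg₂ (· * ·) t1 t2
  refine Eq.trans (Eq.trans ?_ this) ?_
  · ring
  · linear_combination ((q : ℂ) ^ (-(k * (k - 1)))) ^ 2 *
      (theta (-((e : ℂ) * s * q)) ((q : ℂ) ^ 2) *
        theta (-((e : ℂ) * (s : ℂ)⁻¹ * q)) ((q : ℂ) ^ 2)) * m1

/-! ### Theta identities for the diagonal value `k = l`. -/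

/-- The four factorials pair into two shifted theta functions. The elementary factors left over are
those of `S_mul_S`, which cancel against the square roots in `rootQuot_diag`. -/
theorem lineFac_diag {q e₁ e₂ s : ℂ} {k r : ℤ} (hq : q ≠ 0) (hp : ‖q ^ 2‖ < 1) (he₁ : e₁ ≠ 0)
    (he₂ : e₂ ≠ 0) (hs : s ≠ 0) :
    lineFac q ((q ^ 2) ^ k) ((q ^ 2) ^ r) ((q ^ 2) ^ k) e₁ e₂ e₂ e₁ s * s ^ (-r) =
      ((e₁ * q) ^ (-k) * q ^ (-(k * (k - 1)))) *
      ((e₂ * q) ^ (-(k + r)) * q ^ (-((k + r) * (k + r - 1)))) *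
      (theta (-(e₁ * q) * s) (q ^ 2) * theta (-(e₂ * q) / s) (q ^ 2)) := by
  have hp0 : q ^ 2 ≠ 0 := pow_ne_zero 2 hq
  have hM : (q ^ 2) ^ r ≠ 0 := zpow_ne_zero _ hp0
  have hK : (q ^ 2) ^ k ≠ 0 := zpow_ne_zero _ hp0
  have t1 := theta_mul_zpow hp hp0 rfl (x := -(e₁ * q) * s) (by simp [*]) k
  have t2 := theta_mul_zpow hp hp0 rfl (x := -(e₂ * q) / s) (by simp [*]) (k + r)
  rw [theta] at t1 t2
  rw [zpow_add₀ hp0] at t2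
  have b1 : -(q * s / ((q ^ 2) ^ k * (q ^ 2) ^ r * e₂)) =
      q ^ 2 / (-(e₂ * q) / s * ((q ^ 2) ^ k * (q ^ 2) ^ r)) := by field_simp
  have b2 : -(q * (q ^ 2) ^ k * e₁ * s) = -(e₁ * q) * s * (q ^ 2) ^ k := by ring
  have b3 : -(q / ((q ^ 2) ^ k * e₁ * s)) = q ^ 2 / (-(e₁ * q) * s * (q ^ 2) ^ k) := by field_simp
  have b4 : -(q * (q ^ 2) ^ k * (q ^ 2) ^ r * e₂ / s) =
      -(e₂ * q) / s * ((q ^ 2) ^ k * (q ^ 2) ^ r) := by ring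
  have m1 : (-(-(e₁ * q) * s)) ^ (-k) * (-(-(e₂ * q) / s)) ^ (-(k + r)) * s ^ (-r) =
      (e₁ * q) ^ (-k) * (e₂ * q) ^ (-(k + r)) := by
    rw [show -(-(e₁ * q) * s) = e₁ * q * s by ring, show -(-(e₂ * q) / s) = e₂ * q * s⁻¹ by ring,
      mul_zpow _ s, mul_zpow _ s⁻¹, inv_zpow, ← zpow_neg]
    have : s ^ (-k) * s ^ (- -(k + r)) * s ^ (-r) = 1 := by
      rw [← zpow_add₀ hs, ← zpow_add₀ hs, show -k + - -(k + r) + -r = 0 by ring, zpow_zero]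
    linear_combination ((e₁ * q) ^ (-k) * (e₂ * q) ^ (-(k + r))) * this
  rw [lineFac, b1, b2, b3, b4]
  have := congrArg₂ (· * ·) t1 t2
  linear_combination s ^ (-r) * this + (q ^ (-(k * (k - 1))) * q ^ (-((k + r) * (k + r - 1))) *
    (theta (-(e₁ * q) * s) (q ^ 2) * theta (-(e₂ * q) / s) (q ^ 2))) * m1

/-- Two three-term relations, exchanged by `1 ↔ 2`, are combined. Their third terms differ only by
`θ(x₂ / x₁)` against `θ(x₁ / x₂)`, which agree up to an elementary factor, and so they cancel. -/
theorem theta_four_term {p : ℂ} (hp : ‖p‖ < 1) (hp0 : p ≠ 0) {x₁ x₂ y₁ y₂ s : ℂ} (hx₁ : x₁ ≠ 0)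
    (hx₂ : x₂ ≠ 0) (hy₁ : y₁ ≠ 0) (hy₂ : y₂ ≠ 0) (hs : s ≠ 0) (h : x₁ * y₂ = x₂ * y₁) :
    theta (s ^ 2) p * (y₂ * theta (x₁ * y₁ / p) p *
        (theta (x₂ * s) p * theta (x₂ / s) p * theta (y₂ * s) p * theta (y₂ / s) p) +
      y₁ * theta (x₂ * y₂ / p) p *
        (theta (x₁ * s) p * theta (x₁ / s) p * theta (y₁ * s) p * theta (y₁ / s) p)) =
    theta (x₂ * y₁ / p) p * (y₁ * theta (x₂ * s ^ 2 / x₁) p *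
        (theta (x₁ * s) p * theta (y₁ * s) p * theta (x₂ / s) p * theta (y₂ / s) p) +
      y₂ * theta (x₁ * s ^ 2 / x₂) p *
        (theta (x₂ * s) p * theta (y₂ * s) p * theta (x₁ / s) p * theta (y₁ / s) p)) := by
  have key : ∀ {x₁ x₂ y₁ y₂ : ℂ}, x₁ ≠ 0 → x₂ ≠ 0 → y₁ ≠ 0 → y₂ ≠ 0 → x₁ * y₂ = x₂ * y₁ →
      theta (x₂ * s) p * theta (s ^ 2) p * theta (x₁ * y₁ / p) p * (-(y₂ * s / p) * theta (y₂ * s) p) -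
        theta (x₁ * s) p * theta (x₂ * s ^ 2 / x₁) p * theta (x₂ * y₁ / p) p *
          (-(y₁ * s / p) * theta (y₁ * s) p) =
      -(p / (x₂ * s)) * (theta (x₂ / x₁) p * theta (x₁ / s) p * theta (y₁ / s) p *
        theta (x₂ * y₁ * s ^ 2 / p ^ 2) p) := by
    intro x₁ x₂ y₁ y₂ hx₁ hx₂ hy₁ hy₂ h
    have h1 := theta_three_term hp hp0 (a := x₁ / s) (b := p / (y₁ / s))
      (d := x₂ * y₁ * s ^ 2 / p ^ 2) (f := x₂ * s) (g := x₁ * s) (by simp [*]) (by simp [*])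
      (by simp [*]) (by simp [*]) (by field_simp)
    have sh : ∀ y, y ≠ 0 → theta (p / (y * s / p)) p = -(y * s / p) * theta (y * s) p := by
      intro y hy
      rw [theta_inv _ _ hp0, theta_mul_base hp hp0 (x := y * s / p) (by simp [*])]
      congr 2; field_simp
    have e1 : x₁ * s / (x₁ / s) = s ^ 2 := by field_simp
    have e2 : x₁ * s / (p / (y₁ / s)) = x₁ * y₁ / p := by field_simp
    have e3 : x₁ * s / (x₂ * y₁ * s ^ 2 / p ^ 2) = p / (y₂ * s / p) := by
      rw [← h]; field_simp
    have e4 : x₂ * s / (x₁ / s) = x₂ * s ^ 2 / x₁ := by field_simp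
    have e5 : x₂ * s / (p / (y₁ / s)) = x₂ * y₁ / p := by field_simp
    have e6 : x₂ * s / (x₂ * y₁ * s ^ 2 / p ^ 2) = p / (y₁ * s / p) := by field_simp
    have e7 : p * (x₁ * s) / (x₂ * s) = p / (x₂ / x₁) := by field_simp
    rw [e1, e2, e3, e4, e5, e6, e7, sh _ hy₁, sh _ hy₂, theta_inv _ _ hp0, theta_inv _ _ hp0] at h1
    exact h1
  have k1 := key hx₁ hx₂ hy₁ hy₂ h
  have k2 := key hx₂ hx₁ hy₂ hy₁ h.symm
  have t := theta_inv' hp hp0 (x := x₁ / x₂) (by simp [*])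
  rw [inv_div] at t
  rw [h] at k2
  have t' : -(p / (x₂ * s)) * theta (x₂ / x₁) p = p / (x₁ * s) * theta (x₁ / x₂) p := by
    rw [t]; field_simp
  have m : s / p ≠ 0 := by simp [*]
  apply mul_left_cancel₀ m
  linear_combination -(theta (x₂ / s) p * theta (y₂ / s) p) * k1 -
    (theta (x₁ / s) p * theta (y₁ / s) p) * k2 -
    (theta (x₁ / s) p * theta (y₁ / s) p * theta (x₂ / s) p * theta (y₂ / s) p *
      theta (x₂ * y₁ * s ^ 2 / p ^ 2) p) * t'

/-- The value of `r̄` from its limit along a line. -/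
theorem line_value {p : ℂ} (hp : ‖p‖ < 1) (hp0 : p ≠ 0) {x₁ x₂ y₁ y₂ s : ℂ} (hx₁ : x₁ ≠ 0)
    (hx₂ : x₂ ≠ 0) (hy₁ : y₁ ≠ 0) (hy₂ : y₂ ≠ 0) (hs : s ≠ 0) (h : x₁ * y₂ = x₂ * y₁) :
    p / (x₂ * s ^ 2) * theta (s ^ 2) p *
      ((theta (x₁ * s) p * theta (x₂ / s) p) * (theta (x₂ * s) p * theta (x₂ * s) p *
          theta (y₂ * s) p * theta (y₂ / s) p) *
        (theta (x₁ / y₁) p * theta (x₁ * y₁ / p) p / x₁) +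
      (theta (x₁ / s) p * theta (x₂ * s) p) * (theta (x₁ * s) p * theta (x₁ * s) p *
          theta (y₁ * s) p * theta (y₁ / s) p) *
        (theta (x₂ / y₂) p * theta (x₂ * y₂ / p) p / x₂)) =
    -(theta (x₂ * y₁) p * theta (y₁ / x₁) p * theta (x₁ * s) p * theta (x₂ * s) p) *
      (theta (x₂ / x₁ * s ^ 2 * p) p * (theta (x₁ * s) p * theta (y₁ * s) p * theta (x₂ / s) p *
          theta (y₂ / s) p) -
        (s ^ 2)⁻¹ * (theta (x₂ / x₁ * (s ^ 2)⁻¹ * p) p * (theta (x₁ / s) p * theta (y₁ / s) p *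
          theta (x₂ * s) p * theta (y₂ * s) p))) := by
  have F := theta_four_term hp hp0 hx₁ hx₂ hy₁ hy₂ hs h
  have hy : y₂ = x₂ * y₁ / x₁ := by field_simp; linear_combination h
  have e0 : x₂ / y₂ = x₁ / y₁ := by rw [hy]; field_simp
  have t1 := theta_inv' hp hp0 (x := x₁ / y₁) (by simp [*])
  rw [inv_div] at t1
  have t2 := theta_mul_base hp hp0 (x := x₂ * y₁ / p) (by simp [*])
  rw [div_mul_cancel₀ _ hp0] at t2
  have t3 := theta_mul_base hp hp0 (x := x₂ * s ^ 2 / x₁) (by simp [*])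
  have t4 := theta_inv (x₁ * s ^ 2 / x₂) p hp0
  have e1 : p / (x₁ * s ^ 2 / x₂) = x₂ / x₁ * (s ^ 2)⁻¹ * p := by field_simp
  have e2 : x₂ / x₁ * s ^ 2 * p = x₂ * s ^ 2 / x₁ * p := by ring
  have t2' : theta (x₂ * y₁) p = -(p / (x₂ * y₁)) * theta (x₂ * y₁ / p) p := by
    rw [t2]; field_simp
  have t3' : theta (x₂ * s ^ 2 / x₁ * p) p = -(x₁ / (x₂ * s ^ 2)) * theta (x₂ * s ^ 2 / x₁) p := by
    rw [t3]; field_simp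
  rw [e1] at t4
  rw [e0, t1, t2', e2, t3', t4]
  generalize theta (x₁ / y₁) p = a1 at *
  generalize theta (x₂ * y₁ / p) p = a2 at *
  generalize theta (x₂ * s ^ 2 / x₁) p = a3 at *
  generalize theta (x₁ * s ^ 2 / x₂) p = a4 at *
  generalize theta (x₁ * s) p = b1 at *
  generalize theta (x₂ * s) p = b2 at *
  generalize theta (y₁ * s) p = b3 at *
  generalize theta (y₂ * s) p = b4 at *
  generalize theta (x₁ / s) p = b5 at *
  generalize theta (x₂ / s) p = b6 at *
  generalize theta (y₁ / s) p = b7 at *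
  generalize theta (y₂ / s) p = b8 at *
  generalize theta (x₁ * y₁ / p) p = c1 at *
  generalize theta (x₂ * y₂ / p) p = c2 at *
  generalize theta (s ^ 2) p = c3 at *
  rw [hy] at F
  have F' : c3 * (c1 * (b2 * b6 * b4 * b8) / x₁ + c2 * (b1 * b5 * b3 * b7) / x₂) =
      a2 * (a3 * (b1 * b3 * b6 * b8) / x₂ + a4 * (b2 * b4 * b5 * b7) / x₁) := by
    field_simp at F ⊢
    linear_combination F
  have e3 : p / (x₂ * y₁) * (y₁ / x₁) * (x₁ / (x₂ * s ^ 2)) = p / (x₂ * s ^ 2) * x₂⁻¹ := by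
    field_simp
  have e4 : p / (x₂ * y₁) * (y₁ / x₁) * (s ^ 2)⁻¹ = p / (x₂ * s ^ 2) * x₁⁻¹ := by field_simp
  linear_combination (p / (x₂ * s ^ 2) * a1 * b1 * b2) * F' -
    (a2 * a1 * b1 * b2 * (a3 * (b1 * b3 * b6 * b8))) * e3 -
    (a2 * a1 * b1 * b2 * (a4 * (b5 * b7 * b2 * b4))) * e4

/-! ### Existence of the value at generic parameters. -/

/-- The genericity assumptions on the parameters at `z = 1`, `e₄ = e₁`, `s₄ = s₃ = s`. -/
structure Generic (q e₁ e₂ s : ℝ) : Prop where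
  ne₁ : e₁ ≠ 0
  ne₂ : e₂ ≠ 0
  ne_s : s ≠ 0
  adm₁ : Admissible q e₁ s
  adm₂ : Admissible q e₂ s
  ratio : NotPow q (e₂ / e₁)
  ratio_mul : NotPow q (e₂ / e₁ * s ^ 2)
  ratio_div : NotPow q (e₂ / e₁ / s ^ 2)
  sq : NotPow q (s ^ 2)

theorem Generic.swap {q e₁ e₂ s : ℝ} (h : Generic q e₁ e₂ s) : Generic q e₂ e₁ s where
  ne₁ := h.ne₂
  ne₂ := h.ne₁
  ne_s := h.ne_s
  adm₁ := h.adm₂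
  adm₂ := h.adm₁
  ratio := by have := h.ratio.inv; rwa [inv_div] at this
  ratio_mul := by
    have := h.ratio_div.inv
    rwa [show (e₂ / e₁ / s ^ 2 : ℂ)⁻¹ = e₁ / e₂ * s ^ 2 by rw [inv_div, div_div_eq_mul_div]; ring]
      at this
  ratio_div := by
    have := h.ratio_mul.inv
    rwa [mul_inv, inv_div, ← div_eq_mul_inv] at this
  sq := h.sq

theorem theta_ne_zero_iff_notPow {q : ℝ} (hq0 : 0 < q) (hq1 : q < 1) {x : ℂ} (hx : x ≠ 0) :
    theta x ((q : ℂ) ^ 2) ≠ 0 ↔ NotPow q x := by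
  have hp0 : (q : ℂ) ^ 2 ≠ 0 := pow_ne_zero 2 (by exact_mod_cast hq0.ne')
  refine ⟨fun h n => ?_, fun h => h.theta_ne_zero hq0 hq1 0 hx (by simp)⟩
  rw [zpow_mul, show (q : ℂ) ^ (2 : ℤ) = q ^ 2 from zpow_ofNat _ _]
  exact ne_zpow_of_theta_ne_zero (norm_ofReal_sq_lt_one hq0 hq1) hp0 h n

/-- Away from `0` the condition means `θ(f y) ≠ 0`, and this is open by continuity of `θ`. -/
theorem eventually_notPow {X : Type*} [TopologicalSpace X] {q : ℝ} (hq0 : 0 < q) (hq1 : q < 1)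
    {f : X → ℂ} {x : X} (hf : ContinuousAt f x) (h0 : f x ≠ 0) (h : NotPow q (f x)) :
    ∀ᶠ y in 𝓝 x, NotPow q (f y) := by
  have hp := norm_ofReal_sq_lt_one hq0 hq1
  have h1 := (ContinuousAt.theta hp hf h0).eventually_ne
    ((theta_ne_zero_iff_notPow hq0 hq1 h0).2 h)
  filter_upwards [h1, hf.eventually_ne h0] with y h2 h3
  exact (theta_ne_zero_iff_notPow hq0 hq1 h3).1 h2

theorem Generic.halfDen_ne_zero {q e₁ e₂ s : ℝ} (hq0 : 0 < q) (hq1 : q < 1)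
    (h : Generic q e₁ e₂ s) (r : ℤ) : halfDen r q 1 e₁ e₂ e₁ s s ≠ 0 := by
  have hp := norm_ofReal_sq_lt_one hq0 hq1
  have hqc : (q : ℂ) ≠ 0 := by exact_mod_cast hq0.ne'
  have hp0 : (q : ℂ) ^ 2 ≠ 0 := pow_ne_zero 2 hqc
  have c1 : (e₁ : ℂ) ≠ 0 := by exact_mod_cast h.ne₁
  have c2 : (e₂ : ℂ) ≠ 0 := by exact_mod_cast h.ne₂
  have c3 : (s : ℂ) ≠ 0 := by exact_mod_cast h.ne_s
  have hM := zpow_ne_zero r hp0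
  have hq2 := qInf_self_ne_zero hp
  have a1 := theta_ne_zero hp hp0 (x := -((e₁ : ℂ) * s * q)) (by simp [*]) (h.adm₁.ne_zpow hq0)
  have a2 := theta_ne_zero hp hp0 (x := -((e₁ : ℂ) * (s⁻¹ : ℝ) * q)) (by simp [*])
    (h.adm₁.neg_inv.ne_zpow hq0)
  rw [Complex.ofReal_inv] at a2
  have b1 : qInf (1 * (q : ℂ) ^ 2 * e₁ / (((q : ℂ) ^ 2) ^ r * e₂)) ((q : ℂ) ^ 2) ≠ 0 :=
    h.ratio.inv.qInf_ne_zero hq0 hq1 (1 - r) (by rw [zpow_sub₀ hp0, zpow_one]; field_simp)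
  have b2 : theta ((q : ℂ) ^ 2 * e₁ * s / (((q : ℂ) ^ 2) ^ r * e₂ * s)) ((q : ℂ) ^ 2) ≠ 0 :=
    h.ratio.inv.theta_ne_zero hq0 hq1 (1 - r) (by simp [*])
      (by rw [zpow_sub₀ hp0, zpow_one]; field_simp)
  have b3 : theta ((q : ℂ) ^ 2 * e₁ * s / (((q : ℂ) ^ 2) ^ r * e₂ * (s : ℂ)⁻¹)) ((q : ℂ) ^ 2) ≠ 0 :=
    h.ratio_div.inv.theta_ne_zero hq0 hq1 (1 - r) (by simp [*])
      (by rw [zpow_sub₀ hp0, zpow_one]; field_simp)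
  have b4 : qInf (1 * (q : ℂ) ^ 2 * (s * s)) ((q : ℂ) ^ 2) ≠ 0 :=
    h.sq.qInf_ne_zero hq0 hq1 1 (by rw [zpow_one]; ring)
  have b5 : qInf (1 * (q : ℂ) ^ 2 * ((s : ℂ)⁻¹ / s)) ((q : ℂ) ^ 2) ≠ 0 :=
    h.sq.inv.qInf_ne_zero hq0 hq1 1 (by rw [zpow_one]; field_simp)
  have b6 : qInf (1 * (q : ℂ) ^ 2 * (s / s)) ((q : ℂ) ^ 2) ≠ 0 := by
    rwa [div_self c3, one_mul, mul_one]
  have b7 : qInf (1 * (q : ℂ) ^ 2 * (s * (s : ℂ)⁻¹)) ((q : ℂ) ^ 2) ≠ 0 := by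
    rwa [mul_inv_cancel₀ c3, one_mul, mul_one]
  simp only [halfDen, gDen]
  exact mul_ne_zero b1 (mul_ne_zero (mul_ne_zero (mul_ne_zero (mul_ne_zero a1 b2) b4) b6)
    (mul_ne_zero (mul_ne_zero (mul_ne_zero a2 b3) b7) b5))

/-- The numerator of `r̄` as a function of `(z, e₄, s₄)`. -/
noncomputable def rBarNum (q : ℝ) (k r l : ℤ) (β Z e₁ e₂ s : ℝ) (y : ℂ × ℝ × ℝ) : ℂ :=
  half k r l q y.1 β Z e₁ e₂ (e₂ * y.2.1 / e₁) y.2.1 s y.2.2 -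
    half (k + r) (-r) (l + r) q y.1 β (Z * e₁ ^ 2 / e₂ ^ 2) e₂ e₁ y.2.1 (e₂ * y.2.1 / e₁) y.2.2 s

/-- The denominators of `rBarNum` do not vanish. -/
def NumRegular (q : ℝ) (r : ℤ) (e₁ e₂ s : ℝ) (y : ℂ × ℝ × ℝ) : Prop :=
  y.1 ≠ 0 ∧ y.2.1 ≠ 0 ∧ y.2.2 ≠ 0 ∧ halfDen r q y.1 e₁ e₂ y.2.1 s y.2.2 ≠ 0 ∧
    halfDen (-r) q y.1 e₂ e₁ (e₂ * y.2.1 / e₁) y.2.2 s ≠ 0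

theorem Generic.eventually_numRegular {q e₁ e₂ s : ℝ} (hq0 : 0 < q) (hq1 : q < 1)
    (h : Generic q e₁ e₂ s) (r : ℤ) :
    ∀ᶠ y : ℂ × ℝ × ℝ in 𝓝 (1, e₁, s), NumRegular q r e₁ e₂ s y := by
  have hp := norm_ofReal_sq_lt_one hq0 hq1
  have hqc : (q : ℂ) ≠ 0 := by exact_mod_cast hq0.ne'
  have c1 : (e₁ : ℂ) ≠ 0 := by exact_mod_cast h.ne₁
  have c2 : (e₂ : ℂ) ≠ 0 := by exact_mod_cast h.ne₂
  have c3 : (s : ℂ) ≠ 0 := by exact_mod_cast h.ne_s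
  have d1 := h.halfDen_ne_zero hq0 hq1 r
  have d2 := h.swap.halfDen_ne_zero hq0 hq1 (-r)
  have e1 := ContinuousAt.halfDen (x := ((1 : ℂ), e₁, s)) (r := r) (z := fun y : ℂ × ℝ × ℝ => y.1)
    (e₄ := fun y => y.2.1) (s₃ := fun _ => s) (s₄ := fun y => y.2.2) hp hqc c1 c2 (by fun_prop)
    (by fun_prop) (by fun_prop) (by fun_prop) c1 c3 c3
  have e2 := ContinuousAt.halfDen (x := ((1 : ℂ), e₁, s)) (r := -r) (z := fun y : ℂ × ℝ × ℝ => y.1)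
    (e₄ := fun y => e₂ * y.2.1 / e₁) (s₃ := fun y => y.2.2) (s₄ := fun y => s) hp hqc c2 c1
    (by fun_prop) (by fun_prop) (by fun_prop) (by fun_prop) (by simp [*]) c3 c3
  have f1 : ContinuousAt (fun y : ℂ × ℝ × ℝ => y.1) (1, e₁, s) := by fun_prop
  have f2 : ContinuousAt (fun y : ℂ × ℝ × ℝ => y.2.1) (1, e₁, s) := by fun_prop
  have f3 : ContinuousAt (fun y : ℂ × ℝ × ℝ => y.2.2) (1, e₁, s) := by fun_prop
  filter_upwards [f1.eventually_ne one_ne_zero, f2.eventually_ne h.ne₁, f3.eventually_ne h.ne_s,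
    e1.eventually_ne d1, e2.eventually_ne (by simpa [mul_div_cancel_right₀ _ c1] using d2)]
    with y h1 h2 h3 h4 h5
  exact ⟨h1, h2, h3, h4, h5⟩

theorem NumRegular.continuousAt {q : ℝ} (hq0 : 0 < q) (hq1 : q < 1) {k r l : ℤ}
    {β Z e₁ e₂ s : ℝ} (hβ : β ≠ 0) (hZ : Z ≠ 0) (he₁ : e₁ ≠ 0) (he₂ : e₂ ≠ 0) (hs : s ≠ 0)
    {y : ℂ × ℝ × ℝ} (hy : NumRegular q r e₁ e₂ s y) :
    ContinuousAt (rBarNum q k r l β Z e₁ e₂ s) y := by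
  obtain ⟨h1, h2, h3, h4, h5⟩ := hy
  have hp := norm_ofReal_sq_lt_one hq0 hq1
  have hqc : (q : ℂ) ≠ 0 := by exact_mod_cast hq0.ne'
  have c1 : (e₁ : ℂ) ≠ 0 := by exact_mod_cast he₁
  have c2 : (e₂ : ℂ) ≠ 0 := by exact_mod_cast he₂
  have c3 : (s : ℂ) ≠ 0 := by exact_mod_cast hs
  have c4 : (y.2.1 : ℂ) ≠ 0 := by exact_mod_cast h2
  have c5 : (y.2.2 : ℂ) ≠ 0 := by exact_mod_cast h3
  have cβ : (β : ℂ) ≠ 0 := by exact_mod_cast hβ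
  have cZ : (Z : ℂ) ≠ 0 := by exact_mod_cast hZ
  have i1 := ContinuousAt.half (x := y) (k := k) (r := r) (l := l) hp hqc cβ cZ c1 c2
    (z := fun y : ℂ × ℝ × ℝ => y.1) (e₃ := fun y => e₂ * y.2.1 / e₁) (e₄ := fun y => y.2.1)
    (s₃ := fun _ => s) (s₄ := fun y => y.2.2) (by fun_prop) (by fun_prop) (by fun_prop)
    (by fun_prop) (by fun_prop) h1 (by simp [*]) c4 c3 c5 h4
  have i2 := ContinuousAt.half (x := y) (k := k + r) (r := -r) (l := l + r) (Z := Z * e₁ ^ 2 / e₂ ^ 2)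
    hp hqc cβ (by simp [*]) c2 c1
    (z := fun y : ℂ × ℝ × ℝ => y.1) (e₄ := fun y => e₂ * y.2.1 / e₁) (e₃ := fun y => y.2.1)
    (s₄ := fun _ => s) (s₃ := fun y => y.2.2) (by fun_prop) (by fun_prop) (by fun_prop)
    (by fun_prop) (by fun_prop) h1 c4 (by simp [*]) c5 c3 h5
  refine (i1.sub i2).congr (Eventually.of_forall fun w => ?_)
  simp only [rBarNum, Pi.sub_apply]

theorem NumRegular.differentiableAt {q : ℝ} (hq0 : 0 < q) (hq1 : q < 1) {k r l : ℤ}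
    {β Z e₁ e₂ s : ℝ} (hβ : β ≠ 0) (hZ : Z ≠ 0) (he₁ : e₁ ≠ 0) (he₂ : e₂ ≠ 0) (hs : s ≠ 0)
    {y : ℂ × ℝ × ℝ} (hy : NumRegular q r e₁ e₂ s y) :
    DifferentiableAt ℂ (fun z => rBarNum q k r l β Z e₁ e₂ s (z, y.2)) y.1 := by
  obtain ⟨h1, h2, h3, h4, h5⟩ := hy
  have hp := norm_ofReal_sq_lt_one hq0 hq1
  have hqc : (q : ℂ) ≠ 0 := by exact_mod_cast hq0.ne'
  have c1 : (e₁ : ℂ) ≠ 0 := by exact_mod_cast he₁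
  have c2 : (e₂ : ℂ) ≠ 0 := by exact_mod_cast he₂
  have c3 : (s : ℂ) ≠ 0 := by exact_mod_cast hs
  have c4 : (y.2.1 : ℂ) ≠ 0 := by exact_mod_cast h2
  have c5 : (y.2.2 : ℂ) ≠ 0 := by exact_mod_cast h3
  have cβ : (β : ℂ) ≠ 0 := by exact_mod_cast hβ
  have cZ : (Z : ℂ) ≠ 0 := by exact_mod_cast hZ
  have i1 := DifferentiableAt.half (k := k) (r := r) (l := l) hp hqc cβ cZ c1 c2 h1
    (e₃ := e₂ * y.2.1 / e₁) (by simp [*]) c4 c3 c5 h4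
  have i2 := DifferentiableAt.half (k := k + r) (r := -r) (l := l + r)
    (Z := Z * e₁ ^ 2 / e₂ ^ 2) hp hqc cβ (by simp [*]) c2 c1 h1 c4 (by simp [*]) c5 c3 h5
  refine (i1.sub i2).congr_of_eventuallyEq (Eventually.of_forall fun w => ?_)
  simp only [rBarNum, Pi.sub_apply]

theorem half_eq_zero {k r l : ℤ} {q z β Z e₁ e₂ e₃ e₄ s₃ s₄ : ℂ} (hq : q ≠ 0) (hp : ‖q ^ 2‖ < 1)
    (hkl : l ≤ k) (hz : z ≠ 0) (he₁ : e₁ ≠ 0) (he₂ : e₂ ≠ 0) (he₃ : e₃ ≠ 0) (he₄ : e₄ ≠ 0)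
    (hs₃ : s₃ ≠ 0) (hs₄ : s₄ ≠ 0) (he : e₁ * e₃ = e₂ * e₄) (hze₄ : z * e₄ = e₁)
    (had : ∀ n : ℤ, -(q * s₃ * z ^ 2 / ((q ^ 2) ^ k * e₁)) ≠ (q ^ 2) ^ n)
    (hD : halfDen r q z e₁ e₂ e₄ s₃ s₄ ≠ 0) :
    half k r l q z β Z e₁ e₂ e₃ e₄ s₃ s₄ = 0 := by
  have h2 := left_ne_zero_of_mul (right_ne_zero_of_mul hD)
  have h3 := right_ne_zero_of_mul (right_ne_zero_of_mul hD)
  rw [half, gCore_inv_of_resonant hq hp rfl rfl rfl hkl hz he₁ he₂ he₃ he₄ hs₃ hs₄ he hze₄ had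
    (left_ne_zero_of_mul (left_ne_zero_of_mul (left_ne_zero_of_mul h2)))
    (right_ne_zero_of_mul (left_ne_zero_of_mul (left_ne_zero_of_mul h2)))
    (right_ne_zero_of_mul (left_ne_zero_of_mul h2)) (right_ne_zero_of_mul h2)
    (left_ne_zero_of_mul (left_ne_zero_of_mul (left_ne_zero_of_mul h3)))
    (right_ne_zero_of_mul (left_ne_zero_of_mul (left_ne_zero_of_mul h3)))
    (right_ne_zero_of_mul (left_ne_zero_of_mul h3)) (right_ne_zero_of_mul h3), sub_self, mul_zero]

/-- Since `e₁ / e₄ = e₂ / e₃`, the hypersurface `z e₄ = e₁` is also resonant for `r̊`, so both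
halves vanish separately. The noncoincidence condition of the resonance lemma follows from
admissibility near the point. -/
theorem Generic.rBarNum_eq_zero {q e₁ e₂ s β Z : ℝ} (hq0 : 0 < q) (hq1 : q < 1)
    (h : Generic q e₁ e₂ s) {k r l : ℤ} (hkl : l ≤ k) :
    ∀ᶠ x : ℝ × ℝ in 𝓝 (e₁, s), rBarNum q k r l β Z e₁ e₂ s ((e₁ : ℂ) / x.1, x) = 0 := by
  have hp := norm_ofReal_sq_lt_one hq0 hq1
  have hqc : (q : ℂ) ≠ 0 := by exact_mod_cast hq0.ne'
  have hp0 : (q : ℂ) ^ 2 ≠ 0 := pow_ne_zero 2 hqc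
  have c1 : (e₁ : ℂ) ≠ 0 := by exact_mod_cast h.ne₁
  have c2 : (e₂ : ℂ) ≠ 0 := by exact_mod_cast h.ne₂
  have c3 : (s : ℂ) ≠ 0 := by exact_mod_cast h.ne_s
  have f0 : ContinuousAt (fun x : ℝ × ℝ => ((e₁ : ℂ) / x.1, x)) (e₁, s) := by
    fun_prop (disch := assumption)
  have f1 : ∀ᶠ x : ℝ × ℝ in 𝓝 (e₁, s), NumRegular q r e₁ e₂ s ((e₁ : ℂ) / x.1, x) := by
    refine f0.eventually (p := fun y => NumRegular q r e₁ e₂ s y) ?_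
    simp only [div_self c1]
    exact h.eventually_numRegular hq0 hq1 r
  have key : ∀ e : ℝ, e ≠ 0 → Admissible q e s → ∀ k : ℤ,
      NotPow q (-(q * s * ((e₁ : ℂ) / e₁) ^ 2 / (((q : ℂ) ^ 2) ^ k * e))) := by
    intro e he had k n hn
    have ce : (e : ℂ) ≠ 0 := by exact_mod_cast he
    refine (had.inv hq0 he h.ne_s).ne_zpow hq0 (n + k) ?_
    have hK := zpow_ne_zero k hp0
    rw [zpow_mul, show (q : ℂ) ^ (2 : ℤ) = q ^ 2 from zpow_ofNat _ _, div_self c1] at hn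
    rw [zpow_add₀ hp0, ← hn]
    push_cast
    field_simp
  have hK1 := zpow_ne_zero k hp0
  have hK2 := zpow_ne_zero (k + r) hp0
  have g1 := eventually_notPow hq0 hq1 (x := (e₁, s)) (f := fun x : ℝ × ℝ =>
    -(q * s * ((e₁ : ℂ) / x.1) ^ 2 / (((q : ℂ) ^ 2) ^ k * e₁))) (by fun_prop (disch := assumption))
    (by simp [*]) (key e₁ h.ne₁ h.adm₁ k)
  have g2 := eventually_notPow hq0 hq1 (x := (e₁, s)) (f := fun x : ℝ × ℝ =>
    -(q * x.2 * ((e₁ : ℂ) / x.1) ^ 2 / (((q : ℂ) ^ 2) ^ (k + r) * e₂)))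
    (by fun_prop (disch := assumption)) (by simp [*]) (key e₂ h.ne₂ h.adm₂ (k + r))
  filter_upwards [f1, g1, g2] with x ⟨h1, h2, h3, h4, h5⟩ h6 h7
  simp only at h1 h2 h3 h4 h5
  have c4 : (x.1 : ℂ) ≠ 0 := by exact_mod_cast h2
  have c5 : (x.2 : ℂ) ≠ 0 := by exact_mod_cast h3
  rw [rBarNum, half_eq_zero hqc hp hkl h1 c1 c2 (by simp [*]) c4 c3 c5 (by field_simp)
    (by field_simp) (h6.ne_zpow hqc (m := 0) (by simp)) h4,
    half_eq_zero hqc hp (by omega) h1 c2 c1 c4 (by simp [*]) c5 c3 (by field_simp)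
    (by field_simp) (h7.ne_zpow hqc (m := 0) (by simp)) h5, sub_zero]

theorem continuous_qInf_real {q : ℝ} (hq0 : 0 < q) (hq1 : q < 1) :
    Continuous fun a : ℝ => qInf a (q ^ 2) := by
  have h : (fun a : ℝ => qInf a (q ^ 2)) = fun a : ℝ => (qInf (a : ℂ) ((q : ℂ) ^ 2)).re := by
    funext a
    rw [← Complex.ofReal_pow, ← ofReal_qInf (norm_sq_lt_one hq0 hq1), Complex.ofReal_re]
  rw [h]
  exact Complex.continuous_re.comp
    ((differentiable_qInf (norm_ofReal_sq_lt_one hq0 hq1)).continuous.comp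
      Complex.continuous_ofReal)

theorem ContinuousAt.qInf_real {X : Type*} [TopologicalSpace X] {q : ℝ} (hq0 : 0 < q) (hq1 : q < 1)
    {a : X → ℝ} {x : X} (ha : ContinuousAt a x) :
    ContinuousAt (fun y => QInt.qInf (a y) (q ^ 2)) x :=
  ContinuousAt.comp (g := fun a : ℝ => QInt.qInf a (q ^ 2))
    (continuous_qInf_real hq0 hq1).continuousAt ha

theorem ContinuousAt.S {X : Type*} [TopologicalSpace X] {q : ℝ} (hq0 : 0 < q) (hq1 : q < 1)
    {n : ℤ} {A B : X → ℝ} {x : X} (hA : ContinuousAt A x) (hB : ContinuousAt B x) (h0 : B x ≠ 0) :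
    ContinuousAt (fun y => QInt.S q n (A y) (B y)) x := by
  simp only [QInt.S, qInfs_cons, qInfs_nil, mul_one]
  refine Real.continuous_sqrt.continuousAt.comp (f := fun y => QInt.qInf _ _ * QInt.qInf _ _) ?_
  refine (ContinuousAt.qInf_real hq0 hq1 ?_).mul (ContinuousAt.qInf_real hq0 hq1 ?_)
  · fun_prop
  · fun_prop (disch := assumption)

theorem ContinuousAt.rootTheta {X : Type*} [TopologicalSpace X] {q : ℝ} (hq0 : 0 < q) (hq1 : q < 1)
    {A B : X → ℝ} {x : X} (hA : ContinuousAt A x) (hB : ContinuousAt B x) (h0 : A x ≠ 0)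
    (h1 : B x ≠ 0) : ContinuousAt (fun y => QInt.rootTheta q (A y) (B y)) x := by
  simp only [QInt.rootTheta, thetas_cons, thetas_nil, mul_one]
  refine Real.continuous_sqrt.continuousAt.comp
    (f := fun y => QInt.qInf _ _ * QInt.qInf _ _ * (QInt.qInf _ _ * QInt.qInf _ _)) ?_
  have a1 : -A x * B x * q ≠ 0 := by simp [h0, h1, hq0.ne']
  have a2 : -A x * (B x)⁻¹ * q ≠ 0 := by simp [h0, h1, hq0.ne']
  refine ((ContinuousAt.qInf_real hq0 hq1 ?_).mul (ContinuousAt.qInf_real hq0 hq1 ?_)).mul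
    ((ContinuousAt.qInf_real hq0 hq1 ?_).mul (ContinuousAt.qInf_real hq0 hq1 ?_))
  all_goals fun_prop (disch := assumption)

theorem Generic.continuousAt_rootQuot {q e₁ e₂ s : ℝ} (hq0 : 0 < q) (hq1 : q < 1)
    (h : Generic q e₁ e₂ s) (k r l : ℤ) :
    ContinuousAt (fun y : ℂ × ℝ × ℝ => rootQuot q k r l e₁ e₂ (e₂ * y.2.1 / e₁) y.2.1 s y.2.2)
      (1, e₁, s) := by
  have h1 := h.ne₁
  have h2 := h.ne₂
  have h3 := h.ne_s
  have h4 : e₂ * e₁ / e₁ ≠ 0 := by simp [*]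
  have a1 := (h.adm₁.inv hq0 h1 h3).S_pos hq0 hq1 (-k)
  have a2 := h.adm₂.S_pos hq0 hq1 (l + r)
  have a3 := (h.adm₂.inv hq0 h2 h3).S_pos hq0 hq1 (-k - r)
  have a4 := h.adm₁.S_pos hq0 hq1 l
  unfold rootQuot
  refine ContinuousAt.div ?_ ?_ ?_
  · exact (ContinuousAt.rootTheta (A := fun y : ℂ × ℝ × ℝ => e₂ * y.2.1 / e₁) (B := fun _ => s)
      hq0 hq1 (by fun_prop) (by fun_prop) h4 h3).mul
      (ContinuousAt.rootTheta (A := fun y : ℂ × ℝ × ℝ => y.2.1) (B := fun y => y.2.2)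
        hq0 hq1 (by fun_prop) (by fun_prop) h1 h3)
  · refine (((ContinuousAt.S hq0 hq1 ?_ ?_ h3).mul (ContinuousAt.S hq0 hq1 ?_ ?_ h3)).mul
      (ContinuousAt.S hq0 hq1 ?_ ?_ h3)).mul (ContinuousAt.S hq0 hq1 ?_ ?_ h3)
    all_goals fun_prop (disch := assumption)
  · simp only [mul_div_cancel_right₀ _ h1]
    positivity

theorem zpow_ne_one {p : ℂ} (hp : ‖p‖ < 1) {n : ℤ} (hn : n ≠ 0) : p ^ n ≠ 1 := by
  intro h
  have h1 := congrArg norm h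
  rw [norm_zpow, norm_one] at h1
  exact hn ((zpow_eq_one_iff_right₀ (norm_nonneg _) hp.ne).1 h1)

/-- At the point the argument of the denominator is `p ^ (l - k)`. For `k < l` no factor vanishes.
For `l ≤ k` exactly the factor of index `m = k - l` does; it equals `(z - e₁ / e₄) / z` and is
compensated by the zero of the numerator. -/
theorem Generic.exists_tendsto_ratio {q e₁ e₂ s β Z : ℝ} (hq0 : 0 < q) (hq1 : q < 1)
    (h : Generic q e₁ e₂ s) (hβ : β ≠ 0) (hZ : Z ≠ 0) (k r l : ℤ) :
    ∃ v, Tendsto (fun y : ℂ × ℝ × ℝ => rBarNum q k r l β Z e₁ e₂ s y /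
      qInf (((q : ℂ) ^ 2) ^ l * e₁ / (y.1 * ((q : ℂ) ^ 2) ^ k * y.2.1)) ((q : ℂ) ^ 2))
      (𝓝[{y | y.1 ≠ (e₁ : ℂ) / y.2.1}] (1, e₁, s)) (𝓝 v) := by
  have hp := norm_ofReal_sq_lt_one hq0 hq1
  have hqc : (q : ℂ) ≠ 0 := by exact_mod_cast hq0.ne'
  have hp0 : (q : ℂ) ^ 2 ≠ 0 := pow_ne_zero 2 hqc
  have c1 : (e₁ : ℂ) ≠ 0 := by exact_mod_cast h.ne₁
  have hreg := h.eventually_numRegular hq0 hq1 r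
  have hK := zpow_ne_zero k hp0
  have hK' : (1 : ℂ) * ((q : ℂ) ^ 2) ^ k * e₁ ≠ 0 := by simp [*]
  have hX : ContinuousAt (fun y : ℂ × ℝ × ℝ =>
      ((q : ℂ) ^ 2) ^ l * e₁ / (y.1 * ((q : ℂ) ^ 2) ^ k * y.2.1)) (1, e₁, s) := by
    fun_prop (disch := assumption)
  have hX1 : ((q : ℂ) ^ 2) ^ l * e₁ / (1 * ((q : ℂ) ^ 2) ^ k * e₁) = ((q : ℂ) ^ 2) ^ (l - k) := by
    rw [zpow_sub₀ hp0]; field_simp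
  rcases lt_or_ge k l with hkl | hkl
  · refine ⟨_, ContinuousAt.continuousWithinAt (ContinuousAt.div
      (hreg.self_of_nhds.continuousAt hq0 hq1 hβ hZ h.ne₁ h.ne₂ h.ne_s)
      (ContinuousAt.qInf hp hX) ?_)⟩
    simp only [hX1]
    refine qInf_ne_zero hp fun n => ?_
    rw [← zpow_natCast ((q : ℂ) ^ 2), ← zpow_add₀ hp0]
    exact zpow_ne_one hp (by omega)
  · obtain ⟨m, hm⟩ := Int.le.dest hkl
    have hζ : ContinuousAt (fun x : ℝ × ℝ => (e₁ : ℂ) / x.1) (e₁, s) := by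
      fun_prop (disch := assumption)
    have key := exists_tendsto_div_sub (N := rBarNum q k r l β Z e₁ e₂ s)
      (ζ := fun x : ℝ × ℝ => (e₁ : ℂ) / x.1) (x₀ := (e₁, s)) hζ
      (by
        simp only [div_self c1]
        exact hreg.mono fun y hy => hy.continuousAt hq0 hq1 hβ hZ h.ne₁ h.ne₂ h.ne_s)
      (by
        simp only [div_self c1]
        exact hreg.mono fun y hy => hy.differentiableAt hq0 hq1 hβ hZ h.ne₁ h.ne₂ h.ne_s)
      (h.rBarNum_eq_zero hq0 hq1 hkl)
    simp only [div_self c1] at key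
    obtain ⟨v, hv⟩ := key
    set X : ℂ × ℝ × ℝ → ℂ := fun y => ((q : ℂ) ^ 2) ^ l * e₁ / (y.1 * ((q : ℂ) ^ 2) ^ k * y.2.1)
      with hXdef
    have hXm : X (1, e₁, s) = ((q : ℂ) ^ 2) ^ (-(m : ℤ)) := by
      rw [hXdef]; simp only; rw [hX1]; congr 1; omega
    -- The reciprocal of all factors except that of index `m`: those before it form `qFac`, those
    -- after it `qInf`.
    have hF : ContinuousAt (fun y => y.1 / (qFac (X y) ((q : ℂ) ^ 2) m *
        qInf (X y * ((q : ℂ) ^ 2) ^ m * (q : ℂ) ^ 2) ((q : ℂ) ^ 2))) (1, e₁, s) := by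
      refine ContinuousAt.div (by fun_prop) (ContinuousAt.mul ?_ ?_) (mul_ne_zero ?_ ?_)
      · unfold qFac
        fun_prop
      · fun_prop (disch := assumption)
      · rw [qFac, Finset.prod_ne_zero_iff]
        intro j hj
        rw [hXm, ← zpow_natCast ((q : ℂ) ^ 2), ← zpow_add₀ hp0, sub_ne_zero]
        rw [Finset.mem_range] at hj
        exact (zpow_ne_one hp (by omega)).symm
      · rw [hXm, ← zpow_natCast ((q : ℂ) ^ 2), ← zpow_add₀ hp0, neg_add_cancel, zpow_zero, one_mul]
        exact qInf_self_ne_zero hp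
    refine ⟨_, (hv.mul hF.continuousWithinAt).congr' ?_⟩
    filter_upwards [self_mem_nhdsWithin, hreg.filter_mono nhdsWithin_le_nhds] with y hy1 hy2
    obtain ⟨h1, h2, -⟩ := hy2
    have c4 : (y.2.1 : ℂ) ≠ 0 := by exact_mod_cast h2
    have hy3 : y.1 - e₁ / y.2.1 ≠ 0 := sub_ne_zero.2 hy1
    have hXu : X y * ((q : ℂ) ^ 2) ^ m = e₁ / (y.1 * y.2.1) := by
      have : ((q : ℂ) ^ 2) ^ k = ((q : ℂ) ^ 2) ^ l * ((q : ℂ) ^ 2) ^ m := by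
        rw [← zpow_natCast ((q : ℂ) ^ 2), ← zpow_add₀ hp0, hm]
      have hL := zpow_ne_zero l hp0
      have hm0 := pow_ne_zero m hp0
      rw [hXdef]; simp only; rw [this]; field_simp
    rw [qInf_eq_qFac_mul hp (X y) m, qInf_step hp (X y * ((q : ℂ) ^ 2) ^ m)]
    have e1 : 1 - X y * ((q : ℂ) ^ 2) ^ m = (y.1 - e₁ / y.2.1) / y.1 := by
      rw [hXu]; field_simp
    rw [e1]
    simp only [div_eq_mul_inv, mul_inv, inv_inv]
    ring

/-- The conditions that hold at `u = 1` persist nearby. The one that fails there, that `u` is not a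
power of `p`, holds in a punctured neighbourhood because `θ` has a simple zero at `1`. -/
theorem Generic.path_mem {q e₁ e₂ s : ℝ} (hq0 : 0 < q) (hq1 : q < 1) (h : Generic q e₁ e₂ s) :
    ∀ᶠ u : ℝ in 𝓝[≠] 1, ((1 : ℂ), e₁ / u, s) ∈ regularSet q 1 e₁ e₂ s := by
  have hp := norm_ofReal_sq_lt_one hq0 hq1
  have hqc : (q : ℂ) ≠ 0 := by exact_mod_cast hq0.ne'
  have hp0 : (q : ℂ) ^ 2 ≠ 0 := pow_ne_zero 2 hqc
  have c1 : (e₁ : ℂ) ≠ 0 := by exact_mod_cast h.ne₁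
  have c2 : (e₂ : ℂ) ≠ 0 := by exact_mod_cast h.ne₂
  have c3 : (s : ℂ) ≠ 0 := by exact_mod_cast h.ne_s
  have hinv : NotPow q (e₁ / e₂) := h.swap.ratio
  have near : ∀ a : ℂ, a ≠ 0 → NotPow q a → ∀ᶠ u : ℝ in 𝓝[≠] 1, NotPow q (u * a) := fun a ha hn =>
    (eventually_notPow hq0 hq1 (x := (1 : ℝ)) (f := fun u : ℝ => u * a) (by fun_prop)
      (by simpa using ha) (by simpa using hn)).filter_mono nhdsWithin_le_nhds
  have hu1 : ∀ᶠ u : ℝ in 𝓝[≠] 1, NotPow q u := by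
    have g1 : ContinuousAt (fun u : ℝ => qInf ((u : ℂ) * (q : ℂ) ^ 2) ((q : ℂ) ^ 2) *
        qInf ((q : ℂ) ^ 2 / (u : ℂ)) ((q : ℂ) ^ 2)) 1 :=
      (ContinuousAt.qInf hp (by fun_prop)).mul (ContinuousAt.qInf hp (by fun_prop (disch := simp)))
    have g2 : qInf (((1 : ℝ) : ℂ) * (q : ℂ) ^ 2) ((q : ℂ) ^ 2) *
        qInf ((q : ℂ) ^ 2 / ((1 : ℝ) : ℂ)) ((q : ℂ) ^ 2) ≠ 0 := by
      rw [Complex.ofReal_one, one_mul, div_one]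
      exact mul_ne_zero (qInf_self_ne_zero hp) (qInf_self_ne_zero hp)
    have g3 : ContinuousAt (fun u : ℝ => u) 1 := by fun_prop
    filter_upwards [(g1.eventually_ne g2).filter_mono nhdsWithin_le_nhds,
      (g3.eventually_ne one_ne_zero).filter_mono nhdsWithin_le_nhds, self_mem_nhdsWithin]
      with u h1 h2 h3
    have cu : (u : ℂ) ≠ 0 := by exact_mod_cast h2
    refine (theta_ne_zero_iff_notPow hq0 hq1 cu).1 ?_
    rw [theta, qInf_step hp, mul_assoc]
    refine mul_ne_zero ?_ h1
    rw [sub_ne_zero]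
    intro hh
    exact h3 (by exact_mod_cast hh.symm)
  have cont : ContinuousAt (fun u : ℝ => u) 1 := by fun_prop
  filter_upwards [hu1, near _ (by simp [*]) hinv, near _ (by simp [*]) h.ratio,
    near _ (by simp [*]) h.sq, near _ (by simp [*]) h.sq.inv,
    (cont.eventually_ne one_ne_zero).filter_mono nhdsWithin_le_nhds] with u a1 a2 a3 a4 a5 a6
  have cu : (u : ℂ) ≠ 0 := by exact_mod_cast a6
  refine ⟨one_ne_zero, div_ne_zero h.ne₁ a6, h.ne_s, ?_, ?_, ?_, ?_, ?_, h.sq, h.sq, ?_⟩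
  · simpa using hinv
  · simpa using h.ratio
  · convert a1 using 1; push_cast; field_simp
  · convert a2 using 1; push_cast; field_simp
  · convert a3 using 1; push_cast; field_simp
  · have hn : ∀ n : ℕ, 1 ≤ n → ∀ t : ℂ, NotPow q t → t * (q : ℂ) ^ (2 * n) ≠ 1 := by
      intro n _ t ht hh
      refine ht (-n) ?_
      rw [mul_neg, zpow_neg]
      exact eq_inv_of_mul_eq_one_left (by exact_mod_cast hh)
    have h1 : ∀ n : ℕ, 1 ≤ n → (q : ℂ) ^ (2 * n) ≠ 1 := by
      intro n hn hh
      rw [pow_mul] at hh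
      exact zpow_ne_one hp (n := n) (by omega) (by rwa [zpow_natCast])
    intro t ht
    simp only [Set.mem_insert_iff, Set.mem_singleton_iff] at ht
    simp only [Complex.ofReal_one, one_mul]
    rcases ht with rfl | rfl | rfl | rfl
    · refine ⟨?_, ?_, fun n h2 => ?_⟩
      · convert h.ratio_mul using 1; push_cast; ring
      · convert a4 using 1; push_cast; field_simp
      · convert hn n h2 _ h.sq using 2; push_cast; ring
    · rw [div_self h.ne_s]
      refine ⟨?_, ?_, fun n h2 => ?_⟩
      · simpa using h.ratio
      · convert a1 using 1; push_cast; field_simp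
      · simpa using h1 n h2
    · rw [div_self h.ne_s]
      refine ⟨?_, ?_, fun n h2 => ?_⟩
      · simpa using h.ratio
      · convert a1 using 1; push_cast; field_simp
      · simpa using h1 n h2
    · refine ⟨?_, ?_, fun n h2 => ?_⟩
      · convert h.ratio_div using 1; push_cast; field_simp
      · convert a5 using 1; push_cast; field_simp
      · convert hn n h2 _ h.sq.inv using 2; push_cast; field_simp

theorem Generic.tendsto_path {q e₁ e₂ s : ℝ} (hq0 : 0 < q) (hq1 : q < 1) (h : Generic q e₁ e₂ s) :
    Tendsto (fun u : ℝ => ((1 : ℂ), e₁ / u, s)) (𝓝[≠] 1)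
      (𝓝[regularSet q 1 e₁ e₂ s] (1, e₁, s)) := by
  refine tendsto_nhdsWithin_iff.2 ⟨?_, h.path_mem hq0 hq1⟩
  have : ContinuousAt (fun u : ℝ => ((1 : ℂ), e₁ / u, s)) 1 := by fun_prop (disch := simp)
  have h2 := this.tendsto
  simp only [div_one] at h2
  exact h2.mono_left nhdsWithin_le_nhds

theorem Generic.eventually_rBar_eq {q e₁ e₂ s : ℝ} (hq0 : 0 < q) (hq1 : q < 1)
    (h : Generic q e₁ e₂ s) (β Z : ℝ) (k r l : ℤ) :
    ∀ᶠ y : ℂ × ℝ × ℝ in 𝓝[regularSet q 1 e₁ e₂ s] (1, e₁, s),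
      rBar q k r l y.1 1 β Z e₁ e₂ (e₂ * y.2.1 / e₁) y.2.1 s y.2.2 =
      rootQuot q k r l e₁ e₂ (e₂ * y.2.1 / e₁) y.2.1 s y.2.2 * (rBarNum q k r l β Z e₁ e₂ s y /
      qInf (((q : ℂ) ^ 2) ^ l * e₁ / (y.1 * ((q : ℂ) ^ 2) ^ k * y.2.1)) ((q : ℂ) ^ 2)) := by
  have h1 := h.ne₁
  have h2 := h.ne₂
  have h3 := h.ne_s
  have h4 : e₂ * e₁ / e₁ ≠ 0 := by simp [*]
  have a1 := (h.adm₁.inv hq0 h1 h3).S_pos hq0 hq1 (-k)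
  have a2 := h.adm₂.S_pos hq0 hq1 (l + r)
  have a3 := (h.adm₂.inv hq0 h2 h3).S_pos hq0 hq1 (-k - r)
  have a4 := h.adm₁.S_pos hq0 hq1 l
  have b1 : ContinuousAt (fun y : ℂ × ℝ × ℝ => S q (-k) (y.2.1)⁻¹ y.2.2) (1, e₁, s) :=
    ContinuousAt.S hq0 hq1 (by fun_prop (disch := assumption)) (by fun_prop) h3
  have b2 : ContinuousAt (fun y : ℂ × ℝ × ℝ => S q (l + r) e₂ y.2.2) (1, e₁, s) :=
    ContinuousAt.S hq0 hq1 (by fun_prop) (by fun_prop) h3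
  have b3 : ContinuousAt (fun y : ℂ × ℝ × ℝ => S q (-k - r) (e₂ * y.2.1 / e₁)⁻¹ s) (1, e₁, s) :=
    ContinuousAt.S hq0 hq1 (by fun_prop (disch := assumption)) (by fun_prop) h3
  filter_upwards [self_mem_nhdsWithin, (b1.eventually_const_lt a1).filter_mono nhdsWithin_le_nhds,
    (b2.eventually_const_lt a2).filter_mono nhdsWithin_le_nhds,
    (b3.eventually_const_lt (by simpa only [mul_div_cancel_right₀ _ h1] using a3)).filter_mono
      nhdsWithin_le_nhds] with y d1 d2 d3 d4
  rw [rBar_eq hq0 hq1 k r l h1 h2 h3 rfl d1 d2 d3 d4 a4, rBarNum]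
  push_cast
  ring

theorem Generic.exists_isValue {q e₁ e₂ s β Z : ℝ} (hq0 : 0 < q) (hq1 : q < 1)
    (h : Generic q e₁ e₂ s) (hβ : β ≠ 0) (hZ : Z ≠ 0) (k r l : ℤ) :
    ∃ v, IsValue q k r l 1 1 β Z e₁ e₂ e₁ s s v := by
  obtain ⟨v, hv⟩ := h.exists_tendsto_ratio hq0 hq1 hβ hZ k r l
  refine ⟨rootQuot q k r l e₁ e₂ (e₂ * e₁ / e₁) e₁ s s * v, ?_, ?_⟩
  rotate_left
  · have hsub : regularSet q 1 e₁ e₂ s ⊆ {y | y.1 ≠ (e₁ : ℂ) / y.2.1} := by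
      rintro y ⟨h1, h2, -, -, -, h3, -⟩ hy
      have hy' : y.1 = (e₁ : ℂ) / y.2.1 := hy
      refine h3 0 ?_
      rw [Complex.ofReal_one, one_mul, ← hy', mul_zero, zpow_zero, inv_mul_cancel₀ h1]
    have hc := (Complex.continuous_ofReal.continuousAt.comp
      (h.continuousAt_rootQuot hq0 hq1 k r l)).tendsto
    exact ((hc.mono_left nhdsWithin_le_nhds).mul (hv.mono_left (nhdsWithin_mono _ hsub))).congr'
      ((h.eventually_rBar_eq hq0 hq1 β Z k r l).mono fun y hy => hy.symm)
  · exact mem_closure_of_tendsto ((h.tendsto_path hq0 hq1).mono_right nhdsWithin_le_nhds)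
      (h.path_mem hq0 hq1)

/-- For `l = k` the four roots in the denominator group into two products covered by `S_mul_S`, and
the roots of theta functions cancel. -/
theorem rootQuot_diag {q e₁ e₂ s : ℝ} (hq0 : 0 < q) (hq1 : q < 1) (h : Generic q e₁ e₂ s)
    (he₁ : 0 < e₁) (he₂ : 0 < e₂) (k r : ℤ) :
    rootQuot q k r k e₁ e₂ e₂ e₁ s s * (((e₁ * q) ^ (-k) * q ^ (-(k * (k - 1)))) *
      ((e₂ * q) ^ (-(k + r)) * q ^ (-((k + r) * (k + r - 1))))) = 1 := by
  have h1 := S_mul_S hq0 hq1 he₁ h.ne_s h.adm₁ k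
  have h2 := S_mul_S hq0 hq1 he₂ h.ne_s h.adm₂ (k + r)
  have t1 := h.adm₁.rootTheta_pos hq0 hq1 h.ne₁ h.ne_s
  have t2 := h.adm₂.rootTheta_pos hq0 hq1 h.ne₂ h.ne_s
  have n1 : 0 < (e₁ * q) ^ (-k) * q ^ (-(k * (k - 1))) := by positivity
  have n2 : 0 < (e₂ * q) ^ (-(k + r)) * q ^ (-((k + r) * (k + r - 1))) := by positivity
  have hden : S q (-k) e₁⁻¹ s * S q (k + r) e₂ s * S q (-k - r) e₂⁻¹ s * S q k e₁ s =
      (S q (-k) e₁⁻¹ s * S q k e₁ s) * (S q (-(k + r)) e₂⁻¹ s * S q (k + r) e₂ s) := by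
    rw [show -k - r = -(k + r) by ring]; ring
  rw [rootQuot, hden, h1, h2]
  field_simp

/-! ### Computation of the value along the line. -/

/-- The bounded factor of `r̄` on the line `z = 1`, `s₄ = s₃ = s`, `e₄ = e₁ / u`. -/
noncomputable def lineNum (k r l : ℤ) (q e₁ e₂ s x₁ x₂ y₁ y₂ u : ℂ) : ℂ :=
  q ^ (l - k) / qInf (q ^ 2) (q ^ 2) * theta (s ^ 2 * q ^ 2) (q ^ 2) * theta (e₂ / e₁) (q ^ 2) *
    (q ^ 2 * u / (x₂ * s ^ 2) * theta (s ^ 2) (q ^ 2)) *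
    (lineFac q ((q ^ 2) ^ k) ((q ^ 2) ^ r) ((q ^ 2) ^ l) e₁ e₂ (e₂ / u) (e₁ / u) s * s ^ (-r) *
        (theta (x₂ * s / u) (q ^ 2) * theta (x₂ * s) (q ^ 2) * theta (y₂ * s) (q ^ 2) *
          theta (u * y₂ / s) (q ^ 2)) *
        (theta (x₁ / (u * y₁)) (q ^ 2) * theta (x₁ * y₁ / q ^ 2) (q ^ 2) / x₁) +
      lineFac q ((q ^ 2) ^ k) ((q ^ 2) ^ r) ((q ^ 2) ^ l) e₁ e₂ (e₂ / u) (e₁ / u) s⁻¹ * s ^ r *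
        (theta (x₁ * s / u) (q ^ 2) * theta (x₁ * s) (q ^ 2) * theta (y₁ * s) (q ^ 2) *
          theta (u * y₁ / s) (q ^ 2)) *
        (theta (x₂ / (u * y₂)) (q ^ 2) * theta (x₂ * y₂ / q ^ 2) (q ^ 2) / x₂))

theorem continuousAt_lineNum {k r l : ℤ} {q e₁ e₂ s x₁ x₂ y₁ y₂ : ℂ} (hq : q ≠ 0)
    (hp : ‖q ^ 2‖ < 1) (he₁ : e₁ ≠ 0) (he₂ : e₂ ≠ 0) (hs : s ≠ 0) (hx₁ : x₁ ≠ 0) (hx₂ : x₂ ≠ 0)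
    (hy₁ : y₁ ≠ 0) (hy₂ : y₂ ≠ 0) :
    ContinuousAt (fun u => lineNum k r l q e₁ e₂ s x₁ x₂ y₁ y₂ u) 1 := by
  have hp0 : q ^ 2 ≠ 0 := pow_ne_zero 2 hq
  have hM : (q ^ 2) ^ r ≠ 0 := zpow_ne_zero _ hp0
  have hK : (q ^ 2) ^ k ≠ 0 := zpow_ne_zero _ hp0
  have h1 : (1 : ℂ) ≠ 0 := one_ne_zero
  have f1 : ∀ s : ℂ, s ≠ 0 → ContinuousAt (fun u : ℂ => lineFac q ((q ^ 2) ^ k) ((q ^ 2) ^ r)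
      ((q ^ 2) ^ l) e₁ e₂ (e₂ / u) (e₁ / u) s) 1 := by
    intro s hs
    have a1 : (q ^ 2) ^ k * (q ^ 2) ^ r * (e₂ / 1) ≠ 0 := by simp [*]
    have a2 : (q ^ 2) ^ k * (e₁ / 1) * s ≠ 0 := by simp [*]
    unfold lineFac
    fun_prop (disch := assumption)
  have f2 := f1 s hs
  have f3 := f1 s⁻¹ (inv_ne_zero hs)
  have b1 : x₂ * s / 1 ≠ 0 := by simp [*]
  have b2 : 1 * y₂ / s ≠ 0 := by simp [*]
  have b3 : x₁ / (1 * y₁) ≠ 0 := by simp [*]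
  have b4 : x₁ * s / 1 ≠ 0 := by simp [*]
  have b5 : 1 * y₁ / s ≠ 0 := by simp [*]
  have b6 : x₂ / (1 * y₂) ≠ 0 := by simp [*]
  have b7 : 1 * y₁ ≠ 0 := by simp [*]
  have b8 : 1 * y₂ ≠ 0 := by simp [*]
  unfold lineNum
  fun_prop (disch := assumption)

theorem lineNum_one {k r : ℤ} {q e₁ e₂ s x₁ x₂ y₁ y₂ : ℂ} (hq : q ≠ 0)
    (hp : ‖q ^ 2‖ < 1) (he₁ : e₁ ≠ 0) (he₂ : e₂ ≠ 0) (hs : s ≠ 0) (hx₁ : x₁ = -(e₁ * q))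
    (hx₂ : x₂ = -(e₂ * q)) (hy₁ : y₁ ≠ 0) (hy₂ : y₂ ≠ 0) (h : x₁ * y₂ = x₂ * y₁) :
    qInf (q ^ 2) (q ^ 2) ^ 2 * lineNum k r k q e₁ e₂ s x₁ x₂ y₁ y₂ 1 =
      (((e₁ * q) ^ (-k) * q ^ (-(k * (k - 1)))) *
        ((e₂ * q) ^ (-(k + r)) * q ^ (-((k + r) * (k + r - 1))))) *
      (qInf (q ^ 2) (q ^ 2) * theta (s ^ 2 * q ^ 2) (q ^ 2) * theta (e₂ / e₁) (q ^ 2) *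
    (-(theta (x₂ * y₁) (q ^ 2) * theta (y₁ / x₁) (q ^ 2) * theta (x₁ * s) (q ^ 2) *
        theta (x₂ * s) (q ^ 2)) *
      (theta (x₂ / x₁ * s ^ 2 * q ^ 2) (q ^ 2) * (theta (x₁ * s) (q ^ 2) * theta (y₁ * s) (q ^ 2) *
          theta (x₂ / s) (q ^ 2) * theta (y₂ / s) (q ^ 2)) -
        (s ^ 2)⁻¹ * (theta (x₂ / x₁ * (s ^ 2)⁻¹ * q ^ 2) (q ^ 2) * (theta (x₁ / s) (q ^ 2) *
          theta (y₁ / s) (q ^ 2) * theta (x₂ * s) (q ^ 2) * theta (y₂ * s) (q ^ 2)))))) := by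
  have hp0 : q ^ 2 ≠ 0 := pow_ne_zero 2 hq
  have l1 := lineFac_diag (k := k) (r := r) hq hp he₁ he₂ hs
  have l2 := lineFac_diag (k := k) (r := r) hq hp he₁ he₂ (inv_ne_zero hs)
  rw [show s⁻¹ ^ (-r) = s ^ r by rw [inv_zpow, zpow_neg, inv_inv], ← hx₁, ← hx₂, div_inv_eq_mul,
    ← div_eq_mul_inv] at l2
  rw [← hx₁, ← hx₂] at l1
  have hx₁0 : x₁ ≠ 0 := by simp [*]
  have hx₂0 : x₂ ≠ 0 := by simp [*]
  rw [← line_value hp hp0 hx₁0 hx₂0 hy₁ hy₂ hs h, lineNum]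
  simp only [div_one, one_mul, mul_one, l1, l2, sub_self, zpow_zero]
  have := qInf_self_ne_zero hp
  field_simp

/-- The origin of the Kronecker delta: `θ(u)` has a simple zero at `u = 1`, while the denominator
vanishes there only for `k = l`. -/
theorem tendsto_theta_div {q : ℝ} (hq0 : 0 < q) (hq1 : q < 1) (k l : ℤ) :
    Tendsto (fun u : ℝ => theta (u : ℂ) ((q : ℂ) ^ 2) /
      (1 - u * (((q : ℂ) ^ 2) ^ l / ((q : ℂ) ^ 2) ^ k))) (𝓝[≠] 1)
      (𝓝 (if k = l then qInf ((q : ℂ) ^ 2) ((q : ℂ) ^ 2) ^ 2 else 0)) := by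
  have hp := norm_ofReal_sq_lt_one hq0 hq1
  have hp0 : (q : ℂ) ^ 2 ≠ 0 := pow_ne_zero 2 (by exact_mod_cast hq0.ne')
  split_ifs with hkl
  · have g1 : ContinuousAt (fun u : ℝ => qInf ((u : ℂ) * (q : ℂ) ^ 2) ((q : ℂ) ^ 2) *
        qInf ((q : ℂ) ^ 2 / (u : ℂ)) ((q : ℂ) ^ 2)) 1 :=
      (ContinuousAt.qInf hp (by fun_prop)).mul
        (ContinuousAt.qInf hp (by fun_prop (disch := simp)))
    have g2 := g1.tendsto
    simp only [Complex.ofReal_one, one_mul, div_one] at g2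
    rw [pow_two (qInf _ _)]
    refine (g2.mono_left nhdsWithin_le_nhds).congr' ?_
    filter_upwards [self_mem_nhdsWithin] with u hu
    have hu' : 1 - (u : ℂ) ≠ 0 := by
      rw [sub_ne_zero]
      exact fun hh => hu (by exact_mod_cast hh.symm)
    rw [hkl, div_self (zpow_ne_zero l hp0), mul_one, theta, qInf_step hp (u : ℂ)]
    field_simp
  · have hn : 1 - ((1 : ℝ) : ℂ) * (((q : ℂ) ^ 2) ^ l / ((q : ℂ) ^ 2) ^ k) ≠ 0 := by
      rw [Complex.ofReal_one, one_mul, ← zpow_sub₀ hp0, sub_ne_zero]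
      exact (zpow_ne_one hp (by omega)).symm
    have g1 : ContinuousAt (fun u : ℝ => theta (u : ℂ) ((q : ℂ) ^ 2) /
        (1 - u * (((q : ℂ) ^ 2) ^ l / ((q : ℂ) ^ 2) ^ k))) 1 :=
      (ContinuousAt.theta hp (by fun_prop) (by simp)).div (by fun_prop) hn
    have g2 := g1.tendsto
    rw [Complex.ofReal_one, theta_one hp, zero_div] at g2
    exact g2.mono_left nhdsWithin_le_nhds

/-- With `X = u p ^ (l - k)`, the numerator contains `(p X; p)_∞` and the denominator is `(X; p)_∞`,
so only `1 - X` remains below. -/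
theorem rBarNum_line {q e₁ e₂ s β Z : ℝ} (hq0 : 0 < q) (hq1 : q < 1)
    (h : Generic q e₁ e₂ s) (hβ : β ≠ 0) (hZ : Z ≠ 0) {k r l : ℤ}
    {x₁ x₂ y₁ y₂ : ℂ} (hx₁ : x₁ = -(e₁ * q)) (hx₂ : x₂ = -(e₂ * q))
    (hy₁ : y₁ = -(β * (e₁ * Z / e₂ ^ 2) * q)) (hy₂ : y₂ = -(β * (Z / e₂) * q)) {u : ℝ}
    (hu : u ≠ 0) (hnum : NumRegular q r e₁ e₂ s (1, e₁ / u, s))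
    (hmem : ((1 : ℂ), e₁ / u, s) ∈ regularSet q 1 e₁ e₂ s) :
    rBarNum q k r l β Z e₁ e₂ s (1, e₁ / u, s) /
      qInf (((q : ℂ) ^ 2) ^ l * e₁ / (1 * ((q : ℂ) ^ 2) ^ k * (e₁ / u : ℝ))) ((q : ℂ) ^ 2) =
    theta (u : ℂ) ((q : ℂ) ^ 2) / (1 - u * (((q : ℂ) ^ 2) ^ l / ((q : ℂ) ^ 2) ^ k)) *
      lineNum k r l q e₁ e₂ s x₁ x₂ y₁ y₂ u := by
  have hp := norm_ofReal_sq_lt_one hq0 hq1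
  have hqc : (q : ℂ) ≠ 0 := by exact_mod_cast hq0.ne'
  have hp0 : (q : ℂ) ^ 2 ≠ 0 := pow_ne_zero 2 hqc
  have c1 : (e₁ : ℂ) ≠ 0 := by exact_mod_cast h.ne₁
  have c2 : (e₂ : ℂ) ≠ 0 := by exact_mod_cast h.ne₂
  have c3 : (s : ℂ) ≠ 0 := by exact_mod_cast h.ne_s
  have cβ : (β : ℂ) ≠ 0 := by exact_mod_cast hβ
  have cZ : (Z : ℂ) ≠ 0 := by exact_mod_cast hZ
  have cu : (u : ℂ) ≠ 0 := by exact_mod_cast hu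
  obtain ⟨-, -, -, n1, n2⟩ := hnum
  simp only at n1 n2
  have e4 : ((e₁ / u : ℝ) : ℂ) = e₁ / u := by push_cast; ring
  have e3 : (e₂ : ℂ) * (e₁ / u) / e₁ = e₂ / u := by field_simp
  rw [e4] at n1 n2
  rw [e3] at n2
  have hsub := half_sub_line (k := k) (r := r) (l := l) hqc hp cβ cZ c1 c2 c3 cu hx₁ hx₂ hy₁ hy₂
    n1 n2
  have hXd : ((q : ℂ) ^ 2) ^ l * e₁ / (1 * ((q : ℂ) ^ 2) ^ k * (e₁ / u)) =
      u * (((q : ℂ) ^ 2) ^ l / ((q : ℂ) ^ 2) ^ k) := by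
    have := zpow_ne_zero k hp0
    field_simp
  rw [rBarNum]
  simp only
  rw [e4, e3, hsub, hXd]
  obtain ⟨-, -, -, -, -, g, -⟩ := hmem
  simp only at g
  rw [Complex.ofReal_one, one_mul, inv_one, one_mul, e4, div_div_cancel₀ c1] at g
  have hU : qInf ((u : ℂ) * (((q : ℂ) ^ 2) ^ l / ((q : ℂ) ^ 2) ^ k)) ((q : ℂ) ^ 2) ≠ 0 :=
    g.qInf_ne_zero hq0 hq1 (l - k) (by rw [zpow_sub₀ hp0])
  rw [qInf_step hp (u * (((q : ℂ) ^ 2) ^ l / ((q : ℂ) ^ 2) ^ k))] at hU ⊢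
  rw [mul_comm (q ^ 2 : ℂ) (u * (((q : ℂ) ^ 2) ^ l / ((q : ℂ) ^ 2) ^ k))]
  have n3 := left_ne_zero_of_mul hU
  have n4 := right_ne_zero_of_mul hU
  rw [lineNum]
  generalize qInf ((u : ℂ) * (((q : ℂ) ^ 2) ^ l / ((q : ℂ) ^ 2) ^ k) * (q : ℂ) ^ 2)
    ((q : ℂ) ^ 2) = U at *
  generalize 1 - (u : ℂ) * (((q : ℂ) ^ 2) ^ l / ((q : ℂ) ^ 2) ^ k) = X at *
  have cancel : ∀ a b : ℂ, a / X * b * (X * U) = a * b * U := by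
    intros
    field_simp
  rw [div_eq_iff hU, cancel]
  ring

theorem Generic.tendsto_rBar_path {q e₁ e₂ s β Z : ℝ} (hq0 : 0 < q) (hq1 : q < 1)
    (h : Generic q e₁ e₂ s) {k r l : ℤ} {v : ℂ}
    (hv : IsValue q k r l 1 1 β Z e₁ e₂ e₁ s s v) :
    Tendsto (fun u : ℝ => rBar q k r l 1 1 β Z e₁ e₂ (e₂ * (e₁ / u) / e₁) (e₁ / u) s s)
      (𝓝[≠] 1) (𝓝 v) := by
  have := Tendsto.comp hv.2 (h.tendsto_path hq0 hq1)
  simp only [Function.comp_def] at this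
  exact this

theorem Generic.tendsto_rootQuot_path {q e₁ e₂ s : ℝ} (hq0 : 0 < q) (hq1 : q < 1)
    (h : Generic q e₁ e₂ s) (k r l : ℤ) :
    Tendsto (fun u : ℝ => ((rootQuot q k r l e₁ e₂ (e₂ * (e₁ / u) / e₁) (e₁ / u) s s : ℝ) : ℂ))
      (𝓝[≠] 1) (𝓝 (rootQuot q k r l e₁ e₂ e₂ e₁ s s : ℝ)) := by
  have := (Complex.continuous_ofReal.tendsto _).comp
    ((h.continuousAt_rootQuot hq0 hq1 k r l).tendsto.comp
      ((h.tendsto_path hq0 hq1).mono_right nhdsWithin_le_nhds))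
  simp only [Function.comp_def] at this
  rwa [mul_div_cancel_right₀ _ h.ne₁] at this

theorem Generic.eventually_rBar_path {q e₁ e₂ s β Z : ℝ} (hq0 : 0 < q) (hq1 : q < 1)
    (h : Generic q e₁ e₂ s) (k r l : ℤ) :
    ∀ᶠ u : ℝ in 𝓝[≠] 1, rBar q k r l 1 1 β Z e₁ e₂ (e₂ * (e₁ / u) / e₁) (e₁ / u) s s =
      (rootQuot q k r l e₁ e₂ (e₂ * (e₁ / u) / e₁) (e₁ / u) s s : ℝ) *
      (rBarNum q k r l β Z e₁ e₂ s (1, e₁ / u, s) /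
      qInf (((q : ℂ) ^ 2) ^ l * e₁ / (1 * ((q : ℂ) ^ 2) ^ k * (e₁ / u : ℝ))) ((q : ℂ) ^ 2)) := by
  have := (h.tendsto_path hq0 hq1).eventually (h.eventually_rBar_eq hq0 hq1 β Z k r l)
  simp only at this
  exact this

theorem Generic.eventually_rBar_path_eq_lineNum {q e₁ e₂ s β Z : ℝ} (hq0 : 0 < q) (hq1 : q < 1)
    (h : Generic q e₁ e₂ s) (hβ : β ≠ 0) (hZ : Z ≠ 0) {k r l : ℤ}
    {x₁ x₂ y₁ y₂ : ℂ} (hx₁ : x₁ = -(e₁ * q)) (hx₂ : x₂ = -(e₂ * q))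
    (hy₁ : y₁ = -(β * (e₁ * Z / e₂ ^ 2) * q)) (hy₂ : y₂ = -(β * (Z / e₂) * q)) :
    ∀ᶠ u : ℝ in 𝓝[≠] 1, rBar q k r l 1 1 β Z e₁ e₂ (e₂ * (e₁ / u) / e₁) (e₁ / u) s s =
      (rootQuot q k r l e₁ e₂ (e₂ * (e₁ / u) / e₁) (e₁ / u) s s : ℝ) *
      (theta (u : ℂ) ((q : ℂ) ^ 2) / (1 - u * (((q : ℂ) ^ 2) ^ l / ((q : ℂ) ^ 2) ^ k)) *
        lineNum k r l q e₁ e₂ s x₁ x₂ y₁ y₂ u) := by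
  have hreg : ∀ᶠ u : ℝ in 𝓝[≠] 1, NumRegular q r e₁ e₂ s (1, e₁ / u, s) :=
    (h.tendsto_path hq0 hq1).eventually (p := fun y => NumRegular q r e₁ e₂ s y)
      ((h.eventually_numRegular hq0 hq1 r).filter_mono nhdsWithin_le_nhds)
  have hu0 : ∀ᶠ u : ℝ in 𝓝[≠] 1, u ≠ 0 :=
    (continuousAt_id.eventually_ne one_ne_zero).filter_mono nhdsWithin_le_nhds
  filter_upwards [h.eventually_rBar_path hq0 hq1 k r l, hreg, hu0, h.path_mem hq0 hq1]
    with u h1 h2 h3 h4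
  rw [← rBarNum_line hq0 hq1 h hβ hZ hx₁ hx₂ hy₁ hy₂ h3 h2 h4, h1]

theorem Generic.eq_lineNum_of_isValue {q e₁ e₂ s β Z : ℝ} (hq0 : 0 < q) (hq1 : q < 1)
    (h : Generic q e₁ e₂ s) (hβ : β ≠ 0) (hZ : Z ≠ 0) {k r l : ℤ}
    {v x₁ x₂ y₁ y₂ : ℂ} (hx₁ : x₁ = -(e₁ * q)) (hx₂ : x₂ = -(e₂ * q))
    (hy₁ : y₁ = -(β * (e₁ * Z / e₂ ^ 2) * q)) (hy₂ : y₂ = -(β * (Z / e₂) * q))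
    (hv : IsValue q k r l 1 1 β Z e₁ e₂ e₁ s s v) :
    v = (rootQuot q k r l e₁ e₂ e₂ e₁ s s : ℝ) *
      ((if k = l then qInf ((q : ℂ) ^ 2) ((q : ℂ) ^ 2) ^ 2 else 0) *
        lineNum k r l q e₁ e₂ s x₁ x₂ y₁ y₂ 1) := by
  have hp := norm_ofReal_sq_lt_one hq0 hq1
  have hqc : (q : ℂ) ≠ 0 := by exact_mod_cast hq0.ne'
  have c1 : (e₁ : ℂ) ≠ 0 := by exact_mod_cast h.ne₁
  have c2 : (e₂ : ℂ) ≠ 0 := by exact_mod_cast h.ne₂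
  have c3 : (s : ℂ) ≠ 0 := by exact_mod_cast h.ne_s
  have cβ : (β : ℂ) ≠ 0 := by exact_mod_cast hβ
  have cZ : (Z : ℂ) ≠ 0 := by exact_mod_cast hZ
  have hx₁0 : x₁ ≠ 0 := by simp [*]
  have hx₂0 : x₂ ≠ 0 := by simp [*]
  have hy₁0 : y₁ ≠ 0 := by simp [*]
  have hy₂0 : y₂ ≠ 0 := by simp [*]
  have hcast : Tendsto (fun u : ℝ => (u : ℂ)) (𝓝[≠] 1) (𝓝 1) := by
    have := (Complex.continuous_ofReal.tendsto 1).mono_left (nhdsWithin_le_nhds (s := {1}ᶜ))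
    rwa [Complex.ofReal_one] at this
  have hN := (continuousAt_lineNum (k := k) (r := r) (l := l) hqc hp c1 c2 c3 hx₁0 hx₂0 hy₁0
      hy₂0).tendsto.comp hcast
  have hall := (h.tendsto_rootQuot_path hq0 hq1 k r l).mul ((tendsto_theta_div hq0 hq1 k l).mul hN)
  exact tendsto_nhds_unique ((h.tendsto_rBar_path hq0 hq1 hv).congr'
    (h.eventually_rBar_path_eq_lineNum hq0 hq1 hβ hZ hx₁ hx₂ hy₁ hy₂)) hall

theorem Generic.eq_of_isValue {q e₁ e₂ s β Z : ℝ} (hq0 : 0 < q) (hq1 : q < 1)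
    (h : Generic q e₁ e₂ s) (hβ : β ≠ 0) (hZ : Z ≠ 0) (he₁ : 0 < e₁) (he₂ : 0 < e₂) {k r l : ℤ}
    {v x₁ x₂ y₁ y₂ : ℂ} (hx₁ : x₁ = -(e₁ * q)) (hx₂ : x₂ = -(e₂ * q))
    (hy₁ : y₁ = -(β * (e₁ * Z / e₂ ^ 2) * q)) (hy₂ : y₂ = -(β * (Z / e₂) * q))
    (hv : IsValue q k r l 1 1 β Z e₁ e₂ e₁ s s v) :
    v = if k = l then qInf ((q : ℂ) ^ 2) ((q : ℂ) ^ 2) * theta ((s : ℂ) ^ 2 * q ^ 2) ((q : ℂ) ^ 2) *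
      theta ((e₂ : ℂ) / e₁) ((q : ℂ) ^ 2) *
    (-(theta (x₂ * y₁) ((q : ℂ) ^ 2) * theta (y₁ / x₁) ((q : ℂ) ^ 2) *
        theta (x₁ * s) ((q : ℂ) ^ 2) * theta (x₂ * s) ((q : ℂ) ^ 2)) *
      (theta (x₂ / x₁ * s ^ 2 * q ^ 2) ((q : ℂ) ^ 2) * (theta (x₁ * s) ((q : ℂ) ^ 2) *
          theta (y₁ * s) ((q : ℂ) ^ 2) *
          theta (x₂ / s) ((q : ℂ) ^ 2) * theta (y₂ / s) ((q : ℂ) ^ 2)) -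
        ((s : ℂ) ^ 2)⁻¹ * (theta (x₂ / x₁ * ((s : ℂ) ^ 2)⁻¹ * q ^ 2) ((q : ℂ) ^ 2) *
          (theta (x₁ / s) ((q : ℂ) ^ 2) *
          theta (y₁ / s) ((q : ℂ) ^ 2) * theta (x₂ * s) ((q : ℂ) ^ 2) *
          theta (y₂ * s) ((q : ℂ) ^ 2))))) else 0 := by
  have hp := norm_ofReal_sq_lt_one hq0 hq1
  have hqc : (q : ℂ) ≠ 0 := by exact_mod_cast hq0.ne'
  have c1 : (e₁ : ℂ) ≠ 0 := by exact_mod_cast h.ne₁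
  have c2 : (e₂ : ℂ) ≠ 0 := by exact_mod_cast h.ne₂
  have c3 : (s : ℂ) ≠ 0 := by exact_mod_cast h.ne_s
  have cβ : (β : ℂ) ≠ 0 := by exact_mod_cast hβ
  have cZ : (Z : ℂ) ≠ 0 := by exact_mod_cast hZ
  have hy₁0 : y₁ ≠ 0 := by simp [*]
  have hy₂0 : y₂ ≠ 0 := by simp [*]
  have hxy : x₁ * y₂ = x₂ * y₁ := by rw [hx₁, hx₂, hy₁, hy₂]; field_simp
  rw [h.eq_lineNum_of_isValue hq0 hq1 hβ hZ hx₁ hx₂ hy₁ hy₂ hv]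
  split_ifs with hkl
  · subst hkl
    rw [lineNum_one hqc hp c1 c2 c3 hx₁ hx₂ hy₁0 hy₂0 hxy, ← mul_assoc]
    have hR := congrArg Complex.ofReal (rootQuot_diag hq0 hq1 h he₁ he₂ k r)
    push_cast at hR
    rw [hR, one_mul]
  · simp

theorem notPow_ofReal {q x : ℝ} (h : ∀ n : ℤ, x ≠ q ^ (2 * n)) : NotPow q x := fun n hn =>
  h n (by exact_mod_cast hn)

/-- Existence supplies some value, and uniqueness of limits along the line identifies it. -/
theorem isValue_one {q e₁ e₂ e₁' e₂' s α' : ℝ} (hq0 : 0 < q) (hq1 : q < 1)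
    (h : Generic q e₁ e₂ s) (he₁ : 0 < e₁) (he₂ : 0 < e₂) (he₂' : e₂' ≠ 0)
    (he' : e₁' = e₁ * e₂' / e₂) (hα' : α' ≠ 0) (k r l : ℤ) :
    IsValue q k r l 1 1 α' (e₂ * e₂') e₁ e₂ e₁ s s
      ((-(if k = l then 1 else 0) * qInf (q ^ 2) (q ^ 2) *
        thetas [α' * e₁' * e₂ * q ^ 2, α' * (e₁' / e₁), e₂ / e₁, -e₁ * s * q,
          -e₂ * s * q, s ^ 2 * q ^ 2] (q ^ 2) *
        (thetas [e₂ / e₁ * s ^ 2 * q ^ 2, -e₁ * s * q, -α' * e₁' * s * q,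
            -e₂ * s⁻¹ * q, -α' * e₂' * s⁻¹ * q] (q ^ 2) -
          (s ^ 2)⁻¹ *
          thetas [e₂ / e₁ * (s ^ 2)⁻¹ * q ^ 2, -e₁ * s⁻¹ * q, -α' * e₁' * s⁻¹ * q,
            -e₂ * s * q, -α' * e₂' * s * q] (q ^ 2)) : ℝ) : ℂ) := by
  have hZ : e₂ * e₂' ≠ 0 := mul_ne_zero h.ne₂ he₂'
  have c1 : (e₁ : ℂ) ≠ 0 := by exact_mod_cast h.ne₁
  have c2 : (e₂ : ℂ) ≠ 0 := by exact_mod_cast h.ne₂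
  have cq : (q : ℂ) ≠ 0 := by exact_mod_cast hq0.ne'
  have ce' : (e₁' : ℂ) = e₁ * e₂' / e₂ := by exact_mod_cast he'
  obtain ⟨v, hv⟩ := h.exists_isValue hq0 hq1 hα' hZ k r l
  convert hv using 1
  rw [h.eq_of_isValue hq0 hq1 hα' hZ he₁ he₂ (x₁ := -(e₁ * q)) (x₂ := -(e₂ * q))
    (y₁ := -(α' * e₁' * q)) (y₂ := -(α' * e₂' * q)) rfl rfl
    (by rw [ce']; push_cast; field_simp) (by push_cast; field_simp) hv]
  have hr := norm_sq_lt_one hq0 hq1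
  simp only [thetas_cons, thetas_nil, mul_one, Complex.ofReal_mul, Complex.ofReal_sub,
    Complex.ofReal_neg, ofReal_theta hr, ofReal_qInf hr]
  push_cast
  split_ifs with hkl
  · rw [Complex.ofReal_one]
    have a1 : -(e₂ * q : ℂ) * -(α' * e₁' * q) = α' * e₁' * e₂ * q ^ 2 := by ring
    have a2 : -(α' * e₁' * q : ℂ) / -(e₁ * q) = α' * (e₁' / e₁) := by field_simp
    have a3 : -(e₂ * q : ℂ) / -(e₁ * q) = e₂ / e₁ := by field_simp
    rw [a1, a2, a3]
    rw [show -(e₁ * q : ℂ) * s = -e₁ * s * q by ring, show -(e₂ * q : ℂ) * s = -e₂ * s * q by ring,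
      show -(e₁ * q : ℂ) / s = -e₁ * (s : ℂ)⁻¹ * q by ring,
      show -(e₂ * q : ℂ) / s = -e₂ * (s : ℂ)⁻¹ * q by ring,
      show -(α' * e₁' * q : ℂ) * s = -α' * e₁' * s * q by ring,
      show -(α' * e₁' * q : ℂ) / s = -α' * e₁' * (s : ℂ)⁻¹ * q by ring,
      show -(α' * e₂' * q : ℂ) * s = -α' * e₂' * s * q by ring,
      show -(α' * e₂' * q : ℂ) / s = -α' * e₂' * (s : ℂ)⁻¹ * q by ring]
    ring
  · simp

/-! ### The sign symmetry behind part (2). -/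

theorem S_neg_right (q : ℝ) (n : ℤ) (A B : ℝ) : S q n A (-B) = S q n (-A) B := by
  simp only [S, inv_neg, mul_neg, neg_mul, neg_neg]

theorem S_inv_neg_right (q : ℝ) (n : ℤ) (A B : ℝ) : S q n A⁻¹ (-B) = S q n (-A)⁻¹ B := by
  rw [S_neg_right, inv_neg]

theorem rootTheta_neg_right (q e s : ℝ) : rootTheta q e (-s) = rootTheta q (-e) s := by
  simp only [rootTheta, inv_neg, mul_neg, neg_mul, neg_neg]

theorem iota_neg (s : ℝ) : iota (-s) = -iota s := by
  simp only [iota, abs_neg, neg_div]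

theorem neg_zpow_eq {K : Type*} [Field K] (x : K) (n : ℤ) : (-x) ^ n = (-1) ^ n * x ^ n := by
  rw [← mul_zpow, neg_one_mul]

theorem neg_one_zpow_mul_self {K : Type*} [Field K] (n : ℤ) : (-1 : K) ^ n * (-1) ^ n = 1 := by
  rw [← mul_zpow, neg_one_mul, neg_neg, one_zpow]

theorem neg_one_zpow_neg {K : Type*} [Field K] (n : ℤ) : (-1 : K) ^ (-n) = (-1) ^ n := by
  rw [zpow_neg, ← inv_zpow, inv_neg, inv_one]

theorem kappa_neg_left (q : ℝ) (r : ℤ) (z : ℂ) (α e₁ e₂ s₄ : ℝ) :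
    kappa q r (-z) (-α) e₁ e₂ (-s₄) = (-1) ^ r * kappa q r z α (-e₁) e₂ s₄ := by
  have h := neg_one_zpow_mul_self (K := ℂ) r
  simp only [kappa, Complex.ofReal_neg, neg_mul, neg_div, mul_neg, neg_zpow_eq z, neg_zpow_eq (α : ℂ),
    neg_zpow_eq (s₄ : ℂ), neg_one_zpow_neg]
  rw [← mul_div_assoc ((-1) ^ r)]
  congr 1
  linear_combination ((-1) ^ r * z ^ r * α ^ r * s₄ ^ (-r) * q ^ r) * h

theorem kappa_neg_right (q : ℝ) (r : ℤ) (z : ℂ) (α e₁ e₂ s₄ : ℝ) :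
    kappa q r (-z) (-α) e₂ e₁ s₄ = kappa q r z α e₂ (-e₁) s₄ := by
  have h := neg_one_zpow_mul_self (K := ℂ) r
  simp only [kappa, Complex.ofReal_neg, neg_mul, div_neg, mul_neg, neg_zpow_eq z,
    neg_zpow_eq (α : ℂ)]
  congr 1
  linear_combination (z ^ r * α ^ r * s₄ ^ (-r) * q ^ r) * h

/-- In the arguments of all products and series the sign changes match on both sides. Only integer
powers leave a sign: `κ_r` contributes `(-1) ^ r` and `z ^ (-k - r)` contributes `(-1) ^ (k + r)`.
-/
theorem R_neg_left (q : ℝ) (k r l : ℤ) (z : ℂ) (α e₁ e₂ e₃ e₄ s₃ s₄ : ℝ) :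
    R q k r l (-z) (-α) e₁ e₂ e₃ e₄ s₃ (-s₄) =
      (-1) ^ k * R q k r l z α (-e₁) e₂ e₃ (-e₄) s₃ s₄ := by
  have h := neg_one_zpow_mul_self (K := ℂ) r
  have hs : (-1 : ℂ) ^ (-k - r) = (-1) ^ k * (-1) ^ r := by
    rw [show -k - r = -k + -r by ring, zpow_add₀ (by norm_num), neg_one_zpow_neg, neg_one_zpow_neg]
  have e : S q l e₁ (-α * s₃) = S q l (-e₁) (α * s₃) := by rw [neg_mul, S_neg_right]
  have e' : S q (l + r) e₂ (-α * -s₄) = S q (l + r) e₂ (α * s₄) := by rw [neg_mul_neg]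
  rw [R, R, kappa_neg_left, S_inv_neg_right, e, e', neg_zpow_eq z, hs,
    show (-1) ^ r * kappa q r z α (-e₁) e₂ s₄ * ((-1) ^ k * (-1) ^ r * z ^ (-k - r)) =
      (-1) ^ k * (kappa q r z α (-e₁) e₂ s₄ * z ^ (-k - r)) by
      linear_combination ((-1) ^ k * (kappa q r z α (-e₁) e₂ s₄ * z ^ (-k - r))) * h]
  simp only [Complex.ofReal_neg, neg_mul, neg_div, div_neg, mul_neg, neg_neg, inv_neg, neg_sq]
  ring

theorem R_neg_right (q : ℝ) (k r l : ℤ) (z : ℂ) (α e₁ e₂ e₃ e₄ s₃ s₄ : ℝ) :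
    R q (k + r) (-r) (l + r) (-z) (-α) e₂ e₁ e₄ e₃ (-s₄) s₃ =
      (-1) ^ k * R q (k + r) (-r) (l + r) z α e₂ (-e₁) (-e₄) e₃ s₄ s₃ := by
  have hs : (-1 : ℂ) ^ (-(k + r) - -r) = (-1) ^ k := by
    rw [show -(k + r) - -r = -k by ring, neg_one_zpow_neg]
  have e : S q (l + r + -r) e₁ (-α * s₃) = S q (l + r + -r) (-e₁) (α * s₃) := by
    rw [neg_mul, S_neg_right]
  have e' : S q (l + r) e₂ (-α * -s₄) = S q (l + r) e₂ (α * s₄) := by rw [neg_mul_neg]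
  rw [R, R, kappa_neg_right, S_inv_neg_right, e, e', neg_zpow_eq z, hs]
  simp only [Complex.ofReal_neg, neg_mul, neg_div, div_neg, mul_neg, neg_neg, inv_neg]
  ring

theorem c_neg_left (q : ℝ) (z : ℂ) (e₃ e₄ s₃ s₄ : ℝ) :
    c q (-z) e₃ e₄ s₃ (-s₄) = c q z e₃ (-e₄) s₃ s₄ := by
  simp only [c, rootTheta_neg_right, Complex.ofReal_neg, neg_mul, neg_div, mul_neg, neg_neg]

theorem c_neg_right (q : ℝ) (z : ℂ) (e₃ e₄ s₃ s₄ : ℝ) :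
    c q (-z) e₄ e₃ (-s₄) s₃ = c q z (-e₄) e₃ s₄ s₃ := by
  simp only [c, Complex.ofReal_neg, neg_mul, div_neg, mul_neg, neg_neg]

theorem rPart_neg_left (q : ℝ) (k r l : ℤ) (z : ℂ) (α β Z e₁ e₂ e₃ e₄ s₃ s₄ : ℝ) :
    rPart q k r l (-z) (-α) (-β) Z e₁ e₂ e₃ e₄ s₃ (-s₄) =
      (-1) ^ k * rPart q k r l z α β (-Z) (-e₁) e₂ e₃ (-e₄) s₃ s₄ := by
  simp only [rPart, c_neg_left, R_neg_left, Complex.ofReal_neg, neg_mul, neg_div, mul_neg, neg_neg,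
    inv_neg]
  ring

theorem rPart_neg_right (q : ℝ) (k r l : ℤ) (z : ℂ) (α β Z e₁ e₂ e₃ e₄ s₃ s₄ : ℝ) :
    rPart q (k + r) (-r) (l + r) (-z) (-α) (-β) Z e₂ e₁ e₄ e₃ (-s₄) s₃ =
      (-1) ^ k * rPart q (k + r) (-r) (l + r) z α β (-Z) e₂ (-e₁) (-e₄) e₃ s₄ s₃ := by
  simp only [rPart, c_neg_right, R_neg_right, Complex.ofReal_neg, neg_mul, neg_div, div_neg,
    mul_neg, neg_neg, inv_neg]
  ring

theorem rElt_neg_left (q : ℝ) (k r l : ℤ) (z : ℂ) (α β Z e₁ e₂ e₃ e₄ s₃ s₄ : ℝ) :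
    rElt q k r l (-z) (-α) (-β) Z e₁ e₂ e₃ e₄ s₃ (-s₄) =
      (-1) ^ k * rElt q k r l z α β (-Z) (-e₁) e₂ e₃ (-e₄) s₃ s₄ := by
  rw [rElt, rElt, inv_neg, rPart_neg_left, rPart_neg_left]
  ring

/-- The extra minus sign comes from `ι(s₄)`, since `s₄` takes the place of `s₃` in `r̊`. In `r̄` the
explicit factor `ι(s₄)` compensates it. -/
theorem rRing_neg (q : ℝ) (k r l : ℤ) (z : ℂ) (α β Z e₁ e₂ e₃ e₄ s₃ s₄ : ℝ) :
    rRing q k r l (-z) (-α) (-β) Z e₁ e₂ e₃ e₄ s₃ (-s₄) =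
      -((-1) ^ k * rRing q k r l z α β (-Z) (-e₁) e₂ e₃ (-e₄) s₃ s₄) := by
  rw [rRing, rRing, rElt, rElt, rPart_neg_right, rPart_neg_right, iota_neg, rootTheta_neg_right,
    neg_sq, neg_mul Z, neg_div]
  push_cast
  ring

theorem rBar_neg (q : ℝ) (k r l : ℤ) (z : ℂ) (α β Z e₁ e₂ e₃ e₄ s₃ s₄ : ℝ) :
    rBar q k r l (-z) (-α) (-β) Z e₁ e₂ e₃ e₄ s₃ (-s₄) =
      (-1) ^ k * rBar q k r l z α β (-Z) (-e₁) e₂ e₃ (-e₄) s₃ s₄ := by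
  simp only [rBar, rElt_neg_left, rRing_neg, iota_neg, Complex.ofReal_neg, neg_mul, neg_div,
    div_neg, mul_neg, neg_neg, inv_neg, Complex.ofReal_div, Complex.ofReal_mul]
  ring_nf

theorem neg_mem_regularSet {q α e₁ e₂ s : ℝ} {y : ℂ × ℝ × ℝ} :
    -y ∈ regularSet q α (-e₁) e₂ s ↔ y ∈ regularSet q (-α) e₁ e₂ s := by
  obtain ⟨z, e, t⟩ := y
  simp only [regularSet, Set.mem_ofPred_eq, Prod.neg_mk, Set.mem_insert_iff, Set.mem_singleton_iff,
    forall_eq_or_imp, forall_eq, Complex.ofReal_neg, neg_mul, neg_div, div_neg, mul_neg, neg_neg,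
    inv_neg, Complex.ofReal_div, Complex.ofReal_mul, neg_sq, ne_eq, neg_eq_zero]

/-- On `(z, e₄, s₄)` the symmetry is the homeomorphism `y ↦ -y`, which matches the two regular sets,
and `e₃ = e₂ e₄ / e₁` is unchanged when `e₁` and `e₄` both change sign. Closure points and limits
are thus transported. -/
theorem IsValue.neg {q α β Z e₁ e₂ e₄ s₃ s₄ : ℝ} {k r l : ℤ} {z v : ℂ}
    (h : IsValue q k r l z α β (-Z) (-e₁) e₂ (-e₄) s₃ s₄ v) :
    IsValue q k r l (-z) (-α) (-β) Z e₁ e₂ e₄ s₃ (-s₄) ((-1) ^ k * v) := by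
  obtain ⟨h1, h2⟩ := h
  have hpt : -((-z, e₄, -s₄) : ℂ × ℝ × ℝ) = (z, -e₄, s₄) := by simp
  have hset : regularSet q (-α) e₁ e₂ s₃ = Neg.neg ⁻¹' regularSet q α (-e₁) e₂ s₃ := by
    ext y
    exact neg_mem_regularSet.symm
  refine ⟨?_, ?_⟩
  · have h3 : ((-z, e₄, -s₄) : ℂ × ℝ × ℝ) ∈
        Homeomorph.neg (ℂ × ℝ × ℝ) ⁻¹' closure (regularSet q α (-e₁) e₂ s₃) := by
      rw [Set.mem_preimage, Homeomorph.coe_neg]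
      rwa [hpt]
    rw [Homeomorph.preimage_closure] at h3
    rwa [hset]
  · have hneg : Tendsto (fun y : ℂ × ℝ × ℝ => -y)
        (𝓝[regularSet q (-α) e₁ e₂ s₃] (-z, e₄, -s₄))
        (𝓝[regularSet q α (-e₁) e₂ s₃] (z, -e₄, s₄)) := by
      refine tendsto_nhdsWithin_iff.2 ⟨?_, ?_⟩
      · rw [← hpt]
        exact (continuous_neg.tendsto _).mono_left nhdsWithin_le_nhds
      · filter_upwards [self_mem_nhdsWithin] with y hy
        exact neg_mem_regularSet.2 hy
    refine ((h2.comp hneg).const_mul ((-1 : ℂ) ^ k)).congr fun y => ?_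
    obtain ⟨z', e', t⟩ := y
    have := rBar_neg q k r l (-z') α β Z e₁ e₂ (e₂ * e' / e₁) e' s₃ (-t)
    rw [neg_neg, neg_neg] at this
    simp only [Function.comp, Prod.neg_mk, mul_neg, neg_div_neg_eq, this]

theorem Admissible.neg_left {q e s : ℝ} (h : Admissible q e (-s)) : Admissible q (-e) s := by
  intro n
  have := h n
  rw [inv_neg] at this
  simpa only [mul_neg, neg_mul] using this

theorem notPow_of_neg {q x : ℝ} (hq0 : 0 < q) (hx : x < 0) : NotPow q x :=
  notPow_ofReal fun _ => (hx.trans (zpow_pos hq0 _)).ne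

theorem generic_of_pos {q e₁ e₂ s : ℝ} (he₁ : 0 < e₁) (he₂ : 0 < e₂)
    (hs : s ≠ 0) (hs2 : ∀ n : ℤ, s ^ 2 ≠ q ^ (2 * n)) (h₁ : Admissible q e₁ s)
    (h₂ : Admissible q e₂ s) (hr : ∀ n : ℤ, e₂ / e₁ ≠ q ^ (2 * n))
    (hm : ∀ n : ℤ, e₂ / e₁ * s ^ 2 ≠ q ^ (2 * n)) (hd : ∀ n : ℤ, e₂ / e₁ / s ^ 2 ≠ q ^ (2 * n)) :
    Generic q e₁ e₂ s where
  ne₁ := he₁.ne'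
  ne₂ := he₂.ne'
  ne_s := hs
  adm₁ := h₁
  adm₂ := h₂
  ratio := by simpa using notPow_ofReal hr
  ratio_mul := by simpa using notPow_ofReal hm
  ratio_div := by simpa using notPow_ofReal hd
  sq := by simpa using notPow_ofReal hs2

/-- For `e₁ < 0 < e₂` the ratio and its multiples by `s ^ (±2)` are negative, hence never powers of
`q ^ 2`. -/
theorem generic_of_neg {q e₁ e₂ s : ℝ} (hq0 : 0 < q) (he₁ : e₁ < 0) (he₂ : 0 < e₂)
    (hs : s ≠ 0) (hs2 : ∀ n : ℤ, s ^ 2 ≠ q ^ (2 * n)) (h₁ : Admissible q e₁ s)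
    (h₂ : Admissible q e₂ s) : Generic q e₁ e₂ s where
  ne₁ := he₁.ne
  ne₂ := he₂.ne'
  ne_s := hs
  adm₁ := h₁
  adm₂ := h₂
  ratio := by simpa using notPow_of_neg hq0 (div_neg_of_pos_of_neg he₂ he₁)
  ratio_mul := by
    simpa using notPow_of_neg hq0 (mul_neg_of_neg_of_pos (div_neg_of_pos_of_neg he₂ he₁)
      (by positivity : 0 < s ^ 2))
  ratio_div := by
    simpa using notPow_of_neg hq0 (div_neg_of_neg_of_pos (div_neg_of_pos_of_neg he₂ he₁)
      (by positivity : 0 < s ^ 2))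
  sq := by simpa using notPow_ofReal hs2

end QInt

theorem proposition1
    -- `e₁ = q ^ (2 ε₁)`, `e₂ = q ^ (2 ε₂)`, `e₁' = q ^ (2 ε₁')`, `e₂' = q ^ (2 ε₂')`,
    -- `s = q ^ (2 σ₃)`
    (q : ℝ) (hq0 : 0 < q) (hq1 : q < 1)
    (e₁ e₂ e₁' e₂' s α' : ℝ) (he₁ : 0 < e₁) (he₂ : 0 < e₂) (he₁' : 0 < e₁') (he₂' : 0 < e₂')
    (he' : e₂' / e₁' = e₂ / e₁) (hs : s ≠ 0)
    (hα' : α' = 1 ∨ α' = -1)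
    (hs2 : ∀ n : ℤ, s ^ 2 ≠ q ^ (2 * n))
    (k r l : ℤ) :
    -- the case `z = α = 1`, `s₄ = s₃`
    (QInt.Admissible q e₁ s → QInt.Admissible q e₂ s →
      (∀ n : ℤ, e₂ / e₁ ≠ q ^ (2 * n)) →
      (∀ n : ℤ, e₂ / e₁ * s ^ 2 ≠ q ^ (2 * n)) →
      (∀ n : ℤ, e₂ / e₁ / s ^ 2 ≠ q ^ (2 * n)) →
      QInt.IsValue q k r l 1 1 α' (e₂ * e₂') e₁ e₂ e₁ s s
        ((-(if k = l then 1 else 0) * QInt.qInf (q ^ 2) (q ^ 2) *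
          QInt.thetas [α' * e₁' * e₂ * q ^ 2, α' * (e₁' / e₁), e₂ / e₁, -e₁ * s * q,
            -e₂ * s * q, s ^ 2 * q ^ 2] (q ^ 2) *
          (QInt.thetas [e₂ / e₁ * s ^ 2 * q ^ 2, -e₁ * s * q, -α' * e₁' * s * q,
              -e₂ * s⁻¹ * q, -α' * e₂' * s⁻¹ * q] (q ^ 2) -
            (s ^ 2)⁻¹ *
            QInt.thetas [e₂ / e₁ * (s ^ 2)⁻¹ * q ^ 2, -e₁ * s⁻¹ * q, -α' * e₁' * s⁻¹ * q,
              -e₂ * s * q, -α' * e₂' * s * q] (q ^ 2)) : ℝ) : ℂ)) ∧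
    -- the case `z = α = -1`, `s₄ = -s₃`
    (QInt.Admissible q e₁ (-s) → QInt.Admissible q e₂ s →
      ∃ v : ℂ,
        QInt.IsValue q k r l 1 1 α' (-(e₂ * e₂')) (-e₁) e₂ (-e₁) s s v ∧
        QInt.IsValue q k r l (-1) (-1) (-α') (e₂ * e₂') e₁ e₂ e₁ s (-s) ((-1) ^ k * v)) := by
  have ha : α' ≠ 0 := by rcases hα' with rfl | rfl <;> norm_num
  refine ⟨fun h₁ h₂ hr hm hd => ?_, fun h₁ h₂ => ?_⟩
  · exact QInt.isValue_one hq0 hq1 (QInt.generic_of_pos he₁ he₂ hs hs2 h₁ h₂ hr hm hd) he₁ he₂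
      he₂'.ne' (by field_simp at he' ⊢; linarith) ha k r l
  · have hg := QInt.generic_of_neg hq0 (neg_neg_of_pos he₁) he₂ hs hs2 h₁.neg_left h₂
    obtain ⟨v, hv⟩ := hg.exists_isValue hq0 hq1 ha
      (neg_ne_zero.2 (mul_ne_zero he₂.ne' he₂'.ne')) k r l
    exact ⟨v, hv, hv.neg⟩
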